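/- Graphs are finite and simple. A \emph{fixed point free} (FPF) automorphism of a graph is an automorphism $\phi$ with $\phi(v)\neq v$ for every vertex $v$. For a graph $H$, a coloring $c:V(H)\to\{1,\dots,|V(H)|\}$ and a function $b:V(H)\to\{0,1\}$, a $\mathrm{PFPF}_b$ automorphism of $(H,c)$ is an automorphism $\phi$ of $H$ with $c(\phi(v))=c(v)$ for all $v$ such that $\phi(v)=v$ only if $b(v)=1$. A \emph{module} of a graph $G$ is a set $M$ of vertices such that every vertex outside $M$ is adjacent to all or to none of the vertices of $M$. Two sets \emph{overlap} if they intersect and neither contains the other; a module is \emph{strong} if it overlaps no module. If $|V(G)|\ge 2$, the inclusion-maximal ones among the nonempty strong modules $M\neq V(G)$ form a partition $\mathcal P$ of $V(G)$, the \emph{maximal modular partition}. The quotient graph $G_{/\mathcal P}$ has the parts of $\mathcal P$ as vertices, two distinct parts being adjacent iff all vertices of the one are adjacent to all vertices of the other in $G$. For a graph class $\mathcal G$ (closed under isomorphism) let $\mathcal G_{/\mathcal P}$ be the class of all graphs isomorphic to $G_{/\mathcal P}$ for some $G\in\mathcal G$ with $|V(G)|\ge2$. The class $\mathcal G$ is \emph{hereditary}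 if it contains every induced subgraph of each of its members. Running time is the number of steps of a deterministic (multi-stack, equivalently multi-tape) Turing machine; graphs are given by adjacency matrices, and a machine need only be correct on instances from the class in question. A problem on graphs is \emph{decided in time $t$} if a single machine decides all its instances and, for every $n$, makes at most $t(n)$ steps on every instance whose graphs have at most $n$ vertices. \textbf{Lemma.} There is a polynomial $p$ with non-negative integer coefficients such that the following holds for every hereditary graph class $\mathcal G$ and all functions $f_{\mathrm{iso}},f_{\mathrm{pfpf}}:\mathbb N\to\mathbb N$. Suppose that isomorphism of two graphs $G,H\in\mathcal G$ can be decided in time $f_{\mathrm{iso}}$, and that it can be decided in time $f_{\mathrm{pfpf}}$, given a graph $H\in\mathcal G_{/\mathcal P}$, an arbitrary coloring $c:V(H)\to\{1,\dots,|V(H)|\}$ and an arbitrary $b:V(H)\to\{0,1\}$, whether $(H,c)$ has a $\mathrm{PFPF}_b$ automorphism. Then it can be decided in time \[ n\longmapsto p(n)\,\bigl(f_{\mathrm{iso}}(n)+f_{\mathrm{pfpf}}(n)\bigr) \] whether a graph $G\in\mathcal G$ has a fixed point free automorphism; that is, FPFAut on $n$-vertex graphs of $\mathcal G$ is solvable in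 time $n^{O(1)}\,(f_{\mathrm{iso}}^{\mathcal G}(n)+f_{\mathrm{pfpf}}^{\mathcal G_{/\mathcal P}}(n))$. -/

import Mathlib

namespace FPFAut

/-! ### Modules and the maximal modular partition -/

section Modules

variable {V : Type*} (G : SimpleGraph V)

/-- `M` is a module: no vertex outside `M` splits `M`. -/
def IsModule (M : Set V) : Prop :=
  ∀ u, u ∉ M → ∀ v ∈ M, ∀ w ∈ M, G.Adj u v → G.Adj u w

/-- Two vertex sets overlap. -/
def Overlap (M M' : Set V) : Prop :=
  (M ∩ M').Nonempty ∧ (M \ M').Nonempty ∧ (M' \ M).Nonempty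

/-- A module is strong if it overlaps no module. -/
def IsStrongModule (M : Set V) : Prop :=
  IsModule G M ∧ ∀ M', IsModule G M' → ¬ Overlap M M'

/-- The parts of the maximal modular partition: the inclusion-maximal elements among the nonempty
strong modules different from the whole vertex set. For a finite graph with at least two vertices
they partition the vertex set. -/
def maximalModularPartition : Set (Set V) :=
  {M | Maximal (fun N : Set V => IsStrongModule G N ∧ N.Nonempty ∧ N ≠ Set.univ) M}

/-- The quotient graph of the maximal modular partition: its vertices are the parts, and two
distinct parts are adjacent iff every vertex of one is adjacent to every vertex of the other. -/
def quotientGraph : SimpleGraph (maximalModularPartition G) :=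
  SimpleGraph.fromRel fun M N => ∀ u ∈ M.1, ∀ v ∈ N.1, G.Adj u v

end Modules

/-! ### Automorphisms -/

section Automorphisms

variable {V : Type*} (G : SimpleGraph V)

/-- `G` has a fixed point free automorphism. -/
def HasFPFAut : Prop :=
  ∃ φ : G ≃g G, ∀ v, φ v ≠ v

/-- `(G, c)` has a colour preserving automorphism all of whose fixed points `v` satisfy
`b v = true`. -/
def HasPFPFAut {C : Type*} (c : V → C) (b : V → Bool) : Prop :=
  ∃ φ : G ≃g G, (∀ v, c (φ v) = c v) ∧ ∀ v, φ v = v → b v = true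

end Automorphisms

/-! ### Classes of finite graphs -/

/-- A finite graph, with vertex set `{0, …, n - 1}`. -/
structure FinGraph where
  /-- the number of vertices -/
  n : ℕ
  /-- the graph -/
  graph : SimpleGraph (Fin n)

/-- A class of finite graphs is hereditary if it contains (every isomorphic copy of) every induced
subgraph of each of its members. -/
def IsHereditary (𝒢 : Set FinGraph) : Prop :=
  ∀ G ∈ 𝒢, ∀ H : FinGraph, Nonempty (H.graph ↪g G.graph) → H ∈ 𝒢

/-- The class of (isomorphic copies of) the quotient graphs of the members of `𝒢`. Graphs with
fewer than two vertices have no maximal modular partition. -/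
def quotientClass (𝒢 : Set FinGraph) : Set FinGraph :=
  {H | ∃ G ∈ 𝒢, 2 ≤ G.n ∧ Nonempty (H.graph ≃g quotientGraph G.graph)}

/-! ### Decision problems and Turing machine time -/

/-- The tape alphabet for inputs: two bits `some false`, `some true` and a separator `none`. -/
abbrev Symb : Type := Option Bool

/-- A decision problem: a type of instances, their encoding as words, a numerical size parameter,
and the property that is to be decided. -/
structure DecisionProblem where
  /-- the instances -/
  Inst : Type
  /-- the encoding of the instances -/
  encode : Inst → List Symb
  /-- the size in terms of which the running time is measured -/
  size : Inst → ℕ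
  /-- the yes-instances -/
  IsYes : Inst → Prop

open Classical in
/-- The problem `P` can be decided in time `t`: some (multi-stack) Turing machine, started on the
encoding of any instance `x` of `P`, halts with the correct one-bit answer, and for every `n` it
makes at most `t n` steps on every instance of size at most `n`. -/
def DecidableInTime (P : DecisionProblem) (t : ℕ → ℕ) : Prop :=
  ∃ M : Turing.TM2ComputableAux Symb Bool, ∀ (n : ℕ) (x : P.Inst), P.size x ≤ n →
    Nonempty (Turing.TM2OutputsInTime M.tm
      ((P.encode x).map M.inputAlphabet.symm)
      (some [M.outputAlphabet.symm (decide (P.IsYes x))])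
      (t n))

open Classical in
/-- A graph is encoded by its number of vertices in unary, a separator, and the rows of its
adjacency matrix. -/
noncomputable def encodeGraph (G : FinGraph) : List Symb :=
  List.replicate G.n (some true) ++ [none] ++
    (List.ofFn fun i => List.ofFn fun j => some (decide (G.graph.Adj i j))).flatten

/-- A colouring is encoded by the colours of the successive vertices, in unary, each followed by a
separator. -/
def encodeColoring {n : ℕ} (c : Fin n → Fin n) : List Symb :=
  (List.ofFn fun i => List.replicate (c i : ℕ) (some true) ++ [none]).flatten

/-- A Boolean function is encoded by the list of its values. -/
def encodeBoolFun {n : ℕ} (b : Fin n → Bool) : List Symb :=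
  List.ofFn fun i => some (b i)

/-- Graph isomorphism for two graphs from `𝒢`, measured in the larger number of vertices. -/
noncomputable def isoProblem (𝒢 : Set FinGraph) : DecisionProblem where
  Inst := 𝒢 × 𝒢
  encode x := encodeGraph x.1.1 ++ encodeGraph x.2.1
  size x := max x.1.1.n x.2.1.n
  IsYes x := Nonempty (x.1.1.graph ≃g x.2.1.graph)

/-- The partial fixed point free automorphism problem for graphs from `𝒢`: given `G ∈ 𝒢` with `n`
vertices, a colouring `c` with `n` colours and a Boolean function `b` on the vertices, does
`(G, c)` have an automorphism that fixes a vertex `v` only if `b v = true`? -/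
noncomputable def pfpfProblem (𝒢 : Set FinGraph) : DecisionProblem where
  Inst := Σ G : 𝒢, (Fin G.1.n → Fin G.1.n) × (Fin G.1.n → Bool)
  encode x := encodeGraph x.1.1 ++ encodeColoring x.2.1 ++ encodeBoolFun x.2.2
  size x := x.1.1.n
  IsYes x := HasPFPFAut x.1.1.graph x.2.1 x.2.2

/-- The fixed point free automorphism problem for graphs from `𝒢`. -/
noncomputable def fpfProblem (𝒢 : Set FinGraph) : DecisionProblem where
  Inst := 𝒢
  encode G := encodeGraph G.1
  size G := G.1.n
  IsYes G := HasFPFAut G.1.graph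

end FPFAut

/-! Mathematical core. Let `X` be a strong module of `G` with at least two vertices. The parts of
the maximal modular partition of `G[X]` are again strong modules of `G`, with fewer vertices than
`X`. An automorphism of `G[X]` permutes the parts, sends each part to an isomorphic one, and
restricts to an automorphism on every part that it preserves. Conversely, adjacency between distinct
parts depends only on the parts, so an automorphism of the quotient that respects isomorphism types
can be combined with arbitrary isomorphisms between the parts. Between distinct parts such
isomorphisms move every vertex; on a preserved part a fixed point free one is needed. Hence `G[X]`
has a fixed point free automorphism iff its quotient has a PFPF_b automorphism, where the colours
are the isomorphism types of the parts and `b` marks the parts that themselves have a fixed point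
free automorphism (`hasFPFAut_iff_hasPFPFAut`). As the class is hereditary, the parts are legal
inputs for the isomorphism test, and the quotient of `G[X]` is a legal input for the PFPF test.

This gives a dynamic program over strong modules. Every nonempty strong module is the smallest
strong module containing some pair `u, v` (`IsStrongModule.exists_eq_strongClosure`), so a table
indexed by pairs covers all of them. These closures are computed by at most `n` rounds of a monotone
step, first for modules and then for strong modules (`isStrongModule_strongClosure`). The
isomorphism oracle is then asked at most `n ^ 4` times. In `n` further rounds the PFPF oracle is
asked for every pair `u ≠ v`; after `m` rounds the entries of all strong modules with at most `m`
vertices are correct (`solved_fpfCmd`). The answer is the entry of the whole vertex set.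

Machine model. Everything apart from the oracle calls is first-order definable over tables of arity
at most 4, with loops of length `n`. A small language of formulas (`Fm`), word descriptions (`Em`)
and commands (`Cmd`) is therefore interpreted by stack programs (`Low`), with time bounds `p(n) *
T`, where `T` bounds a single oracle call (`Cmd.exec`). Stack programs are compiled to one Turing
machine that contains the oracle machines as subroutines (`Exec.reachesIn`). A halting oracle
machine is back in its initial state with all stacks but its output empty, so it can be called
again. -/

namespace FPFAut

/-! ### Oracle stack programs and their compilation to Turing machines. -/

open Turing Function

/-! ### Bounded evaluation -/

/-- `f` leads from `a` to `b` in at most `t` steps. -/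
def ReachesIn {α : Type*} (f : α → Option α) (a b : α) (t : ℕ) : Prop :=
  Nonempty (StateTransition.EvalsToInTime f a (some b) t)

namespace ReachesIn

variable {α : Type*} {f : α → Option α} {a b c : α} {t t' : ℕ}

theorem refl : ReachesIn f a a 0 := ⟨StateTransition.EvalsToInTime.refl f a⟩

theorem trans (h : ReachesIn f a b t) (h' : ReachesIn f b c t') : ReachesIn f a c (t + t') := by
  obtain ⟨h⟩ := h
  obtain ⟨h'⟩ := h'
  exact ⟨Nat.add_comm t t' ▸ StateTransition.EvalsToInTime.trans f t t' a b _ h h'⟩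

theorem single (h : f a = some b) : ReachesIn f a b 1 :=
  ⟨⟨⟨1, by simpa [flip] using h⟩, le_rfl⟩⟩

theorem mono (h : ReachesIn f a b t) (ht : t ≤ t') : ReachesIn f a b t' := by
  obtain ⟨h⟩ := h
  exact ⟨⟨h.toEvalsTo, h.steps_le_m.trans ht⟩⟩

theorem head (h : f a = some b) (h' : ReachesIn f b c t) : ReachesIn f a c (t + 1) :=
  ((single h).trans h').mono (by omega)

end ReachesIn

theorem iterate_flip_bind_none {α : Type*} (f : α → Option α) (m : ℕ) :
    (flip bind f)^[m] (none : Option α) = none := by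
  induction m with
  | zero => rfl
  | succ m ih => rw [iterate_succ_apply]; exact ih

/-! ### Stack programs with oracle calls -/

/-- Structured programs over stacks indexed by `K`, with oracles indexed by `O`. -/
inductive Low (K O : Type) : Type
  /-- do nothing -/
  | skip : Low K O
  /-- push a symbol -/
  | push : K → Symb → Low K O
  /-- pop a symbol and continue depending on it -/
  | pop : K → (Option Symb → Low K O) → Low K O
  /-- sequential composition -/
  | seq : Low K O → Low K O → Low K O
  /-- pop symbols until the stack is empty, running a program after each pop -/
  | loop : K → (Symb → Low K O) → Low K O
  /-- ask an oracle about the reversed contents of a stack, pushing the answer on another one -/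
  | call : O → K → K → Low K O

section Low

variable {K O : Type} [DecidableEq K]

/-- Execution of a stack program within a number of steps; `A o w b t` says that oracle `o` answers
`b` on `w` within `t` steps. -/
inductive Exec (A : O → List Symb → Bool → ℕ → Prop) :
    Low K O → (K → List Symb) → (K → List Symb) → ℕ → Prop
  | skip (s) : Exec A .skip s s 1
  | push (k a s) : Exec A (.push k a) s (update s k (a :: s k)) 1
  | pop {k f s s' t} : Exec A (f (s k).head?) (update s k (s k).tail) s' t →
      Exec A (.pop k f) s s' (t + 1)
  | seq {p q s s' s'' t t'} : Exec A p s s' t → Exec A q s' s'' t' →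
      Exec A (.seq p q) s s'' (t + t')
  | loop_nil {k f s} : s k = [] → Exec A (.loop k f) s s 1
  | loop_cons {k f s s' s'' a l t t'} : s k = a :: l → Exec A (f a) (update s k l) s' t →
      Exec A (.loop k f) s' s'' t' → Exec A (.loop k f) s s'' (t + t' + 1)
  -- Moving the word symbol by symbol to the input stack of the oracle reverses it. This takes `(s
  -- k).length + 1` steps, the last one noticing the empty stack; fetching the answer takes one
  -- more.
  | call {o k k' s b t} : A o (s k).reverse b t →
      Exec A (.call o k k') s
        (update (update s k []) k' (some b :: update s k [] k')) (t + (s k).length + 2)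
  | weaken {p s s' t t'} : Exec A p s s' t → t ≤ t' → Exec A p s s' t'

end Low

/-! ### Compilation to Turing machines -/

section Compile

set_option linter.unusedSectionVars false

variable {K O : Type} [DecidableEq K] [DecidableEq O] [Fintype K] [Fintype O]
variable (M : O → TM2ComputableAux Symb Bool)

/-- The stacks of the compiled machine: an output stack, the stacks of the program, and the stacks
of the oracle machines. -/
abbrev BigK (K : Type) (M : O → TM2ComputableAux Symb Bool) : Type :=
  Unit ⊕ K ⊕ Σ o, (M o).tm.K

/-- The stack alphabets of the compiled machine. -/
def BigΓ : BigK K M → Type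
  | .inl _ => Bool
  | .inr (.inl _) => Symb
  | .inr (.inr x) => (M x.1).tm.Γ x.2

/-- The internal states of the compiled machine. -/
abbrev Bigσ : Type := Option Symb × ((o : O) → (M o).tm.σ)

/-- The initial internal state of the compiled machine. -/
def bigInit : Bigσ M := (none, fun o => (M o).tm.initialState)

/-- The stack contents of the compiled machine. -/
def bigStk (out : List Bool) (s : K → List Symb)
    (Q : (o : O) → (k : (M o).tm.K) → List ((M o).tm.Γ k)) : (k : BigK K M) → List (BigΓ M k)
  | .inl _ => out
  | .inr (.inl k) => s k
  | .inr (.inr x) => Q x.1 x.2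

/-- The contents of the oracle stacks when no oracle is active. -/
def noQ (o : O) (k : (M o).tm.K) : List ((M o).tm.Γ k) := []

theorem update_bigStk_out (out out' : List Bool) (s : K → List Symb) (Q) :
    update (bigStk M out s Q) (.inl ()) out' = bigStk M out' s Q := by
  funext k
  rcases k with _ | k | x <;> rfl

theorem update_bigStk_reg (out : List Bool) (s : K → List Symb) (Q) (k : K) (l : List Symb) :
    update (bigStk M out s Q) (.inr (.inl k)) l = bigStk M out (update s k l) Q := by
  funext k'
  rcases k' with _ | k' | x
  · rfl
  · by_cases h : k' = k
    · subst h
      exact (update_self ..).trans (update_self (β := fun _ => List Symb) ..).symm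
    · exact (update_of_ne (by simpa using h) _ _).trans
        (update_of_ne (β := fun _ => List Symb) h _ _).symm
  · rfl

theorem update_bigStk_orc (out : List Bool) (s : K → List Symb)
    (Q : (o : O) → (k : (M o).tm.K) → List ((M o).tm.Γ k)) (o : O) (k : (M o).tm.K) (l) :
    update (bigStk M out s Q) (.inr (.inr ⟨o, k⟩)) l =
      bigStk M out s (update Q o (update (Q o) k l)) := by
  funext k'
  rcases k' with _ | k' | ⟨o', k'⟩
  · rfl
  · rfl
  · by_cases h : o' = o
    · subst h
      have h1 : update Q o' (update (Q o') k l) o' = update (Q o') k l := update_self ..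
      refine Eq.trans ?_ (congrFun h1 k').symm
      by_cases h' : k' = k
      · subst h'
        exact (update_self ..).trans (update_self (β := fun k => List ((M o').tm.Γ k)) ..).symm
      · exact (update_of_ne (by simpa using h') _ _).trans (update_of_ne h' _ _).symm
    · have h1 : update Q o (update (Q o) k l) o' = Q o' := update_of_ne h ..
      exact (update_of_ne (by simp [h]) _ _).trans (congrFun h1 k').symm

/-! #### Statements of the compiled machine -/

section Statements

variable {M} {Λ : Type}

/-- Push a symbol on a stack of the program. -/
def pushReg (k : K) (f : Bigσ M → Symb) (q : TM2.Stmt (BigΓ (K := K) M) Λ (Bigσ M)) :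
    TM2.Stmt (BigΓ (K := K) M) Λ (Bigσ M) :=
  .push (.inr (.inl k)) f q

/-- Pop a stack of the program into the internal memory. -/
def popReg (k : K) (q : TM2.Stmt (BigΓ (K := K) M) Λ (Bigσ M)) :
    TM2.Stmt (BigΓ (K := K) M) Λ (Bigσ M) :=
  .pop (.inr (.inl k)) (fun v (x : Option Symb) => (x, v.2)) q

/-- Push a symbol on an oracle stack. -/
def pushOrc (o : O) (k : (M o).tm.K) (f : Bigσ M → (M o).tm.Γ k)
    (q : TM2.Stmt (BigΓ (K := K) M) Λ (Bigσ M)) : TM2.Stmt (BigΓ (K := K) M) Λ (Bigσ M) :=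
  .push (.inr (.inr ⟨o, k⟩)) f q

/-- Peek at an oracle stack. -/
def peekOrc (o : O) (k : (M o).tm.K) (f : Bigσ M → Option ((M o).tm.Γ k) → Bigσ M)
    (q : TM2.Stmt (BigΓ (K := K) M) Λ (Bigσ M)) : TM2.Stmt (BigΓ (K := K) M) Λ (Bigσ M) :=
  .peek (.inr (.inr ⟨o, k⟩)) f q

/-- Pop an oracle stack. -/
def popOrc (o : O) (k : (M o).tm.K) (f : Bigσ M → Option ((M o).tm.Γ k) → Bigσ M)
    (q : TM2.Stmt (BigΓ (K := K) M) Λ (Bigσ M)) : TM2.Stmt (BigΓ (K := K) M) Λ (Bigσ M) :=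
  .pop (.inr (.inr ⟨o, k⟩)) f q

/-- Push a bit on the output stack. -/
def pushOut (f : Bigσ M → Bool) (q : TM2.Stmt (BigΓ (K := K) M) Λ (Bigσ M)) :
    TM2.Stmt (BigΓ (K := K) M) Λ (Bigσ M) :=
  .push (.inl ()) f q

/-- Forget the symbol in the internal memory. -/
def clear (q : TM2.Stmt (BigΓ (K := K) M) Λ (Bigσ M)) : TM2.Stmt (BigΓ (K := K) M) Λ (Bigσ M) :=
  .load (fun v => (none, v.2)) q

/-- Jump to a label depending on the symbol in the internal memory, which is forgotten. -/
def dispatch (g : Option Symb → Λ) : TM2.Stmt (BigΓ (K := K) M) Λ (Bigσ M) :=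
  -- A jump taken after the memory has been cleared no longer sees the symbol, so the four possible
  -- values are separated beforehand.
  .branch (fun v => v.1 == none) (clear (.goto fun _ => g none)) <|
  .branch (fun v => v.1 == some none) (clear (.goto fun _ => g (some none))) <|
  .branch (fun v => v.1 == some (some false)) (clear (.goto fun _ => g (some (some false))))
    (clear (.goto fun _ => g (some (some true))))

variable (out : List Bool) (s : K → List Symb)
  (Q : (o : O) → (k : (M o).tm.K) → List ((M o).tm.Γ k)) (v : Bigσ M)
  (q : TM2.Stmt (BigΓ (K := K) M) Λ (Bigσ M))

theorem stepAux_pushReg (k : K) (f : Bigσ M → Symb) :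
    TM2.stepAux (pushReg k f q) v (bigStk M out s Q) =
      TM2.stepAux q v (bigStk M out (update s k (f v :: s k)) Q) :=
  congrArg _ (update_bigStk_reg M out s Q k _)

theorem stepAux_popReg (k : K) :
    TM2.stepAux (popReg k q) v (bigStk M out s Q) =
      TM2.stepAux q ((s k).head?, v.2) (bigStk M out (update s k (s k).tail) Q) :=
  congrArg _ (update_bigStk_reg M out s Q k _)

theorem stepAux_pushOrc (o : O) (k : (M o).tm.K) (f : Bigσ M → (M o).tm.Γ k) :
    TM2.stepAux (pushOrc o k f q) v (bigStk M out s Q) =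
      TM2.stepAux q v (bigStk M out s (update Q o (update (Q o) k (f v :: Q o k)))) :=
  congrArg _ (update_bigStk_orc M out s Q o k _)

theorem stepAux_peekOrc (o : O) (k : (M o).tm.K) (f : Bigσ M → Option ((M o).tm.Γ k) → Bigσ M) :
    TM2.stepAux (peekOrc o k f q) v (bigStk M out s Q) =
      TM2.stepAux q (f v (Q o k).head?) (bigStk M out s Q) := rfl

theorem stepAux_popOrc (o : O) (k : (M o).tm.K) (f : Bigσ M → Option ((M o).tm.Γ k) → Bigσ M) :
    TM2.stepAux (popOrc o k f q) v (bigStk M out s Q) =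
      TM2.stepAux q (f v (Q o k).head?)
        (bigStk M out s (update Q o (update (Q o) k (Q o k).tail))) :=
  congrArg _ (update_bigStk_orc M out s Q o k _)

theorem stepAux_pushOut (f : Bigσ M → Bool) :
    TM2.stepAux (pushOut f q) v (bigStk M out s Q) =
      TM2.stepAux q v (bigStk M (f v :: out) s Q) :=
  congrArg _ (update_bigStk_out M out _ s Q)

theorem stepAux_clear (S : (k : BigK K M) → List (BigΓ M k)) :
    TM2.stepAux (clear q) v S = TM2.stepAux q (none, v.2) S := rfl

theorem stepAux_dispatch (g : Option Symb → Λ) (S : (k : BigK K M) → List (BigΓ M k)) :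
    TM2.stepAux (dispatch g) v S = ⟨some (g v.1), (none, v.2), S⟩ := by
  rcases v with ⟨_ | _ | _ | _, v⟩ <;> rfl

end Statements

/-- The labels of the code of a program. -/
def Lbl : Low K O → Type
  | .skip => Unit
  | .push _ _ => Unit
  | .pop _ f => Option (Σ a, Lbl (f a))
  | .seq p q => Lbl p ⊕ Lbl q
  | .loop _ f => Option (Σ a, Lbl (f a))
  | .call o _ _ => Bool ⊕ (M o).tm.Λ

noncomputable instance Lbl.instFintype : (p : Low K O) → Fintype (Lbl M p)
  | .skip => inferInstanceAs (Fintype Unit)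
  | .push _ _ => inferInstanceAs (Fintype Unit)
  | .pop _ f => by
      have := fun a => Lbl.instFintype (f a)
      exact inferInstanceAs (Fintype (Option (Σ a, Lbl M (f a))))
  | .seq p q => by
      have := Lbl.instFintype p
      have := Lbl.instFintype q
      exact inferInstanceAs (Fintype (Lbl M p ⊕ Lbl M q))
  | .loop _ f => by
      have := fun a => Lbl.instFintype (f a)
      exact inferInstanceAs (Fintype (Option (Σ a, Lbl M (f a))))
  | .call o _ _ => by
      have := (M o).tm.ΛFin
      exact inferInstanceAs (Fintype (Bool ⊕ (M o).tm.Λ))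

/-- The first label of the code of a program. -/
def entry : (p : Low K O) → Lbl M p
  | .skip => ()
  | .push _ _ => ()
  | .pop _ _ => none
  | .seq p _ => .inl (entry p)
  | .loop _ _ => none
  | .call _ _ _ => .inl false

variable {Λ : Type}

/-- The code of an oracle machine inside the compiled machine. -/
def liftStmt (o : O) (em : (M o).tm.Λ → Λ) (ret : Λ) :
    TM2.Stmt (M o).tm.Γ (M o).tm.Λ (M o).tm.σ → TM2.Stmt (BigΓ (K := K) M) Λ (Bigσ M)
  | .push k f q => pushOrc o k (fun v => f (v.2 o)) (liftStmt o em ret q)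
  | .peek k f q => peekOrc o k (fun v x => (v.1, update v.2 o (f (v.2 o) x)))
      (liftStmt o em ret q)
  | .pop k f q => popOrc o k (fun v x => (v.1, update v.2 o (f (v.2 o) x)))
      (liftStmt o em ret q)
  | .load f q => .load (fun v => (v.1, update v.2 o (f (v.2 o)))) (liftStmt o em ret q)
  | .branch f q q' => .branch (fun v => f (v.2 o)) (liftStmt o em ret q) (liftStmt o em ret q')
  | .goto f => .goto (fun v => em (f (v.2 o)))
  | .halt => .goto (fun _ => ret)

/-- A configuration of an oracle machine as a configuration of the compiled machine. -/
def liftCfg (o : O) (em : (M o).tm.Λ → Λ) (ret : Λ) (s : K → List Symb)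
    (c : TM2.Cfg (M o).tm.Γ (M o).tm.Λ (M o).tm.σ) : TM2.Cfg (BigΓ (K := K) M) Λ (Bigσ M) :=
  ⟨some (c.l.elim ret em), (none, update (bigInit M).2 o c.var),
    bigStk M [] s (update (noQ M) o c.stk)⟩

/-- A lifted statement touches only the coordinate `o` of the internal state and of the oracle
stacks, and halting has become a jump to `ret`; so the two computations agree instruction by
instruction. -/
theorem stepAux_liftStmt (o : O) (em : (M o).tm.Λ → Λ) (ret : Λ) (s : K → List Symb)
    (q : TM2.Stmt (M o).tm.Γ (M o).tm.Λ (M o).tm.σ) (v : (M o).tm.σ)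
    (S : (k : (M o).tm.K) → List ((M o).tm.Γ k)) :
    TM2.stepAux (liftStmt M o em ret q) (none, update (bigInit M).2 o v)
        (bigStk M [] s (update (noQ M) o S)) =
      liftCfg M o em ret s (TM2.stepAux q v S) := by
  induction q generalizing v S with
  | push k f q ih =>
    rw [liftStmt, stepAux_pushOrc]
    simpa using ih v _
  | peek k f q ih =>
    rw [liftStmt, stepAux_peekOrc]
    simpa using ih _ S
  | pop k f q ih =>
    rw [liftStmt, stepAux_popOrc]
    simpa using ih _ _
  | load f q ih =>
    rw [liftStmt]
    simpa using ih _ S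
  | branch f q q' ih ih' =>
    rw [liftStmt]
    simp only [TM2.stepAux, update_self]
    cases f v
    · exact ih' _ _
    · exact ih _ _
  | goto f => simp [liftStmt, TM2.stepAux, liftCfg]
  | halt => simp [liftStmt, TM2.stepAux, liftCfg]

/-- The simulation is step for step, hence without loss of time. -/
theorem reachesIn_liftCfg (m : Λ → TM2.Stmt (BigΓ (K := K) M) Λ (Bigσ M)) (o : O)
    (em : (M o).tm.Λ → Λ) (ret : Λ) (s : K → List Symb)
    (hm : ∀ l, m (em l) = liftStmt M o em ret ((M o).tm.m l)) {c c' : (M o).tm.Cfg} {t : ℕ}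
    (h : ReachesIn (M o).tm.step c c' t) :
    ReachesIn (TM2.step m) (liftCfg M o em ret s c) (liftCfg M o em ret s c') t := by
  obtain ⟨⟨⟨j, hj⟩, hjt⟩⟩ := h
  refine ReachesIn.mono ?_ hjt
  clear hjt
  induction j generalizing c with
  | zero =>
    obtain rfl : c = c' := by simpa using hj
    exact ReachesIn.refl
  | succ j ih =>
    rw [iterate_succ_apply] at hj
    rcases c with ⟨_ | l, v, S⟩
    -- A halted configuration has no successor, so it cannot have a step left to perform.
    · exact absurd hj (by
        change (flip bind (M o).tm.step)^[j] (none : Option _) ≠ _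
        rw [iterate_flip_bind_none]; simp)
    · refine ReachesIn.head ?_ (ih hj)
      simp only [liftCfg, TM2.step, Option.elim_some, hm]
      rw [stepAux_liftStmt]
      rfl

/-- The code of a program. -/
def code : (p : Low K O) → (Lbl M p → Λ) → Λ → Lbl M p → TM2.Stmt (BigΓ (K := K) M) Λ (Bigσ M)
  | .skip, _, ex, _ => .goto fun _ => ex
  | .push k a, _, ex, _ => pushReg k (fun _ => a) (.goto fun _ => ex)
  | .pop k f, em, _, none => popReg k (dispatch fun a => em (some ⟨a, entry M (f a)⟩))
  | .pop _ f, em, ex, some ⟨a, l⟩ => code (f a) (fun l => em (some ⟨a, l⟩)) ex l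
  | .seq p q, em, _, .inl l => code p (fun l => em (.inl l)) (em (.inr (entry M q))) l
  | .seq _ q, em, ex, .inr l => code q (fun l => em (.inr l)) ex l
  | .loop k f, em, ex, none => popReg k
      (dispatch fun a => a.elim ex fun b => em (some ⟨b, entry M (f b)⟩))
  | .loop _ f, em, _, some ⟨a, l⟩ => code (f a) (fun l => em (some ⟨a, l⟩)) (em none) l
  | .call o k _, em, _, .inl false => popReg k <|
      .branch (fun v => v.1.isSome)
        (pushOrc o (M o).tm.k₀ (fun v => (M o).inputAlphabet.symm (v.1.getD none))
          (clear (.goto fun _ => em (.inl false))))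
        (clear (.goto fun _ => em (.inr (M o).tm.main)))
  | .call o _ k', _, ex, .inl true =>
      popOrc o (M o).tm.k₁ (fun v x => (x.map fun y => some ((M o).outputAlphabet y), v.2)) <|
      pushReg k' (fun v => v.1.getD none) <| clear (.goto fun _ => ex)
  | .call o _ _, em, _, .inr l =>
      liftStmt M o (fun l => em (.inr l)) (em (.inl true)) ((M o).tm.m l)

/-- The configuration in which a program is at label `l` with stack contents `s`. -/
def bigCfg (l : Λ) (s : K → List Symb) : TM2.Cfg (BigΓ (K := K) M) Λ (Bigσ M) :=
  ⟨some l, bigInit M, bigStk M [] s (noQ M)⟩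

/-- The answers of the oracle machines. -/
def Answers (o : O) (w : List Symb) (b : Bool) (t : ℕ) : Prop :=
  Nonempty (TM2OutputsInTime (M o).tm (w.map (M o).inputAlphabet.symm)
    (some [(M o).outputAlphabet.symm b]) t)

theorem initList_eq (tm : FinTM2) (w : List (tm.Γ tm.k₀)) :
    initList tm w = ⟨some tm.main, tm.initialState, update (fun _ => []) tm.k₀ w⟩ := by
  unfold initList
  congr 1
  funext k
  by_cases h : k = tm.k₀
  · subst h; simp
  · simp [h]

theorem haltList_eq (tm : FinTM2) (w : List (tm.Γ tm.k₁)) :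
    haltList tm w = ⟨none, tm.initialState, update (fun _ => []) tm.k₁ w⟩ := by
  unfold haltList
  congr 1
  funext k
  by_cases h : k = tm.k₁
  · subst h; simp
  · simp [h]

/-- The contents of the oracle stacks when the input `v` of oracle `o` is on its input stack. -/
def inQ (o : O) (v : List Symb) : (o : O) → (k : (M o).tm.K) → List ((M o).tm.Γ k) :=
  update (noQ M) o (update (fun _ => []) (M o).tm.k₀ (v.map (M o).inputAlphabet.symm))

theorem inQ_nil (o : O) : inQ M o [] = noQ M := by
  unfold inQ
  rw [List.map_nil]
  exact update_eq_self_iff.2 (update_eq_self_iff.2 rfl)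

theorem step_eq (m : Λ → TM2.Stmt (BigΓ (K := K) M) Λ (Bigσ M)) (l : Λ) {q} (h : m l = q) (v S) :
    TM2.step m ⟨some l, v, S⟩ = some (TM2.stepAux q v S) := by
  rw [TM2.step, h]

/-- The list `v` is what has already been moved; it generalizes the claim so that induction on the
remaining word applies. -/
theorem reachesIn_feed (m : Λ → TM2.Stmt (BigΓ (K := K) M) Λ (Bigσ M)) (o : O) (k k' : K)
    (em : Lbl M (.call o k k') → Λ) (ex : Λ)
    (hm : ∀ l, m (em l) = code M (.call o k k') em ex l) (w : List Symb) (s : K → List Symb)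
    (v : List Symb) (hs : s k = w) :
    ReachesIn (TM2.step m)
      ⟨some (em (.inl false)), bigInit M, bigStk M [] s (inQ M o v)⟩
      ⟨some (em (.inr (M o).tm.main)), bigInit M,
        bigStk M [] (update s k []) (inQ M o (w.reverse ++ v))⟩ (w.length + 1) := by
  induction w generalizing s v with
  | nil =>
    refine ReachesIn.single ?_
    refine (step_eq M m _ (hm (.inl false)) _ _).trans ?_
    rw [code, stepAux_popReg, hs]
    rfl
  | cons a w ih =>
    have := ih (update s k w) (a :: v) (by simp)
    refine ReachesIn.head ?_ (by simpa using this)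
    refine (step_eq M m _ (hm (.inl false)) _ _).trans ?_
    rw [code, stepAux_popReg, hs]
    simp only [TM2.stepAux, List.head?_cons, Option.isSome_some, cond_true]
    rw [stepAux_pushOrc, stepAux_clear]
    simp [inQ, bigInit]

/-- Correctness of compilation, by induction on the execution. At the entry and exit of every
subprogram the internal memory is `bigInit` and the oracle stacks are empty, so a label and the
program stacks determine the configuration. An oracle call restores this invariant because
`haltList` prescribes the initial state and empty stacks apart from the output, which is popped. -/
theorem Exec.reachesIn {m : Λ → TM2.Stmt (BigΓ (K := K) M) Λ (Bigσ M)} {p : Low K O}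
    {s s' : K → List Symb} {t : ℕ} (h : Exec (Answers M) p s s' t) (em : Lbl M p → Λ) (ex : Λ)
    (hm : ∀ l, m (em l) = code M p em ex l) :
    ReachesIn (TM2.step m) (bigCfg M (em (entry M p)) s) (bigCfg M ex s') t := by
  induction h generalizing ex with
  | skip s =>
    refine ReachesIn.single ?_
    rw [bigCfg, step_eq M m _ (hm _), code]
    rfl
  | push k a s =>
    refine ReachesIn.single ?_
    rw [bigCfg, step_eq M m _ (hm _), code, stepAux_pushReg]
    rfl
  | @pop k f s s' t h ih =>
    refine ReachesIn.head ?_ (ih (fun l => em (some ⟨_, l⟩)) ex fun l => hm (some ⟨_, l⟩))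
    rw [bigCfg, step_eq M m _ (hm _), entry, code, stepAux_popReg, stepAux_dispatch]
    rfl
  | @seq p q s s' s'' t t' h h' ih ih' =>
    exact (ih (fun l => em (.inl l)) (em (.inr (entry M q))) fun l => hm (.inl l)).trans
      (ih' (fun l => em (.inr l)) ex fun l => hm (.inr l))
  | @loop_nil k f s h =>
    refine ReachesIn.single ?_
    have : update s k [] = s := by rw [← h, update_eq_self]
    rw [bigCfg, step_eq M m _ (hm _), entry, code, stepAux_popReg, stepAux_dispatch, h,
      List.tail_nil, this]
    rfl
  | @loop_cons k f s s' s'' a l t t' hk h h' ih ih' =>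
    refine ReachesIn.head ?_ ((ih (fun l => em (some ⟨_, l⟩)) (em none)
      fun l => hm (some ⟨_, l⟩)).trans (ih' em ex hm))
    rw [bigCfg, step_eq M m _ (hm _), entry, code, stepAux_popReg, stepAux_dispatch, hk]
    rfl
  | @call o k k' s b t h =>
    have h1 := reachesIn_feed M m o k k' em ex hm (s k) s [] rfl
    have h2 := reachesIn_liftCfg M m o (fun l => em (.inr l)) (em (.inl true)) (update s k [])
      (fun l => hm (.inr l)) h
    rw [inQ_nil, List.append_nil] at h1
    rw [initList_eq, haltList_eq] at h2
    simp only [liftCfg, Option.elim_some, Option.elim_none] at h2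
    have h0 : ∀ o, update (bigInit M).2 o (M o).tm.initialState = (bigInit M).2 := fun o =>
      update_eq_self o (bigInit M).2
    have h0' : update (noQ M) o (fun _ => []) = noQ M := update_eq_self o (noQ M)
    rw [h0] at h2
    have h3 : TM2.step m ⟨some (em (.inl true)), bigInit M, bigStk M [] (update s k [])
        (update (noQ M) o (update (fun _ => []) (M o).tm.k₁ [(M o).outputAlphabet.symm b]))⟩ =
        some (bigCfg M ex (update (update s k []) k' (some b :: update s k [] k'))) := by
      refine (step_eq M m _ (hm (.inl true)) _ _).trans ?_
      rw [code, stepAux_popOrc, stepAux_pushReg, stepAux_clear]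
      simp [bigCfg, bigInit, h0']
    exact ((h1.trans h2).trans (ReachesIn.single h3)).mono (by omega)
  | weaken h ht ih => exact (ih em ex hm).mono ht

/-- The stack contents in which only one stack is not empty. -/
def onlyStk (k : K) (w : List Symb) : K → List Symb := update (fun _ => []) k w

/-- The code that runs a program and then outputs the bit on the stack `res`. -/
noncomputable def mainCode (p : Low K O) (res : K) :
    Option (Lbl M p) → TM2.Stmt (BigΓ (K := K) M) (Option (Lbl M p)) (Bigσ M)
  | some l => code M p some none l
  | none => popReg res <| pushOut (fun v => v.1 == some (some true)) <| clear .halt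

/-- The machine that runs a program, with the input on the stack `inp`, and outputs the bit that the
program leaves on the stack `res`. -/
noncomputable def machine (p : Low K O) (inp res : K) : TM2ComputableAux Symb Bool where
  tm :=
    { K := BigK K M
      k₀ := .inr (.inl inp)
      k₁ := .inl ()
      Γ := BigΓ M
      Λ := Option (Lbl M p)
      main := some (entry M p)
      σ := Bigσ M
      initialState := bigInit M
      kFin := by
        have := fun o => (M o).tm.kFin
        exact inferInstance
      σFin := by
        have := fun o => (M o).tm.σFin
        exact inferInstance
      ΛFin := inferInstance
      Γk₀Fin := inferInstanceAs (Fintype Symb)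
      m := mainCode M p res }
  inputAlphabet := Equiv.refl _
  outputAlphabet := Equiv.refl _

/-- All stacks except `res` must end up empty because a halting configuration may contain nothing
but the output. The additional step copies the bit to the output stack. -/
theorem machine_outputs (p : Low K O) (inp res : K) (w : List Symb) (b : Bool) (t : ℕ)
    (h : Exec (Answers M) p (onlyStk inp w) (onlyStk res [some b]) t) :
    Nonempty (TM2OutputsInTime (machine M p inp res).tm
      (w.map (machine M p inp res).inputAlphabet.symm)
      (some [(machine M p inp res).outputAlphabet.symm b]) (t + 1)) := by
  have h1 := h.reachesIn M (m := mainCode M p res) some none fun l => rfl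
  have h2 : TM2.step (mainCode M p res) (bigCfg M none (onlyStk res [some b])) =
      some ⟨none, bigInit M, bigStk M [b] (fun _ => []) (noQ M)⟩ := by
    rw [bigCfg, step_eq M _ _ rfl, mainCode, stepAux_popReg, stepAux_pushOut, stepAux_clear]
    cases b <;> simp [bigInit, onlyStk]
  have h3 := h1.trans (ReachesIn.single h2)
  have hnil : bigStk M [] (fun _ => []) (noQ M) =
      (fun _ => [] : (k : BigK K M) → List (BigΓ M k)) := by
    funext k
    rcases k with _ | k | x <;> rfl
  unfold TM2OutputsInTime
  rw [initList_eq, Option.map_some, haltList_eq]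
  have e1 := (update_bigStk_reg M [] (fun _ => []) (noQ M) inp w).symm
  have e2 := (update_bigStk_out M [] [b] (fun _ : K => []) (noQ M)).symm
  rw [hnil] at e1 e2
  rw [e2, bigCfg, onlyStk, e1] at h3
  have e3 : w.map (machine M p inp res).inputAlphabet.symm = w := List.map_id _
  rw [e3]
  exact h3

end Compile

end FPFAut

/-! ### Memory layout and table lookup. -/

namespace FPFAut

open Function Polynomial

/-! ### Elementary stack programs -/

section Elementary

variable {K O : Type} [DecidableEq K] {A : O → List Symb → Bool → ℕ → Prop}

/-- Move the contents of a stack to another one, reversing them. -/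
def Low.pour (k k' : K) : Low K O := .loop k fun a => .push k' a

/-- Empty a stack. -/
def Low.clear (k : K) : Low K O := .loop k fun _ => .skip

theorem Exec.congr {p : Low K O} {s s' s₁ s₁' : K → List Symb} {t : ℕ} (h : Exec A p s s' t)
    (h₁ : s = s₁) (h₁' : s' = s₁') : Exec A p s₁ s₁' t := h₁ ▸ h₁' ▸ h

theorem exec_pour {k k' : K} (h : k ≠ k') (s : K → List Symb) :
    Exec A (.pour k k') s (update (update s k []) k' ((s k).reverse ++ s k'))
      (2 * (s k).length + 1) := by
  obtain ⟨l, hl⟩ : ∃ l, s k = l := ⟨_, rfl⟩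
  induction l generalizing s with
  | nil =>
    refine ((Exec.loop_nil hl).weaken (by omega)).congr rfl ?_
    simp only [hl, List.reverse_nil, List.nil_append]
    have hu : update s k [] = s := update_eq_self_iff.2 hl.symm
    rw [hu, update_eq_self]
  | cons a l ih =>
    have h1 := ih (update (update s k l) k' (a :: s k'))
      (by rw [update_of_ne h, update_self])
    refine ((Exec.loop_cons hl (Exec.push k' a _) (h1.congr ?_ rfl)).weaken ?_).congr rfl ?_
    · rw [update_of_ne h.symm]
    · simp [update_of_ne h, hl]; omega
    · funext x
      by_cases hx : x = k'
      · subst hx; simp [update_of_ne h, hl]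
      · by_cases hx' : x = k
        · subst hx'; simp [hx]
        · simp [hx, hx']

theorem exec_clear (k : K) (s : K → List Symb) :
    Exec A (.clear k) s (update s k []) (2 * (s k).length + 1) := by
  obtain ⟨l, hl⟩ : ∃ l, s k = l := ⟨_, rfl⟩
  induction l generalizing s with
  | nil =>
    refine ((Exec.loop_nil hl).weaken (by omega)).congr rfl ?_
    simp [hl]
  | cons a l ih =>
    have h1 := ih (update s k l) (by simp)
    refine ((Exec.loop_cons hl (Exec.skip _) h1).weaken ?_).congr rfl ?_
    · simp [hl]; omega
    · simp

end Elementary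

/-! ### The stacks of the program -/

/-- Index variables. The last three are constantly equal to the number of vertices. -/
abbrev Var : Type := Fin 16

/-- Relation symbols. -/
abbrev Rel : Type := Fin 8

/-- The stacks of the program. -/
inductive Stk : Type
  /-- the value of an index variable, in unary -/
  | var : Var → Stk
  /-- the number of remaining iterations of a loop over an index variable -/
  | rem : Var → Stk
  /-- the number of performed steps of a loop up to an index variable -/
  | sh : Var → Stk
  /-- the table of a relation -/
  | rel : Rel → Stk
  /-- the traversed part of a table -/
  | tape : Stk
  /-- Boolean results -/
  | res : Stk
  /-- a word to be given to an oracle, reversed -/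
  | em : Stk
  /-- a table under construction, reversed -/
  | acc : Stk
  /-- the input -/
  | inp : Stk
  deriving DecidableEq, Fintype

/-- A number in unary. -/
def ones (n : ℕ) : List Symb := List.replicate n (some true)

@[simp] theorem length_ones (n : ℕ) : (ones n).length = n := by simp [ones]

theorem ones_succ (n : ℕ) : ones (n + 1) = some true :: ones n := rfl

/-- The part of the memory that programs change persistently. -/
structure Mem where
  /-- the tables of the relations -/
  tab : Rel → List Bool
  /-- Boolean results -/
  res : List Symb
  /-- the oracle input, reversed -/
  em : List Symb
  /-- the table under construction, reversed -/
  acc : List Symb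

/-- The stack contents given by a memory, the values of the index variables, and the numbers of
remaining iterations. -/
def st (μ : Mem) (e r : Var → ℕ) : Stk → List Symb
  | .var i => ones (e i)
  | .rem i => ones (r i)
  | .sh _ => []
  | .rel a => (μ.tab a).map some
  | .tape => []
  | .res => μ.res
  | .em => μ.em
  | .acc => μ.acc
  | .inp => []

section st

variable (μ : Mem) (e r : Var → ℕ)

theorem update_st_res (l : List Symb) : update (st μ e r) .res l = st { μ with res := l } e r := by
  funext k; cases k <;> simp [st]

theorem update_st_em (l : List Symb) : update (st μ e r) .em l = st { μ with em := l } e r := by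
  funext k; cases k <;> simp [st]

theorem update_st_acc (l : List Symb) : update (st μ e r) .acc l = st { μ with acc := l } e r := by
  funext k; cases k <;> simp [st]

theorem update_st_rel (a : Rel) (l : List Bool) :
    update (st μ e r) (.rel a) (l.map some) = st { μ with tab := update μ.tab a l } e r := by
  funext k
  cases k with
  | rel b =>
    by_cases h : b = a
    · subst h; simp [st]
    · simp [st, h]
  | _ => simp [st]

theorem update_st_var (i : Var) (m : ℕ) :
    update (st μ e r) (.var i) (ones m) = st μ (update e i m) r := by
  funext k
  cases k with
  | var j =>
    by_cases h : j = i
    · subst h; simp [st]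
    · simp [st, h]
  | _ => simp [st]

theorem update_st_rem (i : Var) (m : ℕ) :
    update (st μ e r) (.rem i) (ones m) = st μ e (update r i m) := by
  funext k
  cases k with
  | rem j =>
    by_cases h : j = i
    · subst h; simp [st]
    · simp [st, h]
  | _ => simp [st]

end st

section Programs

variable {O : Type}

/-! ### Table lookup -/

/-- Run a program as often as the value of an index variable says. -/
def forEach (x : Var) (p : Low Stk O) : Low Stk O :=
  .seq (.loop (.var x) fun a => .seq (.push (.sh x) a) p) (.pour (.sh x) (.var x))

/-- Move one symbol from a stack to the tape. -/
def shift (k : Stk) : Low Stk O :=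
  .pop k fun a => a.elim .skip fun a => .push .tape a

/-- Move as many symbols to the tape as the product of the index variables says. -/
def times (k : Stk) : List Var → Low Stk O
  | [] => shift k
  | x :: xs => forEach x (times k xs)

/-- The variables that are constantly equal to the number of vertices. -/
def consts : List Var := [13, 14, 15]

/-- Move as many symbols to the tape as the position given by a tuple of indices says. -/
def skipAll (k : Stk) : List Var → Low Stk O
  | [] => .skip
  | i :: is => .seq (times k (i :: consts.take is.length)) (skipAll k is)

/-- Push the symbol of a stack at the position given by a tuple of indices on the result stack. -/
def lookup (k : Stk) (is : List Var) : Low Stk O :=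
  .seq (skipAll k is) <|
  .seq (.pop k fun a => a.elim (.push .res (some false)) fun a => .seq (.push k a) (.push .res a))
    (.pour .tape k)

/-- The position of a tuple in the lexicographic order of all tuples of the same length. -/
def pos (n : ℕ) : List ℕ → ℕ
  | [] => 0
  | x :: xs => x * n ^ xs.length + pos n xs

variable {A : O → List Symb → Bool → ℕ → Prop}

/-- Here `g m` is the memory after `m` rounds, apart from the two counter stacks. The counter
travels from `.var x` to `.sh x` and is poured back at the end, so the loop does not destroy the
index. -/
theorem exec_forEach {x : Var} {p : Low Stk O} {L c : ℕ} (g : ℕ → Stk → List Symb)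
    (hv : ∀ m, g m (.var x) = ones L) (hs : ∀ m, g m (.sh x) = [])
    (hp : ∀ m a b, Exec A p (update (update (g m) (.var x) (ones a)) (.sh x) (ones b))
      (update (update (g (m + 1)) (.var x) (ones a)) (.sh x) (ones b)) c) :
    Exec A (forEach x p) (g 0) (g L) (L * (c + 4) + 2) := by
  -- Invariant: `a` rounds remain on `.var x` and `m` completed rounds are recorded on `.sh x`.
  have key : ∀ a m, Exec A (.loop (.var x) fun a => .seq (.push (.sh x) a) p)
      (update (update (g m) (.var x) (ones a)) (.sh x) (ones m))
      (update (update (g (m + a)) (.var x) (ones 0)) (.sh x) (ones (m + a)))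
      (a * (c + 2) + 1) := by
    intro a
    induction a with
    | zero => intro m; exact (Exec.loop_nil (by simp [ones])).weaken (by omega)
    | succ a ih =>
      intro m
      refine ((Exec.loop_cons (l := ones a) (a := some true) (by simp [ones_succ])
        (Exec.seq (Exec.push _ _ _) ((hp m a (m + 1)).congr ?_ rfl)) (ih (m + 1))).weaken
          ?_).congr rfl ?_
      · funext k
        by_cases h : k = .sh x
        · subst h; simp [ones_succ]
        · by_cases h' : k = .var x
          · subst h'; simp
          · simp [h, h']
      · have : (a + 1) * (c + 2) = a * (c + 2) + (c + 2) := by ring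
        omega
      · rw [show m + 1 + a = m + (a + 1) by omega]
  have h1 := key L 0
  have h2 := exec_pour (A := A) (k := Stk.sh x) (k' := Stk.var x) (by simp)
    (update (update (g (0 + L)) (.var x) (ones 0)) (.sh x) (ones (0 + L)))
  refine ((h1.seq h2).weaken ?_).congr ?_ ?_
  · simp only [update_self, length_ones]
    have : L * (c + 4) = L * (c + 2) + 2 * L := by ring
    omega
  · funext k
    by_cases h : k = .sh x
    · subst h; simp [hs, ones]
    · by_cases h' : k = .var x
      · subst h'; simp [hv]
      · simp [h, h']
  · funext k
    by_cases h : k = .sh x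
    · subst h; simp [hs]
    · by_cases h' : k = .var x
      · subst h'; simp [hv, ones]
      · simp [h, h']

/-- The effect of moving `m` symbols of a stack to the tape. -/
def shf (k : Stk) (m : ℕ) (s : Stk → List Symb) : Stk → List Symb :=
  update (update s k ((s k).drop m)) .tape (((s k).take m).reverse ++ s .tape)

theorem shf_zero (k : Stk) (s : Stk → List Symb) : shf k 0 s = s := by
  simp [shf]

theorem shf_add {k : Stk} (hk : k ≠ .tape) (a b : ℕ) (s : Stk → List Symb) :
    shf k b (shf k a s) = shf k (a + b) s := by
  funext x
  by_cases h : x = .tape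
  · subst h
    simp only [shf, update_self, update_of_ne hk]
    rw [List.take_add, List.reverse_append, List.append_assoc]
  · by_cases h' : x = k
    · subst h'
      simp [shf, hk, List.drop_drop]
    · simp [shf, h, h']

theorem exec_shift {k : Stk} (hk : k ≠ .tape) (s : Stk → List Symb) :
    Exec A (shift k) s (shf k 1 s) 2 := by
  obtain ⟨l, hl⟩ : ∃ l, s k = l := ⟨_, rfl⟩
  cases l with
  | nil =>
    refine (Exec.pop (t := 1) (by rw [hl]; exact Exec.skip _)).congr rfl ?_
    simp [shf, hl, hk.symm]
  | cons a l =>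
    refine (Exec.pop (t := 1) (by rw [hl]; exact Exec.push _ _ _)).congr rfl ?_
    simp [shf, hl, hk.symm]

theorem shf_update_comm {k k' : Stk} (h : k' ≠ k) (h' : k' ≠ .tape) (m : ℕ) (s : Stk → List Symb)
    (l : List Symb) : shf k m (update s k' l) = update (shf k m s) k' l := by
  funext x
  by_cases hx : x = .tape
  · subst hx
    simp [shf, h.symm, h'.symm]
  · by_cases hx' : x = k
    · subst hx'
      simp [shf, hx, h.symm]
    · by_cases hx'' : x = k'
      · subst hx''; simp [shf, hx, hx']
      · simp [shf, hx, hx', hx'']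

/-- The variables must be distinct because an inner loop over the same variable would find its
counter partly consumed. The polynomial depends only on `k` and `xs`, not on the oracles or the
memory. -/
theorem exec_times (k : Stk) (hk : k ≠ .tape) (xs : List Var) : ∃ p : ℕ[X],
    ∀ {O : Type} {A : O → List Symb → Bool → ℕ → Prop} (n : ℕ) (e : Var → ℕ) (s : Stk → List Symb),
    xs.Nodup → (∀ x ∈ xs, e x ≤ n ∧ k ≠ .var x ∧ k ≠ .sh x ∧ s (.var x) = ones (e x) ∧
      s (.sh x) = []) →
    Exec A (times k xs) s (shf k (xs.map e).prod s) (p.eval n) := by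
  induction xs with
  | nil => exact ⟨2, fun n e s _ _ => by simpa [times] using exec_shift hk s⟩
  | cons x xs ih =>
    obtain ⟨p, hp⟩ := ih
    refine ⟨X * (p + 4) + 2, fun {O A} n e s hn hs => ?_⟩
    obtain ⟨hx, hn⟩ := List.nodup_cons.1 hn
    obtain ⟨h1, h2, h3, h4, h5⟩ := hs x (by simp)
    have := exec_forEach (A := A) (x := x) (p := times k xs) (L := e x) (c := p.eval n)
      (fun m => shf k (m * (xs.map e).prod) s)
      (fun m => by simp [shf, h2.symm, h4])
      (fun m => by simp [shf, h3.symm, h5])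
      (fun m a b => by
        refine (hp n e _ hn ?_).congr rfl ?_
        · intro y hy
          have hyx : y ≠ x := fun h => hx (h ▸ hy)
          obtain ⟨h1', h2', h3', h4', h5'⟩ := hs y (by simp [hy])
          refine ⟨h1', h2', h3', ?_, ?_⟩
          · simp [shf, hyx, h2'.symm, h4']
          · simp [shf, hyx, h3'.symm, h5']
        · rw [shf_update_comm h3.symm (by simp), shf_update_comm h2.symm (by simp), shf_add hk,
            Nat.succ_mul])
    refine (this.weaken ?_).congr ?_ ?_
    · simp only [eval_add, eval_mul, eval_X, eval_ofNat]
      gcongr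
    · simp [shf_zero]
    · simp

/-- An index followed by `l` others contributes `e i * n ^ l` to the position, which is realized by
nested loops over `i` and `l` distinct variables of value `n`. Three such variables are available,
whence the arity bound 4. -/
theorem exec_skipAll (k : Stk) (hk : k ≠ .tape) (is : List Var) (hlen : is.length ≤ 4) :
    ∃ p : ℕ[X],
    ∀ {O : Type} {A : O → List Symb → Bool → ℕ → Prop} (n : ℕ) (e : Var → ℕ) (s : Stk → List Symb),
    (∀ x ∈ consts, e x = n) →
    (∀ x ∈ is ++ consts, e x ≤ n ∧ k ≠ .var x ∧ k ≠ .sh x ∧ s (.var x) = ones (e x) ∧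
      s (.sh x) = []) → (∀ x ∈ is, x ∉ consts) →
    Exec A (skipAll k is) s (shf k (pos n (is.map e)) s) (p.eval n) := by
  induction is with
  | nil => exact ⟨1, fun n e s _ _ _ => by simpa [skipAll, pos, shf_zero] using Exec.skip s⟩
  | cons i is ih =>
    obtain ⟨p, hp⟩ := ih (by simp at hlen; omega)
    obtain ⟨q, hq⟩ := exec_times k hk (i :: consts.take is.length)
    refine ⟨q + p, fun {O A} n e s hc hs hd => ?_⟩
    have h1 := hq (A := A) n e s
      (List.nodup_cons.2 ⟨fun h => hd i (by simp) (List.mem_of_mem_take h),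
        List.Nodup.sublist (List.take_sublist _ _) (by decide)⟩)
      (fun x hx => hs x (by
        rcases List.mem_cons.1 hx with rfl | hx
        · simp
        · simp [List.mem_of_mem_take hx]))
    have h2 := hp (A := A) n e (shf k ((i :: consts.take is.length).map e).prod s) hc
      (fun x hx => by
        obtain ⟨h1, h2, h3, h4, h5⟩ := hs x (by simp at hx ⊢; tauto)
        refine ⟨h1, h2, h3, ?_, ?_⟩
        · simp [shf, h2.symm, h4]
        · simp [shf, h3.symm, h5])
      (fun x hx => hd x (by simp [hx]))
    refine ((h1.seq h2).weaken ?_).congr rfl ?_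
    · simp
    · rw [shf_add hk]
      congr 1
      have : (consts.take is.length).map e = List.replicate is.length n := by
        refine List.eq_replicate_iff.2 ⟨?_, ?_⟩
        · simp [consts] at hlen ⊢; omega
        · intro b hb
          obtain ⟨x, hx, rfl⟩ := List.mem_map.1 hb
          exact hc x (List.mem_of_mem_take hx)
      simp [pos, this]

/-- The symbols in front of the wanted one are parked on the tape, the symbol is read and put back,
and the tape is returned. A position beyond the end reads as `false`. -/
theorem exec_lookup (k : Stk) (hk : k ≠ .tape) (hk' : k ≠ .res) (is : List Var)
    (hlen : is.length ≤ 4) : ∃ p : ℕ[X],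
    ∀ {O : Type} {A : O → List Symb → Bool → ℕ → Prop} (n : ℕ) (e : Var → ℕ) (s : Stk → List Symb),
    (∀ x ∈ consts, e x = n) → s .tape = [] →
    (∀ x ∈ is ++ consts, e x ≤ n ∧ k ≠ .var x ∧ k ≠ .sh x ∧ s (.var x) = ones (e x) ∧
      s (.sh x) = []) → (∀ x ∈ is, x ∉ consts) →
    Exec A (lookup k is) s
      (update s .res ((s k).getD (pos n (is.map e)) (some false) :: s .res)) (p.eval n) := by
  obtain ⟨p, hp⟩ := exec_skipAll k hk is hlen
  refine ⟨p + 4 + 2 * ((is.length : ℕ[X]) * (X + 1) ^ 4), fun {O A} n e s hc ht hs hd => ?_⟩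
  have h1 := hp (A := A) n e s hc hs hd
  set m := pos n (is.map e) with hm
  -- At most `m` symbols lie on the tape, so this bounds the cost of returning them.
  have hmn : m ≤ is.length * (n + 1) ^ 4 := by
    have : ∀ l : List Var, l.length ≤ 4 → (∀ x ∈ l, e x ≤ n) →
        pos n (l.map e) ≤ l.length * (n + 1) ^ 4 := by
      intro l
      induction l with
      | nil => simp [pos]
      | cons x l ih =>
        intro hl hx
        have h1 := ih (by simp at hl; omega) fun y hy => hx y (by simp [hy])
        have h2 : e x * n ^ l.length ≤ (n + 1) ^ 4 := by
          calc e x * n ^ l.length ≤ (n + 1) * (n + 1) ^ l.length := by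
                gcongr
                · exact (hx x (by simp)).trans (by omega)
                · omega
            _ = (n + 1) ^ (l.length + 1) := by ring
            _ ≤ (n + 1) ^ 4 := Nat.pow_le_pow_right (by omega) (by simpa using hl)
        simp only [List.map_cons, pos, List.length_map, List.length_cons, Nat.add_mul, one_mul]
        omega
    exact this is hlen fun x hx => (hs x (by simp [hx])).1
  have h2 : Exec A (.pop k fun a => a.elim (.push .res (some false)) fun a =>
      .seq (.push k a) (.push .res a)) (shf k m s)
      (update (shf k m s) .res ((s k).getD m (some false) :: s .res)) 3 := by
    have hd : shf k m s k = (s k).drop m := by simp [shf, hk]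
    have hr : shf k m s .res = s .res := by simp [shf, hk'.symm]
    obtain ⟨l, hl⟩ : ∃ l, (s k).drop m = l := ⟨_, rfl⟩
    rw [hl] at hd
    have hg : (s k).getD m (some false) = l.head?.getD (some false) := by
      rw [← hl, List.head?_drop, List.getD_eq_getElem?_getD]
    cases l with
    | nil =>
      refine ((Exec.pop (t := 1) (by rw [hd]; exact Exec.push _ _ _)).weaken (by omega)).congr rfl
        ?_
      have hu : update (shf k m s) k [] = shf k m s := update_eq_self_iff.2 hd.symm
      rw [hg, List.tail_nil, hu, hr]
      rfl
    | cons a l =>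
      refine (Exec.pop (t := 2) (by
        rw [hd]; exact Exec.seq (Exec.push _ _ _) (Exec.push _ _ _))).congr rfl ?_
      have hu : update (shf k m s) k (a :: l) = shf k m s := update_eq_self_iff.2 hd.symm
      rw [hg, List.tail_cons, update_self, update_idem, hu, hr]
      rfl
  have h3 := exec_pour (A := A) (k := Stk.tape) (k' := k) hk.symm
    (update (shf k m s) .res ((s k).getD m (some false) :: s .res))
  refine ((h1.seq (h2.seq h3)).weaken ?_).congr rfl ?_
  · simp only [shf, ne_eq, reduceCtorEq, not_false_eq_true, update_of_ne, update_self, ht,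
      List.append_nil, List.length_reverse, List.length_take, eval_add, eval_mul, eval_ofNat,
      eval_natCast, eval_pow, eval_X, eval_one, Nat.cast_id]
    have := min_le_left m (s k).length
    omega
  · funext x
    by_cases hx : x = k
    · subst hx
      simp [shf, hk, hk', ht]
    · by_cases hx' : x = .tape
      · subst hx'; simp [hx, ht]
      · by_cases hx'' : x = .res
        · subst hx''; simp [hx]
        · simp [hx, hx', hx'', shf]

end Programs

end FPFAut

/-! ### The language of formulas, words and commands, with polynomial time bounds. -/

namespace FPFAut

open Function Polynomial

section Language

variable {O : Type} {A : O → List Symb → Bool → ℕ → Prop}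

/-! ### Loops over index variables -/

/-- Run a program for all values of an index variable. -/
def bind (i : Var) (p : Low Stk O) : Low Stk O :=
  .seq (.loop (.rem i) fun _ => .seq p (.push (.var i) (some true))) (.pour (.var i) (.rem i))

/-- `μ m` is the memory before round `m`. The stack `.rem i` loses a symbol when a round starts and
`.var i` gains one when it ends; pouring back restores both, so the variable can be used again. -/
theorem exec_bind {i : Var} {p : Low Stk O} {n c : ℕ} (μ : ℕ → Mem) {e r : Var → ℕ}
    (he : e i = 0) (hr : r i = n)
    (hp : ∀ m < n, Exec A p (st (μ m) (update e i m) (update r i (n - (m + 1))))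
      (st (μ (m + 1)) (update e i m) (update r i (n - (m + 1)))) c) :
    Exec A (bind i p) (st (μ 0) e r) (st (μ n) e r) (n * (c + 4) + 2) := by
  have key : ∀ a m, m + a = n →
      Exec A (.loop (.rem i) fun _ => .seq p (.push (.var i) (some true)))
      (st (μ m) (update e i m) (update r i a)) (st (μ n) (update e i n) (update r i 0))
      (a * (c + 2) + 1) := by
    intro a
    induction a with
    | zero =>
      rintro m rfl
      exact (Exec.loop_nil (by simp [st, ones])).weaken (by omega)
    | succ a ih =>
      intro m hm
      have h1 := hp m (by omega)
      rw [show n - (m + 1) = a by omega] at h1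
      refine ((Exec.loop_cons (l := ones a) (a := some true) (by simp [st, ones_succ])
        (Exec.seq (h1.congr ?_ rfl) (Exec.push _ _ _))
        ((ih (m + 1) (by omega)).congr ?_ rfl)).weaken ?_)
      · rw [update_st_rem, update_idem]
      · have : some true :: st (μ (m + 1)) (update e i m) (update r i a) (.var i) =
            ones (m + 1) := by simp [st, ones_succ]
        rw [this, update_st_var, update_idem]
      · have : (a + 1) * (c + 2) = a * (c + 2) + (c + 2) := by ring
        omega
  have h1 := key n 0 (by omega)
  have h2 := exec_pour (A := A) (k := Stk.var i) (k' := Stk.rem i) (by simp)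
    (st (μ n) (update e i n) (update r i 0))
  have hr' : update r i n = r := by rw [← hr, update_eq_self]
  have he' : update e i 0 = e := by rw [← he, update_eq_self]
  refine ((h1.seq h2).weaken ?_).congr ?_ ?_
  · simp only [st, update_self, length_ones]
    have : n * (c + 4) = n * (c + 2) + 2 * n := by ring
    omega
  · rw [hr', he']
  · have h3 : (st (μ n) (update e i n) (update r i 0) (.var i)).reverse ++
        st (μ n) (update e i n) (update r i 0) (.rem i) = ones n := by simp [st, ones]
    rw [h3, show ([] : List Symb) = ones 0 from rfl, update_st_var, update_st_rem, update_idem,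
      update_idem, hr', he']

/-- The value of a symbol on the result stack. -/
def bit (a : Option Symb) : Bool := a == some (some true)

@[simp] theorem bit_some (b : Bool) : bit (some (some b)) = b := by cases b <;> rfl

theorem exec_unary (f : Bool → Bool) (μ : Mem) (e r : Var → ℕ) (b : Bool) :
    Exec A (.pop .res fun a => .push .res (some (f (bit a))))
      (st { μ with res := some b :: μ.res } e r)
      (st { μ with res := some (f b) :: μ.res } e r) 2 := by
  refine (Exec.pop (Exec.push _ _ _)).congr rfl ?_
  simp only [update_st_res]
  simp [st]

theorem exec_binary (f : Bool → Bool → Bool) (μ : Mem) (e r : Var → ℕ) (b b' : Bool) :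
    Exec A (.pop .res fun a => .pop .res fun a' => .push .res (some (f (bit a) (bit a'))))
      (st { μ with res := some b :: some b' :: μ.res } e r)
      (st { μ with res := some (f b b') :: μ.res } e r) 3 := by
  refine (Exec.pop (Exec.pop (Exec.push _ _ _))).congr rfl ?_
  simp only [update_st_res]
  simp [st]

/-! ### Formulas -/

/-- First-order formulas over the relations and the order of the vertices. -/
inductive Fm : Type
  /-- a relation holds -/
  | rel : Rel → List Var → Fm
  /-- an index is less than another one -/
  | lt : Var → Var → Fm
  /-- negation -/
  | not : Fm → Fm
  /-- conjunction -/
  | and : Fm → Fm → Fm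
  /-- existential quantification -/
  | ex : Var → Fm → Fm

namespace Fm

/-- Disjunction. -/
def or (φ ψ : Fm) : Fm := .not (.and (.not φ) (.not ψ))

/-- Universal quantification. -/
def all (i : Var) (φ : Fm) : Fm := .not (.ex i (.not φ))

/-- The truth value of a formula. -/
def eval (n : ℕ) (ρ : Rel → List Bool) : Fm → (Var → ℕ) → Bool
  | rel a is, e => (ρ a).getD (pos n (is.map e)) false
  | lt i j, e => decide (e i < e j)
  | not φ, e => !eval n ρ φ e
  | and φ ψ, e => eval n ρ φ e && eval n ρ ψ e
  | ex i φ, e => decide (∃ x < n, eval n ρ φ (update e i x) = true)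

/-- The bound variables of a formula. -/
def bound : Fm → List Var
  | rel _ _ => []
  | lt _ _ => []
  | not φ => bound φ
  | and φ ψ => bound φ ++ bound ψ
  | ex i φ => i :: bound φ

/-- A formula respects the arity bound, does not use the constant variables, and does not bind
variables twice. -/
def wf : Fm → Bool
  | rel _ is => decide (is.length ≤ 4) && is.all fun i => decide (i ∉ consts)
  | lt i j => decide (i ≠ j) && decide (i ∉ consts) && decide (j ∉ consts)
  | not φ => wf φ
  | and φ ψ => wf φ && wf ψ
  | ex i φ => decide (i ∉ bound φ) && decide (i ∉ consts) && wf φ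

/-- The program that evaluates a formula. -/
def comp : Fm → Low Stk O
  | rel a is => lookup (.rel a) is
  | lt i j => lookup (.var j) [i]
  | not φ => .seq (comp φ) (.pop .res fun a => .push .res (some (!bit a)))
  | and φ ψ => .seq (comp φ) (.seq (comp ψ)
      (.pop .res fun a => .pop .res fun a' => .push .res (some (bit a && bit a'))))
  | ex i φ => .seq (.push .res (some false)) (bind i (.seq (comp φ)
      (.pop .res fun a => .pop .res fun a' => .push .res (some (bit a || bit a')))))

end Fm

/-- Admissible values of the index variables. -/
structure EnvOK (n : ℕ) (e : Var → ℕ) : Prop where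
  consts : ∀ x ∈ consts, e x = n
  le : ∀ x, e x ≤ n

theorem EnvOK.update {n : ℕ} {e : Var → ℕ} (h : EnvOK n e) {i : Var} (hi : i ∉ FPFAut.consts)
    {m : ℕ} (hm : m ≤ n) : EnvOK n (update e i m) := by
  refine ⟨fun x hx => ?_, fun x => ?_⟩
  · rw [update_of_ne (by rintro rfl; exact hi hx), h.consts x hx]
  · by_cases hx : x = i
    · subst hx; simpa using hm
    · simpa [hx] using h.le x

/-- The listed variables are not in use. -/
def Free (n : ℕ) (is : List Var) (e r : Var → ℕ) : Prop := ∀ i ∈ is, e i = 0 ∧ r i = n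

theorem Free.update {n : ℕ} {is : List Var} {e r : Var → ℕ} (h : Free n is e r) {i : Var}
    (hi : i ∉ is) (m m' : ℕ) : Free n is (update e i m) (update r i m') := fun j hj => by
  have : j ≠ i := fun h => hi (h ▸ hj)
  simpa [this] using h j hj

/-- A quantifier is a loop over `n` values that keeps a running disjunction on the result stack.
`Free` ensures that the counters of the bound variables are in their starting position. -/
theorem Fm.exec (φ : Fm) (hφ : φ.wf = true) : ∃ p : ℕ[X],
    ∀ {O : Type} {A : O → List Symb → Bool → ℕ → Prop} (n : ℕ) (μ : Mem) (e r : Var → ℕ),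
    EnvOK n e → Free n φ.bound e r →
    Exec A φ.comp (st μ e r) (st { μ with res := some (φ.eval n μ.tab e) :: μ.res } e r)
      (p.eval n) := by
  induction φ with
  | rel a is =>
    simp only [wf, Bool.and_eq_true, decide_eq_true_eq, List.all_eq_true] at hφ
    obtain ⟨p, hp⟩ := exec_lookup (.rel a) (by simp) (by simp) is hφ.1
    refine ⟨p, fun n μ e r he hf => ?_⟩
    refine (hp n e (st μ e r) he.consts rfl (fun x _ => ⟨he.le x, by simp, by simp, rfl, rfl⟩)
      hφ.2).congr rfl ?_
    rw [update_st_res]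
    simp only [st, eval, List.getD_eq_getElem?_getD, List.getElem?_map]
    cases (μ.tab a)[pos n (is.map e)]? <;> rfl
  | lt i j =>
    simp only [wf, Bool.and_eq_true, decide_eq_true_eq] at hφ
    obtain ⟨⟨h1, h2⟩, h3⟩ := hφ
    -- The unary stack of `j` serves as a table: it has a symbol at position `e i` exactly when `e i
    -- < e j`. The lookup consumes the stack of `i` temporarily, which is why `i ≠ j` is required.
    obtain ⟨p, hp⟩ := exec_lookup (.var j) (by simp) (by simp) [i] (by simp)
    refine ⟨p, fun n μ e r he hf => ?_⟩
    refine (hp n e (st μ e r) he.consts rfl (fun x hx => ⟨he.le x, ?_, by simp, rfl, rfl⟩)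
      (by simpa using h2)).congr rfl ?_
    · rintro ⟨⟩
      rcases List.mem_append.1 hx with hx | hx
      · exact h1 (List.mem_singleton.1 hx).symm
      · exact h3 hx
    · rw [update_st_res]
      simp only [st, eval, List.getD_eq_getElem?_getD, ones, List.getElem?_replicate, List.map_cons,
        List.map_nil, pos, List.length_nil, pow_zero, mul_one, add_zero]
      by_cases h : e i < e j <;> simp [h]
  | not φ ih =>
    obtain ⟨p, hp⟩ := ih hφ
    refine ⟨p + 2, fun n μ e r he hf => ?_⟩
    refine ((hp n μ e r he hf).seq (exec_unary (fun b => !b) μ e r _)).weaken (by simp)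
  | and φ ψ ih ih' =>
    simp only [wf, Bool.and_eq_true] at hφ
    obtain ⟨p, hp⟩ := ih hφ.1
    obtain ⟨q, hq⟩ := ih' hφ.2
    refine ⟨p + (q + 3), fun n μ e r he hf => ?_⟩
    have h1 := hp (A := ‹_›) n μ e r he fun i hi => hf i (by simp [bound, hi])
    have h2 := hq (A := ‹_›) n { μ with res := some (φ.eval n μ.tab e) :: μ.res } e r he
      fun i hi => hf i (by simp [bound, hi])
    refine ((h1.seq (h2.seq (exec_binary (fun b b' => b && b') μ e r _ _))).weaken
      (by simp)).congr rfl ?_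
    simp [eval, Bool.and_comm]
  | ex i φ ih =>
    simp only [wf, Bool.and_eq_true, decide_eq_true_eq] at hφ
    obtain ⟨⟨h1, h2⟩, h3⟩ := hφ
    obtain ⟨p, hp⟩ := ih h3
    refine ⟨1 + (X * (p + 3 + 4) + 2), fun {O A} n μ e r he hf => ?_⟩
    have hb := exec_bind (A := A) (i := i) (n := n) (c := p.eval n + 3)
      (p := .seq (comp φ) (.pop .res fun a => .pop .res fun a' =>
        .push .res (some (bit a || bit a'))))
      (fun m => { μ with
        res := some (decide (∃ x < m, φ.eval n μ.tab (update e i x) = true)) :: μ.res })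
      (e := e) (r := r) (hf i (by simp [bound])).1 (hf i (by simp [bound])).2
      (fun m hm => by
        refine ((hp n _ _ _ (he.update h2 hm.le) (Free.update (fun j hj => hf j
          (by simp [bound, hj])) h1 _ _)).seq (exec_binary (fun b b' => b || b') μ _ _ _
          _)).congr rfl ?_
        congr 4
        simp only [Order.lt_add_one_iff, Nat.le_iff_lt_or_eq, or_and_right, exists_or,
          exists_eq_left, Bool.decide_or, Bool.decide_eq_true, Bool.or_comm])
    refine ((Exec.seq (Exec.push _ _ _) (hb.congr ?_ rfl)).weaken ?_).congr rfl rfl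
    · rw [update_st_res]
      simp [st]
    · simp

/-! ### Words described by formulas -/

/-- Descriptions of words. -/
inductive Em : Type
  /-- a single symbol -/
  | sym : Symb → Em
  /-- the truth value of a formula -/
  | val : Fm → Em
  /-- concatenation -/
  | seq : Em → Em → Em
  /-- a word or the empty word, depending on a formula -/
  | guard : Fm → Em → Em
  /-- the concatenation of words for all values of a variable -/
  | cat : Var → Em → Em

namespace Em

/-- The described word. -/
def eval (n : ℕ) (ρ : Rel → List Bool) : Em → (Var → ℕ) → List Symb
  | sym a, _ => [a]
  | val φ, e => [some (φ.eval n ρ e)]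
  | seq E F, e => eval n ρ E e ++ eval n ρ F e
  | guard φ E, e => if φ.eval n ρ e = true then eval n ρ E e else []
  | cat i E, e => (List.range n).flatMap fun x => eval n ρ E (update e i x)

/-- The bound variables of a description. -/
def bound : Em → List Var
  | sym _ => []
  | val φ => φ.bound
  | seq E F => bound E ++ bound F
  | guard φ E => φ.bound ++ bound E
  | cat i E => i :: bound E

/-- Well-formed descriptions. -/
def wf : Em → Bool
  | sym _ => true
  | val φ => φ.wf
  | seq E F => wf E && wf F
  | guard φ E => φ.wf && wf E
  | cat i E => decide (i ∉ bound E) && decide (i ∉ consts) && wf E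

/-- The program that writes the described word on the stack `em`. -/
def comp : Em → Low Stk O
  | sym a => .push .em a
  | val φ => .seq φ.comp (.pop .res fun a => .push .em (some (bit a)))
  | seq E F => .seq (comp E) (comp F)
  | guard φ E => .seq φ.comp (.pop .res fun a => if bit a then comp E else .skip)
  | cat i E => bind i (comp E)

theorem exec (E : Em) (hE : E.wf = true) : ∃ p : ℕ[X],
    ∀ {O : Type} {A : O → List Symb → Bool → ℕ → Prop} (n : ℕ) (μ : Mem) (e r : Var → ℕ),
    EnvOK n e → Free n E.bound e r →
    Exec A E.comp (st μ e r) (st { μ with em := (E.eval n μ.tab e).reverse ++ μ.em } e r)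
      (p.eval n) := by
  induction E with
  | sym a =>
    refine ⟨1, fun n μ e r _ _ => ?_⟩
    refine ((Exec.push _ _ _).weaken (by simp)).congr rfl ?_
    rw [update_st_em]
    rfl
  | val φ =>
    obtain ⟨p, hp⟩ := φ.exec hE
    refine ⟨p + 2, fun n μ e r he hf => ?_⟩
    refine (((hp n μ e r he hf).seq (Exec.pop (Exec.push _ _ _))).weaken (by simp)).congr rfl ?_
    simp only [update_st_res, update_st_em]
    simp [st, eval]
  | seq E F ih ih' =>
    simp only [wf, Bool.and_eq_true] at hE
    obtain ⟨p, hp⟩ := ih hE.1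
    obtain ⟨q, hq⟩ := ih' hE.2
    refine ⟨p + q, fun {O A} n μ e r he hf => ?_⟩
    have h1 := hp (A := A) n μ e r he fun i hi => hf i (by simp [bound, hi])
    have h2 := hq (A := A) n { μ with em := (E.eval n μ.tab e).reverse ++ μ.em } e r he
      fun i hi => hf i (by simp [bound, hi])
    refine ((h1.seq h2).weaken (by simp)).congr rfl ?_
    simp [eval]
  | guard φ E ih =>
    simp only [wf, Bool.and_eq_true] at hE
    obtain ⟨p, hp⟩ := φ.exec hE.1
    obtain ⟨q, hq⟩ := ih hE.2
    refine ⟨p + (q + 2), fun {O A} n μ e r he hf => ?_⟩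
    have h1 := hp (A := A) n μ e r he fun i hi => hf i (by simp [bound, hi])
    have h2 := hq (A := A) n μ e r he fun i hi => hf i (by simp [bound, hi])
    by_cases h : φ.eval n μ.tab e = true
    · rw [h] at h1
      refine ((h1.seq (Exec.pop (t := q.eval n) (s' := st { μ with
        em := (E.eval n μ.tab e).reverse ++ μ.em } e r) ?_)).weaken (by simp)).congr rfl ?_
      · rw [update_st_res]
        simpa [st] using h2
      · simp [eval, h]
    · rw [Bool.not_eq_true] at h
      rw [h] at h1
      refine ((h1.seq (Exec.pop (t := 1) (s' := st μ e r) ?_)).weaken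
        (by simp)).congr rfl ?_
      · rw [update_st_res]
        simpa [st] using Exec.skip _
      · simp [eval, h]
  | cat i E ih =>
    simp only [wf, Bool.and_eq_true, decide_eq_true_eq] at hE
    obtain ⟨⟨h1, h2⟩, h3⟩ := hE
    obtain ⟨p, hp⟩ := ih h3
    refine ⟨X * (p + 4) + 2, fun {O A} n μ e r he hf => ?_⟩
    have hb := exec_bind (A := A) (i := i) (n := n) (c := p.eval n) (p := comp E)
      (fun m => { μ with
        em := ((List.range m).flatMap fun x => E.eval n μ.tab (update e i x)).reverse ++ μ.em })
      (e := e) (r := r) (hf i (by simp [bound])).1 (hf i (by simp [bound])).2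
      (fun m hm => by
        refine (hp n _ _ _ (he.update h2 hm.le) (Free.update (fun j hj => hf j
          (by simp [bound, hj])) h1 _ _)).congr rfl ?_
        simp [List.range_succ])
    refine (hb.weaken ?_).congr rfl rfl
    simp

end Em

/-! ### Computing tables -/

/-- Run a program for all tuples of values of index variables. -/
def bindAll (p : Low Stk O) : List Var → Low Stk O
  | [] => p
  | i :: is => bind i (bindAll p is)

/-- The table of a Boolean function of the index variables. -/
def table (n : ℕ) (val : (Var → ℕ) → Bool) : List Var → (Var → ℕ) → List Bool
  | [], e => [val e]
  | i :: is, e => (List.range n).flatMap fun x => table n val is (update e i x)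

/-- Assign values to several index variables. -/
def assign (e : Var → ℕ) : List Var → List ℕ → Var → ℕ
  | i :: is, x :: xs => assign (update e i x) is xs
  | _, _ => e

theorem length_table (n : ℕ) (val : (Var → ℕ) → Bool) (is : List Var) (e : Var → ℕ) :
    (table n val is e).length = n ^ is.length := by
  induction is generalizing e with
  | nil => rfl
  | cons i is ih => simp [table, ih, List.length_flatMap, pow_succ, mul_comm]

/-- All blocks have length `L`, so block `x` starts at position `x * L`. -/
theorem getD_flatMap_range {α : Type*} (f : ℕ → List α) (L : ℕ) (hf : ∀ x, (f x).length = L)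
    (d : α) (n x y : ℕ) (hx : x < n) (hy : y < L) :
    ((List.range n).flatMap f).getD (x * L + y) d = (f x).getD y d := by
  induction n with
  | zero => omega
  | succ n ih =>
    rw [List.range_succ, List.flatMap_append, List.flatMap_singleton]
    have hl : ((List.range n).flatMap f).length = n * L := by
      simp [List.length_flatMap, hf]
    rcases Nat.lt_succ_iff_lt_or_eq.1 hx with h | rfl
    · rw [List.getD_append, ih h]
      rw [hl]
      calc x * L + y < x * L + L := by omega
        _ = (x + 1) * L := by ring
        _ ≤ n * L := Nat.mul_le_mul_right _ h
    · rw [List.getD_append_right _ _ _ _ (by omega), hl, Nat.add_sub_cancel_left]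

theorem pos_lt {n : ℕ} {xs : List ℕ} (h : ∀ x ∈ xs, x < n) : pos n xs < n ^ xs.length := by
  induction xs with
  | nil => simp [pos]
  | cons x xs ih =>
    have h1 := ih fun y hy => h y (by simp [hy])
    have h2 : x + 1 ≤ n := h x (by simp)
    calc pos n (x :: xs) < x * n ^ xs.length + n ^ xs.length := by simp only [pos]; omega
      _ = (x + 1) * n ^ xs.length := by ring
      _ ≤ n * n ^ xs.length := Nat.mul_le_mul_right _ h2
      _ = n ^ (x :: xs).length := by simp [pow_succ, mul_comm]

theorem getD_table (n : ℕ) (val : (Var → ℕ) → Bool) (is : List Var) (e : Var → ℕ) (xs : List ℕ)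
    (hl : is.length = xs.length) (h : ∀ x ∈ xs, x < n) :
    (table n val is e).getD (pos n xs) false = val (assign e is xs) := by
  induction is generalizing e xs with
  | nil =>
    obtain rfl : xs = [] := by simpa using hl.symm
    rfl
  | cons i is ih =>
    rcases xs with _ | ⟨x, xs⟩
    · simp at hl
    have hl' : is.length = xs.length := by simpa using hl
    have := getD_flatMap_range (fun x => table n val is (update e i x)) (n ^ xs.length)
      (fun x => by rw [length_table, hl']) false n x (pos n xs) (h x (by simp))
      (pos_lt fun y hy => h y (by simp [hy]))
    rw [table, pos, this, ih _ _ hl' fun y hy => h y (by simp [hy])]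
    rfl

/-- A cell may call an oracle, so its cost carries the factor `T`; since `1 ≤ T`, the overhead of
the loops is absorbed by the same factor. `B` lists the variables that the cell itself binds. -/
theorem exec_bindAll (cell : Low Stk O) (is B : List Var) (p : ℕ[X]) : ∃ q : ℕ[X],
    ∀ {A : O → List Symb → Bool → ℕ → Prop} (n T : ℕ) (μ : Mem) (e r : Var → ℕ)
      (val : (Var → ℕ) → Bool), 1 ≤ T → is.Nodup → (∀ i ∈ is, i ∉ consts ∧ i ∉ B) →
    EnvOK n e → Free n (is ++ B) e r →
    (∀ xs, is.length = xs.length → (∀ x ∈ xs, x < n) → ∀ r' l, EnvOK n (assign e is xs) →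
      Free n B (assign e is xs) r' → Exec A cell (st { μ with acc := l } (assign e is xs) r')
        (st { μ with acc := some (val (assign e is xs)) :: l } (assign e is xs) r')
        (p.eval n * T)) →
    Exec A (bindAll cell is) (st μ e r)
      (st { μ with acc := ((table n val is e).map some).reverse ++ μ.acc } e r) (q.eval n * T) := by
  induction is with
  | nil =>
    refine ⟨p, fun n T μ e r val _ _ _ he hf hc => ?_⟩
    exact (hc [] rfl (by simp) r μ.acc he hf)
  | cons i is ih =>
    obtain ⟨q, hq⟩ := ih
    refine ⟨X * (q + 4) + 2, fun {A} n T μ e r val hT hn hd he hf hc => ?_⟩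
    obtain ⟨hi, hn⟩ := List.nodup_cons.1 hn
    have hb := exec_bind (A := A) (i := i) (n := n) (c := q.eval n * T) (p := bindAll cell is)
      (fun m => { μ with acc := (((List.range m).flatMap fun x =>
        table n val is (update e i x)).map some).reverse ++ μ.acc })
      (e := e) (r := r) (hf i (by simp)).1 (hf i (by simp)).2
      (fun m hm => by
        refine (hq n T _ _ _ val hT hn (fun j hj => hd j (by simp [hj]))
          (he.update (hd i (by simp)).1 hm.le) (Free.update (fun j hj => hf j ?_) ?_ _ _)
          (fun xs hl hx r' l he' hf' => ?_)).congr rfl ?_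
        · simp at hj ⊢; tauto
        · simpa using ⟨hi, (hd i (by simp)).2⟩
        · exact hc (m :: xs) (by simp [hl]) (by simpa using ⟨hm, hx⟩) r' l he' hf'
        · simp [List.range_succ])
    refine (hb.weaken ?_).congr rfl rfl
    simp only [eval_add, eval_mul, eval_X, eval_ofNat]
    nlinarith [Nat.mul_le_mul_left n hT]

/-- Fill the table of a relation by running a program for every entry. -/
def fill (a : Rel) (is : List Var) (cell : Low Stk O) : Low Stk O :=
  .seq (bindAll cell is) (.seq (.clear (.rel a)) (.pour .acc (.rel a)))

/-- The new table is completed on `acc` before the old one is erased, so a relation may be redefined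
in terms of its previous value. The bound on the old table limits the cost of erasing it. -/
theorem exec_fill (a : Rel) (cell : Low Stk O) (is B : List Var) (p : ℕ[X]) : ∃ q : ℕ[X],
    ∀ {A : O → List Symb → Bool → ℕ → Prop} (n T : ℕ) (μ : Mem) (e r : Var → ℕ)
      (val : (Var → ℕ) → Bool), 1 ≤ T → is.Nodup → (∀ i ∈ is, i ∉ consts ∧ i ∉ B) →
    EnvOK n e → Free n (is ++ B) e r →
    (∀ xs, is.length = xs.length → (∀ x ∈ xs, x < n) → ∀ r' l, EnvOK n (assign e is xs) →
      Free n B (assign e is xs) r' → Exec A cell (st { μ with acc := l } (assign e is xs) r')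
        (st { μ with acc := some (val (assign e is xs)) :: l } (assign e is xs) r')
        (p.eval n * T)) →
    μ.acc = [] → (μ.tab a).length ≤ (n + 1) ^ 4 →
    Exec A (fill a is cell) (st μ e r)
      (st { μ with tab := update μ.tab a (table n val is e) } e r) (q.eval n * T) := by
  obtain ⟨q, hq⟩ := exec_bindAll cell is B p
  refine ⟨q + (2 * (X + 1) ^ 4 + 1 + (2 * X ^ is.length + 1)),
    fun {A} n T μ e r val hT hn hd he hf hc hacc hlen => ?_⟩
  have h1 := hq n T μ e r val hT hn hd he hf hc
  rw [hacc, List.append_nil] at h1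
  have h2 := exec_clear (A := A) (Stk.rel a)
    (st { μ with acc := ((table n val is e).map some).reverse } e r)
  rw [show ([] : List Symb) = ([] : List Bool).map some from rfl, update_st_rel] at h2
  have h3 := exec_pour (A := A) (k := Stk.acc) (k' := Stk.rel a) (by simp)
    (st { μ with acc := ((table n val is e).map some).reverse, tab := (update μ.tab a []) } e r)
  refine ((h1.seq (h2.seq h3)).weaken ?_).congr rfl ?_
  · simp only [st, List.length_map, List.length_reverse, length_table, eval_add, eval_mul,
      eval_pow, eval_X, eval_one, eval_ofNat, Nat.add_mul]
    have h4 : 2 * (n + 1) ^ 4 + 1 + (2 * n ^ is.length + 1) ≤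
        (2 * (n + 1) ^ 4 + 1 + (2 * n ^ is.length + 1)) * T := Nat.le_mul_of_pos_right _ hT
    simp only [Nat.add_mul] at h4
    omega
  · simp only [st, List.reverse_reverse, update_self, List.map_nil, List.append_nil]
    rw [update_st_acc, update_st_rel, ← hacc, update_idem]

/-- Needed because an oracle call also costs the length of the query. -/
theorem Em.length_eval_le (E : Em) : ∃ p : ℕ[X], ∀ n ρ e, (E.eval n ρ e).length ≤ p.eval n := by
  induction E with
  | sym a => exact ⟨1, fun n ρ e => by simp [Em.eval]⟩
  | val φ => exact ⟨1, fun n ρ e => by simp [Em.eval]⟩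
  | seq E F ih ih' =>
    obtain ⟨p, hp⟩ := ih
    obtain ⟨q, hq⟩ := ih'
    exact ⟨p + q, fun n ρ e => by simpa [Em.eval] using Nat.add_le_add (hp n ρ e) (hq n ρ e)⟩
  | guard φ E ih =>
    obtain ⟨p, hp⟩ := ih
    refine ⟨p, fun n ρ e => ?_⟩
    rw [Em.eval]
    split
    · exact hp n ρ e
    · simp
  | cat i E ih =>
    obtain ⟨p, hp⟩ := ih
    refine ⟨X * p, fun n ρ e => ?_⟩
    rw [Em.eval, List.length_flatMap]
    refine (List.sum_le_card_nsmul _ (p.eval n) ?_).trans (by simp)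
    simpa using fun x _ => hp n ρ (update e i x)

/-! ### Commands -/

/-- Commands that change the tables of relations. -/
inductive Cmd (O : Type) : Type
  /-- define a relation by a formula -/
  | set : Rel → List Var → Fm → Cmd O
  /-- define a relation by a formula and the answer of an oracle on a word -/
  | ask : Rel → List Var → Fm → O → Em → Cmd O
  /-- sequential composition -/
  | seq : Cmd O → Cmd O → Cmd O
  /-- iteration over all values of an index variable -/
  | iter : Var → Cmd O → Cmd O

namespace Cmd

/-- Iterate a function of a counter and a state. -/
def loop {α : Type*} (f : ℕ → α → α) (a : α) : ℕ → α
  | 0 => a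
  | m + 1 => f m (loop f a m)

/-- The effect of a command, where `ans` gives the answers of the oracles. -/
def eval (n : ℕ) (ans : O → List Symb → Bool) :
    Cmd O → (Var → ℕ) → (Rel → List Bool) → Rel → List Bool
  | set a is φ, e, ρ => update ρ a (table n (φ.eval n ρ) is e)
  | ask a is φ o E, e, ρ =>
      update ρ a (table n (fun e => φ.eval n ρ e && ans o (E.eval n ρ e)) is e)
  | seq c d, e, ρ => eval n ans d e (eval n ans c e ρ)
  | iter i c, e, ρ => loop (fun m ρ => eval n ans c (update e i m) ρ) ρ n

/-- All words given to oracles during the execution of a command satisfy `V`. -/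
def Safe (n : ℕ) (ans : O → List Symb → Bool) (V : O → List Symb → Prop) :
    Cmd O → (Var → ℕ) → (Rel → List Bool) → Prop
  | set _ _ _, _, _ => True
  | ask _ is φ o E, e, ρ => ∀ xs, is.length = xs.length → (∀ x ∈ xs, x < n) →
      φ.eval n ρ (assign e is xs) = true → V o (E.eval n ρ (assign e is xs))
  | seq c d, e, ρ => Safe n ans V c e ρ ∧ Safe n ans V d e (eval n ans c e ρ)
  | iter i c, e, ρ => ∀ m < n, Safe n ans V c (update e i m)
      (loop (fun m ρ => eval n ans c (update e i m) ρ) ρ m)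

/-- The bound variables of a command. -/
def bound : Cmd O → List Var
  | set _ is φ => is ++ φ.bound
  | ask _ is φ _ E => is ++ (φ.bound ++ E.bound)
  | seq c d => bound c ++ bound d
  | iter i c => i :: bound c

/-- Well-formed commands. -/
def wf : Cmd O → Bool
  | set _ is φ => φ.wf && decide (is.length ≤ 4) && decide is.Nodup &&
      is.all fun i => decide (i ∉ consts) && decide (i ∉ φ.bound)
  | ask _ is φ _ E => φ.wf && E.wf && decide (is.length ≤ 4) && decide is.Nodup &&
      is.all fun i => decide (i ∉ consts) && decide (i ∉ φ.bound ++ E.bound)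
  | seq c d => wf c && wf d
  | iter i c => decide (i ∉ bound c) && decide (i ∉ consts) && wf c

/-- The program that executes a command. -/
def comp : Cmd O → Low Stk O
  | set a is φ => fill a is (.seq φ.comp (.pop .res fun b => .push .acc (some (bit b))))
  | ask a is φ o E => fill a is (.seq φ.comp (.pop .res fun b =>
      if bit b then .seq E.comp (.call o .em .acc) else .push .acc (some false)))
  | seq c d => .seq (comp c) (comp d)
  | iter i c => bind i (comp c)

/-- A table of arity at most 4 has at most `n ^ 4` entries; this keeps the cost of erasing tables
under control throughout the run. -/
theorem length_eval_le (n : ℕ) (ans : O → List Symb → Bool) (c : Cmd O) (hc : c.wf = true)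
    (e : Var → ℕ) (ρ : Rel → List Bool) (hρ : ∀ a, (ρ a).length ≤ (n + 1) ^ 4) (a : Rel) :
    (c.eval n ans e ρ a).length ≤ (n + 1) ^ 4 := by
  have key : ∀ (a b : Rel) (is : List Var) (val : (Var → ℕ) → Bool) (e : Var → ℕ)
      (ρ : Rel → List Bool), (∀ a, (ρ a).length ≤ (n + 1) ^ 4) → is.length ≤ 4 →
      (update ρ b (table n val is e) a).length ≤ (n + 1) ^ 4 := by
    intro a b is val e ρ hρ hl
    by_cases h : a = b
    · subst h
      rw [update_self, length_table]
      exact (Nat.pow_le_pow_left (by omega) _).trans (Nat.pow_le_pow_right (by omega) hl)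
    · rw [update_of_ne h]; exact hρ a
  induction c generalizing a e ρ with
  | set b is φ =>
    simp only [wf, Bool.and_eq_true, decide_eq_true_eq] at hc
    exact key a b is _ e ρ hρ hc.1.1.2
  | ask b is φ o E =>
    simp only [wf, Bool.and_eq_true, decide_eq_true_eq] at hc
    exact key a b is _ e ρ hρ hc.1.1.2
  | seq c d ih ih' =>
    simp only [wf, Bool.and_eq_true] at hc
    exact ih' hc.2 e _ (fun a => ih hc.1 e ρ hρ a) a
  | iter i c ih =>
    simp only [wf, Bool.and_eq_true] at hc
    rw [eval]
    suffices ∀ m, ∀ a, (loop (fun m ρ => c.eval n ans (update e i m) ρ) ρ m a).length ≤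
      (n + 1) ^ 4 from this n a
    intro m
    induction m with
    | zero => exact hρ
    | succ m ihm => exact fun a => ih hc.2 _ _ ihm a

/-- The oracles are only assumed to answer on words in `V`, as the machines are correct only on
genuine instances. `Safe` guarantees that no other word is ever asked. -/
theorem exec (c : Cmd O) (hc : c.wf = true) : ∃ p : ℕ[X],
    ∀ {A : O → List Symb → Bool → ℕ → Prop} (n T : ℕ) (ans : O → List Symb → Bool)
      (V : O → List Symb → Prop) (μ : Mem) (e r : Var → ℕ), 1 ≤ T →
    (∀ o w, V o w → A o w (ans o w) T) → EnvOK n e → Free n c.bound e r →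
    (∀ a, (μ.tab a).length ≤ (n + 1) ^ 4) → μ.em = [] → μ.acc = [] →
    c.Safe n ans V e μ.tab →
    Exec A c.comp (st μ e r) (st { μ with tab := c.eval n ans e μ.tab } e r)
      (p.eval n * T) := by
  induction c with
  | set a is φ =>
    simp only [wf, Bool.and_eq_true, decide_eq_true_eq, List.all_eq_true] at hc
    obtain ⟨⟨⟨h1, h2⟩, h3⟩, h4⟩ := hc
    obtain ⟨p, hp⟩ := φ.exec h1
    obtain ⟨q, hq⟩ := exec_fill a (O := O)
      (.seq φ.comp (.pop .res fun b => .push .acc (some (bit b)))) is φ.bound (p + 2)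
    refine ⟨q, fun {A} n T ans V μ e r hT hA he hf hlen hem hacc _ => ?_⟩
    refine hq n T μ e r _ hT h3 h4 he hf (fun xs hl hx r' l he' hf' => ?_) hacc (hlen a)
    refine (((hp n _ _ _ he' hf').seq (Exec.pop (Exec.push _ _ _))).weaken ?_).congr rfl ?_
    · exact (Nat.le_mul_of_pos_right _ hT).trans_eq (by simp)
    · simp only [update_st_res, update_st_acc]
      simp [st]
  | ask a is φ o E =>
    simp only [wf, Bool.and_eq_true, decide_eq_true_eq, List.all_eq_true] at hc
    obtain ⟨⟨⟨⟨h1, h5⟩, h2⟩, h3⟩, h4⟩ := hc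
    obtain ⟨p, hp⟩ := φ.exec h1
    obtain ⟨p', hp'⟩ := E.exec h5
    obtain ⟨p'', hp''⟩ := E.length_eval_le
    obtain ⟨q, hq⟩ := exec_fill a (O := O) (.seq φ.comp (.pop .res fun b =>
      if bit b then .seq E.comp (.call o .em .acc) else .push .acc (some false))) is
      (φ.bound ++ E.bound) (p + (p' + (p'' + 4)))
    refine ⟨q, fun {A} n T ans V μ e r hT hA he hf hlen hem hacc hV => ?_⟩
    refine hq n T μ e r _ hT h3 h4 he hf (fun xs hl hx r' l he' hf' => ?_) hacc (hlen a)
    have e1 := hp (A := A) n { μ with acc := l } _ _ he' fun i hi => hf' i (by simp [hi])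
    have e2 := hp' (A := A) n { μ with acc := l } _ _ he' fun i hi => hf' i (by simp [hi])
    have e3 := hp'' n μ.tab (assign e is xs)
    simp only [eval_add, eval_ofNat]
    by_cases h : φ.eval n μ.tab (assign e is xs) = true
    -- The guard is evaluated first, so legality of the query is needed only when it holds.
    · have e4 := hA o _ (hV xs hl hx h)
      simp only [h] at e1 ⊢
      refine ((e1.seq (Exec.pop (t := p'.eval n + (T + p''.eval n + 2)) (s' := _)
        ?_)).weaken ?_)
      · rw [update_st_res]
        simp only [st, List.head?_cons, bit_some, if_true, List.tail_cons]
        refine (e2.seq (Exec.weaken (Exec.call (b := ans o (E.eval n μ.tab (assign e is xs)))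
          (t := T) ?_) ?_)).congr rfl ?_
        · simpa [st, hem] using e4
        · simp [st, hem]; omega
        · rw [update_st_em, update_st_acc]
          simp [st, ← hem]
      · nlinarith
    · rw [Bool.not_eq_true] at h
      simp only [h] at e1 ⊢
      refine ((e1.seq (Exec.pop (t := 1) (s' := _) ?_)).weaken ?_)
      · rw [update_st_res]
        simp only [st, List.head?_cons, bit_some, List.tail_cons]
        refine (Exec.push _ _ _).congr rfl ?_
        rw [update_st_acc]
        simp [st]
      · nlinarith
  | seq c d ih ih' =>
    simp only [wf, Bool.and_eq_true] at hc
    obtain ⟨p, hp⟩ := ih hc.1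
    obtain ⟨q, hq⟩ := ih' hc.2
    refine ⟨p + q, fun {A} n T ans V μ e r hT hA he hf hlen hem hacc hV => ?_⟩
    have h1 := hp n T ans V μ e r hT hA he (fun i hi => hf i (by simp [bound, hi])) hlen hem hacc
      hV.1
    have h2 := hq n T ans V { μ with tab := c.eval n ans e μ.tab } e r hT hA he
      (fun i hi => hf i (by simp [bound, hi])) (fun a => length_eval_le n ans c hc.1 e _ hlen a)
      hem hacc hV.2
    exact (h1.seq h2).weaken (by simp [Nat.add_mul])
  | iter i c ih =>
    have hw := hc
    simp only [wf, Bool.and_eq_true, decide_eq_true_eq] at hc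
    obtain ⟨⟨h1, h2⟩, h3⟩ := hc
    obtain ⟨p, hp⟩ := ih h3
    refine ⟨X * (p + 4) + 2, fun {A} n T ans V μ e r hT hA he hf hlen hem hacc hV => ?_⟩
    have hL : ∀ m, ∀ a, (loop (fun m ρ => c.eval n ans (update e i m) ρ) μ.tab m a).length ≤
        (n + 1) ^ 4 := by
      intro m
      induction m with
      | zero => exact hlen
      | succ m ihm => exact fun a => length_eval_le n ans c h3 _ _ ihm a
    have hb := exec_bind (A := A) (i := i) (n := n) (c := p.eval n * T) (p := comp c)
      (fun m => { μ with tab := loop (fun m ρ => c.eval n ans (update e i m) ρ) μ.tab m })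
      (e := e) (r := r) (hf i (by simp [bound])).1 (hf i (by simp [bound])).2
      (fun m hm => hp n T ans V _ _ _ hT hA (he.update h2 hm.le) (Free.update (fun j hj => hf j
          (by simp [bound, hj])) h1 _ _) (hL m) hem hacc (hV m hm))
    refine (hb.weaken ?_).congr rfl rfl
    simp only [eval_add, eval_mul, eval_X, eval_ofNat]
    nlinarith [Nat.mul_le_mul_left n hT]

end Cmd

end Language

end FPFAut

/-! ### Reading the input and the complete stack program. -/

namespace FPFAut

open Function Polynomial

section Main

variable {O : Type} {A : O → List Symb → Bool → ℕ → Prop}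

/-! ### Reading the input -/

/-- Push a symbol on several stacks. -/
def pushAll (a : Symb) : List Stk → Low Stk O
  | [] => .skip
  | k :: ks => .seq (.push k a) (pushAll a ks)

theorem exec_pushAll (a : Symb) (ks : List Stk) (hks : ks.Nodup) (s : Stk → List Symb) :
    Exec A (pushAll a ks) s (fun k => if k ∈ ks then a :: s k else s k) (ks.length + 1) := by
  induction ks generalizing s with
  | nil => exact (Exec.skip s).congr rfl (by simp)
  | cons k ks ih =>
    obtain ⟨hk, hn⟩ := List.nodup_cons.1 hks
    refine (((Exec.push k a s).seq (ih hn _)).weaken (by simp; omega)).congr rfl ?_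
    funext k'
    by_cases h : k' = k
    · subst h; simp [hk]
    · simp [h]

theorem exec_loop_pushAll (k₀ : Stk) (ks : List Stk) (hks : ks.Nodup) (hk : k₀ ∉ ks) (n : ℕ)
    (s : Stk → List Symb) (hs : s k₀ = ones n) :
    Exec A (.loop k₀ fun a => pushAll a ks) s
      (fun k => if k = k₀ then [] else if k ∈ ks then ones n ++ s k else s k)
      (n * (ks.length + 2) + 1) := by
  induction n generalizing s with
  | zero =>
    refine ((Exec.loop_nil (by simp [hs, ones])).weaken (by omega)).congr rfl ?_
    funext k
    by_cases h : k = k₀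
    · subst h; simp [hs, ones]
    · simp [h, ones]
  | succ n ih =>
    refine ((Exec.loop_cons (a := some true) (l := ones n) (by simp [hs, ones_succ])
      (exec_pushAll (some true) ks hks _) (ih _ (by simp [hk]))).weaken ?_).congr rfl ?_
    · rw [Nat.add_mul]; omega
    · funext k
      by_cases h : k = k₀
      · simp [h]
      · by_cases h' : k ∈ ks
        · simp [h, h', ones, List.replicate_succ']
        · simp [h, h']

/-- The stacks that are initialized with the number of vertices. -/
def initStks : List Stk :=
  consts.map .var ++ ((List.finRange 16).filter fun i => i ∉ consts).map .rem

/-- Distribute the input to the stacks. -/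
def readInput : Low Stk O :=
  .seq (.pour .inp .tape) <|
  .seq (.loop .tape fun a => a.elim (.seq (.pour .acc .em) (.pour .em (.rel 0)))
    fun b => .push .acc (some b)) (.loop .acc fun a => pushAll a initStks)

/-- Stated with an arbitrary continuation `h` of the loop, so that it applies to the bits on either
side of the separator. -/
theorem exec_loop_bits (p : Low Stk O) (l : List Bool) (w : List Symb) (s s' : Stk → List Symb)
    (t : ℕ) (hs : s .tape = l.map some ++ w)
    (h : Exec A (.loop .tape fun a => a.elim p fun b => .push .acc (some b))
      (update (update s .tape w) .acc (l.reverse.map some ++ s .acc)) s' t) :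
    Exec A (.loop .tape fun a => a.elim p fun b => .push .acc (some b)) s s'
      (t + 2 * l.length) := by
  induction l generalizing s with
  | nil =>
    refine h.congr ?_ rfl
    have h1 : update s .tape w = s := update_eq_self_iff.2 (by simpa using hs.symm)
    rw [h1]
    simp
  | cons b l ih =>
    have h1 := ih (update (update s .tape (l.map some ++ w)) .acc (some b :: s .acc)) (by simp)
      (h.congr (by
        funext k
        by_cases hk : k = .acc
        · subst hk; simp
        · by_cases hk' : k = .tape
          · subst hk'; simp
          · simp [hk, hk']) rfl)
    refine (Exec.loop_cons (f := fun a : Symb => a.elim p fun b => .push .acc (some b))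
      (a := some b) (l := l.map some ++ w) (by simpa using hs) (Exec.push _ _ _) (h1.congr ?_ rfl)).weaken ?_
    · simp
    · simp; omega

/-- The initial values of the index variables. -/
def env₀ (n : ℕ) (x : Var) : ℕ := if x ∈ consts then n else 0

/-- The initial numbers of remaining iterations. -/
def rem₀ (n : ℕ) (x : Var) : ℕ := if x ∈ consts then 0 else n

/-- The tables before the execution of the program. -/
def tab₀ (bits : List Bool) : Rel → List Bool := update (fun _ => []) 0 bits

/-- After the input has been reversed onto the tape, the matrix comes before the vertex count. Its
bits collect on `acc` in the original order. The separator triggers their transfer to the table of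
relation `0` via `em`, two reversals that cancel. The unary vertex count then lands on the emptied
`acc`, from which it is copied to all counters. -/
theorem exec_readInput : ∃ p : ℕ[X], ∀ {O : Type} {A : O → List Symb → Bool → ℕ → Prop}
    (n : ℕ) (bits : List Bool), bits.length ≤ n ^ 2 →
    Exec A readInput (onlyStk .inp (ones n ++ [none] ++ bits.map some))
      (st ⟨tab₀ bits, [], [], []⟩ (env₀ n) (rem₀ n)) (p.eval n) := by
  refine ⟨2 * (X + 1 + X ^ 2) + 1 + (1 + 2 * X + (2 * X ^ 2 + 1 + (2 * X ^ 2 + 1) + 1) + 2 * X ^ 2 +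
    (X * ((initStks.length + 2 : ℕ) : ℕ[X]) + 1)), fun {O A} n bits hb => ?_⟩
  have h1 := exec_pour (A := A) (k := Stk.inp) (k' := Stk.tape) (by simp)
    (onlyStk .inp (ones n ++ [none] ++ bits.map some))
  have hw : (ones n ++ [none] ++ bits.map some).reverse =
      bits.reverse.map some ++ none :: (List.replicate n true).map some := by
    simp [ones]
  set s1 : Stk → List Symb := update (fun _ => []) .tape
    (bits.reverse.map some ++ none :: (List.replicate n true).map some) with hs1
  have h1' := h1.congr (s₁' := s1) rfl (by
    simp only [onlyStk, update_self, hw, update_idem]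
    simp [hs1])
  set s2 : Stk → List Symb := update (update (fun _ => []) .tape
    (none :: (List.replicate n true).map some)) .acc (bits.map some) with hs2
  set s3 : Stk → List Symb := update (update (fun _ => []) .tape
    ((List.replicate n true).map some)) (.rel 0) (bits.map some) with hs3
  set s4 : Stk → List Symb := update (update (fun _ => []) .acc (ones n))
    (.rel 0) (bits.map some) with hs4
  set f : Symb → Low Stk O := fun a => a.elim (.seq (.pour .acc .em) (.pour .em (.rel 0)))
    fun b => .push .acc (some b) with hf
  have h4 : Exec A (.loop .tape f) s3 s4 (1 + 2 * (List.replicate n true).length) := by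
    refine exec_loop_bits _ (List.replicate n true) [] s3 s4 1 (by simp [hs3]) ?_
    refine (Exec.loop_nil (by simp)).congr rfl ?_
    funext k
    by_cases hk : k = .acc
    · subst hk; simp [hs4, hs3, ones]
    · by_cases hk' : k = .tape
      · subst hk'; simp [hs4, hk]
      · simp [hs3, hs4, hk, hk', update_apply]
  have h3 : Exec A (.seq (.pour .acc .em) (.pour .em (.rel 0)) : Low Stk O)
      (update s2 .tape ((List.replicate n true).map some)) s3
      (2 * bits.length + 1 + (2 * bits.length + 1)) := by
    have e1 := exec_pour (A := A) (k := Stk.acc) (k' := Stk.em) (by simp)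
      (update s2 .tape ((List.replicate n true).map some))
    have e2 := exec_pour (A := A) (k := Stk.em) (k' := Stk.rel 0) (by simp)
      (update (update (update s2 .tape ((List.replicate n true).map some)) .acc []) .em
        (bits.map some).reverse)
    refine ((Exec.seq e1 (e2.congr (by simp [hs2]) rfl)).weaken (by simp [hs2])).congr rfl ?_
    funext k
    cases k <;> simp [hs2, hs3, update_apply]
  have h5 := Exec.loop_cons (f := f) (a := none) (l := (List.replicate n true).map some)
    (by simp [hs2]) h3 h4
  have h6 := exec_loop_bits _ bits.reverse (none :: (List.replicate n true).map some) s1 s4 _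
    (by simp [hs1]) (h5.congr (by
      rw [hs1, hs2]
      simp) rfl)
  have h7 := exec_loop_pushAll (A := A) .acc initStks (by decide) (by decide) n s4 (by simp [hs4])
  refine ((h1'.seq (h6.seq h7)).weaken ?_).congr rfl ?_
  · simp only [onlyStk, update_self, List.length_append, length_ones, List.length_cons,
      List.length_nil, List.length_map, List.length_reverse, List.length_replicate, eval_add,
      eval_mul, eval_X, eval_pow, eval_one, eval_ofNat, eval_natCast, Nat.cast_id]
    omega
  · funext k
    cases k with
    | var i => 
      simp only [st, env₀, hs4, initStks]
      by_cases h : i ∈ consts <;> simp [h, ones]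
    | rem i => 
      simp only [st, rem₀, hs4, initStks]
      by_cases h : i ∈ consts <;> simp [h, ones]
    | rel a => 
      by_cases h : a = 0 <;> simp [st, tab₀, hs4, initStks, h]
    | _ => simp [st, hs4, initStks]

/-! ### The main program -/

/-- Empty several stacks. -/
def clearAll : List Stk → Low Stk O
  | [] => .skip
  | k :: ks => .seq (.clear k) (clearAll ks)

theorem exec_clearAll (ks : List Stk) (s : Stk → List Symb) (L : ℕ) (hL : ∀ k ∈ ks, (s k).length ≤ L) :
    Exec A (clearAll ks) s (fun k => if k ∈ ks then [] else s k) (ks.length * (2 * L + 1) + 1) := by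
  induction ks generalizing s with
  | nil => exact ((Exec.skip s).weaken (by omega)).congr rfl (by simp)
  | cons k ks ih =>
    refine (((exec_clear k s).seq (ih _ ?_)).weaken ?_).congr rfl ?_
    · intro k' hk'
      by_cases h : k' = k
      · subst h; simp
      · simpa [h] using hL k' (by simp [hk'])
    · have := hL k (by simp)
      rw [List.length_cons, Nat.add_mul]
      omega
    · funext k'
      by_cases h : k' = k
      · subst h; simp
      · simp [h]

/-- The program that reads the input, executes a command, and evaluates a formula. -/
noncomputable def prog (c : Cmd O) (φ : Fm) : Low Stk O :=
  .seq readInput <| .seq c.comp <| .seq φ.comp (clearAll (Finset.univ.erase Stk.res).toList)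

/-- The final cleaning is forced by the format of halting configurations; it is cheap because every
stack has length at most `(n + 1) ^ 4` by then. -/
theorem exec_prog (c : Cmd O) (hc : c.wf = true) (φ : Fm) (hφ : φ.wf = true)
    (hc' : ∀ i ∈ c.bound, i ∉ consts) (hφ' : ∀ i ∈ φ.bound, i ∉ consts) : ∃ p : ℕ[X],
    ∀ {A : O → List Symb → Bool → ℕ → Prop} (n T : ℕ) (ans : O → List Symb → Bool)
      (V : O → List Symb → Prop) (bits : List Bool), 1 ≤ T →
    (∀ o w, V o w → A o w (ans o w) T) → bits.length ≤ n ^ 2 →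
    c.Safe n ans V (env₀ n) (tab₀ bits) →
    Exec A (prog c φ) (onlyStk .inp (ones n ++ [none] ++ bits.map some))
      (onlyStk .res [some (φ.eval n (c.eval n ans (env₀ n) (tab₀ bits)) (env₀ n))])
      (p.eval n * T) := by
  obtain ⟨p, hp⟩ := exec_readInput
  obtain ⟨q, hq⟩ := c.exec hc
  obtain ⟨q', hq'⟩ := φ.exec hφ
  refine ⟨p + (q + (q' + (((Finset.univ.erase Stk.res).toList.length : ℕ[X]) *
    (2 * (X + 1) ^ 4 + 1) + 1))), fun {A} n T ans V bits hT hA hb hV => ?_⟩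
  have he : EnvOK n (env₀ n) := by
    refine ⟨fun x hx => by simp [env₀, hx], fun x => ?_⟩
    unfold env₀
    split <;> omega
  have hfree : ∀ l : List Var, (∀ i ∈ l, i ∉ consts) → Free n l (env₀ n) (rem₀ n) :=
    fun l hl i hi => by simp [env₀, rem₀, hl i hi]
  have hlen : ∀ a, (tab₀ bits a).length ≤ (n + 1) ^ 4 := by
    intro a
    by_cases h : a = 0
    · subst h
      simp only [tab₀, update_self]
      exact (hb.trans (Nat.pow_le_pow_left (by omega) _)).trans
        (Nat.pow_le_pow_right (by omega) (by omega))
    · simp [tab₀, h]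
  have h1 := hp (A := A) n bits hb
  have h2 := hq n T ans V ⟨tab₀ bits, [], [], []⟩ (env₀ n) (rem₀ n) hT hA he (hfree _ hc') hlen
    rfl rfl hV
  have h3 := hq' (A := A) n ⟨c.eval n ans (env₀ n) (tab₀ bits), [], [], []⟩ (env₀ n) (rem₀ n) he
    (hfree _ hφ')
  have hn : n ≤ (n + 1) ^ 4 := by
    calc n ≤ (n + 1) ^ 1 := by simp
      _ ≤ _ := Nat.pow_le_pow_right (by omega) (by omega)
  have h4 := exec_clearAll (A := A) (Finset.univ.erase Stk.res).toList (st ⟨c.eval n ans (env₀ n)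
    (tab₀ bits), [some (φ.eval n (c.eval n ans (env₀ n) (tab₀ bits)) (env₀ n))], [], []⟩
    (env₀ n) (rem₀ n)) ((n + 1) ^ 4) (by
      intro k hk
      cases k with
      | var i => simpa [st] using (he.le i).trans hn
      | rem i =>
        simp only [st, length_ones, rem₀]
        split <;> omega
      | rel a => simpa [st] using Cmd.length_eval_le n ans c hc _ _ hlen a
      | res => simp at hk
      | _ => simp [st])
  refine ((h1.seq (h2.seq (h3.seq h4))).weaken ?_).congr rfl ?_
  · simp only [eval_add, eval_mul, eval_pow, eval_X, eval_one, eval_ofNat, eval_natCast,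
      Nat.cast_id]
    have e1 := Nat.le_mul_of_pos_right (p.eval n) hT
    have e2 := Nat.le_mul_of_pos_right (q'.eval n +
      ((Finset.univ.erase Stk.res).toList.length * (2 * (n + 1) ^ 4 + 1) + 1)) hT
    simp only [Nat.add_mul] at e1 e2 ⊢
    omega
  · funext k
    by_cases h : k = .res
    · subst h; simp [onlyStk, st]
    · simp [h, onlyStk]

end Main

end FPFAut

/-! ### Modules, strong modules, and automorphisms of the quotient. -/

namespace FPFAut

open Function

/-! ### Closures -/

/-- Every step that changes the set adds an element, so after `card V` steps the set is either
stable or everything. -/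
theorem isFixed_iterate_card {V : Type*} [Fintype V] (F : Set V → Set V) (hF : ∀ X, X ⊆ F X)
    (X : Set V) : F (F^[Fintype.card V] X) = F^[Fintype.card V] X := by
  have key : ∀ m, F (F^[m] X) = F^[m] X ∨ m ≤ (F^[m] X).ncard := by
    intro m
    induction m with
    | zero => simp
    | succ m ih =>
      rw [iterate_succ_apply']
      by_cases h : F (F^[m] X) = F^[m] X
      · left; rw [h, h]
      · right
        have h1 := ih.resolve_left h
        have h2 := Set.ncard_lt_ncard ((hF (F^[m] X)).ssubset_of_ne (Ne.symm h)) (Set.toFinite _)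
        omega
  rcases key (Fintype.card V) with h | h
  · exact h
  · have : F^[Fintype.card V] X = Set.univ := by
      refine Set.eq_of_subset_of_ncard_le (Set.subset_univ _) ?_ (Set.toFinite _)
      rw [Set.ncard_univ, Nat.card_eq_fintype_card]
      exact h
    rw [this]
    exact Set.univ_subset_iff.1 (hF _)

theorem subset_iterate {V : Type*} {F : Set V → Set V} (hF : ∀ X, X ⊆ F X) (X : Set V) (m : ℕ) :
    X ⊆ F^[m] X := by
  induction m with
  | zero => exact subset_rfl
  | succ m ih => rw [iterate_succ_apply']; exact ih.trans (hF _)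

theorem iterate_subset {V : Type*} {F : Set V → Set V} {N : Set V}
    (hF : ∀ X, X ⊆ N → F X ⊆ N) {X : Set V} (hX : X ⊆ N) (m : ℕ) : F^[m] X ⊆ N := by
  induction m with
  | zero => exact hX
  | succ m ih => rw [iterate_succ_apply']; exact hF _ ih

section Modules

variable {V : Type*} (G : SimpleGraph V)

theorem isModule_univ : IsModule G Set.univ := fun u hu => absurd (Set.mem_univ u) hu

theorem isModule_singleton (a : V) : IsModule G {a} := by
  rintro u _ v rfl w rfl h
  exact h

variable {G}

theorem not_overlap_iff {M M' : Set V} :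
    ¬ Overlap M M' ↔ Disjoint M M' ∨ M ⊆ M' ∨ M' ⊆ M := by
  rw [Overlap, Set.sdiff_nonempty, Set.sdiff_nonempty, ← Set.not_disjoint_iff_nonempty_inter]
  tauto

theorem isStrongModule_singleton (a : V) : IsStrongModule G {a} := by
  refine ⟨isModule_singleton G a, fun M' _ => ?_⟩
  rw [not_overlap_iff]
  by_cases h : a ∈ M'
  · exact .inr (.inl (by simpa using h))
  · exact .inl (by simpa using h)

theorem isStrongModule_univ : IsStrongModule G Set.univ :=
  ⟨isModule_univ G, fun _ _ => not_overlap_iff.2 (.inr (.inr (Set.subset_univ _)))⟩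

theorem IsStrongModule.subset_or_subset {M N : Set V} (hM : IsStrongModule G M)
    (hN : IsModule G N) {a : V} (ha : a ∈ M) (ha' : a ∈ N) : M ⊆ N ∨ N ⊆ M := by
  rcases not_overlap_iff.1 (hM.2 N hN) with h | h
  · exact absurd ha' (Set.disjoint_left.1 h ha)
  · exact h

variable (G)

/-- Add all vertices that split a set. -/
def splitStep (X : Set V) : Set V := X ∪ {w | ∃ a ∈ X, ∃ b ∈ X, G.Adj w a ∧ ¬ G.Adj w b}

variable {G}

theorem subset_splitStep (X : Set V) : X ⊆ splitStep G X := Set.subset_union_left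

theorem splitStep_subset {X N : Set V} (hN : IsModule G N) (h : X ⊆ N) : splitStep G X ⊆ N := by
  refine Set.union_subset h ?_
  rintro w ⟨a, ha, b, hb, hwa, hwb⟩
  by_contra hw
  exact hwb (hN w hw a (h ha) b (h hb) hwa)

theorem isModule_of_splitStep_subset {X : Set V} (h : splitStep G X ⊆ X) : IsModule G X := by
  intro u hu v hv w hw huv
  by_contra huw
  exact hu (h (.inr ⟨v, hv, w, hw, huv, huw⟩))

section Closure

variable [Fintype V] (G)

/-- The smallest module that contains two vertices. -/
def modClosure (u v : V) : Set V := (splitStep G)^[Fintype.card V] {u, v}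

/-- Add all vertices that split a set, and all smallest modules of pairs that overlap it. -/
def strongStep (X : Set V) : Set V :=
  splitStep G X ∪ {w | ∃ x y, Overlap (modClosure G x y) X ∧ w ∈ modClosure G x y}

/-- The smallest strong module that contains two vertices. -/
def strongClosure (u v : V) : Set V := (strongStep G)^[Fintype.card V] {u, v}

variable {G}

theorem isModule_modClosure (u v : V) : IsModule G (modClosure G u v) :=
  isModule_of_splitStep_subset
    (isFixed_iterate_card (splitStep G) subset_splitStep {u, v}).subset

theorem pair_subset_modClosure (u v : V) : {u, v} ⊆ modClosure G u v :=
  subset_iterate subset_splitStep _ _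

theorem modClosure_subset {N : Set V} (hN : IsModule G N) {u v : V} (hu : u ∈ N) (hv : v ∈ N) :
    modClosure G u v ⊆ N :=
  iterate_subset (fun _ h => splitStep_subset hN h) (Set.pair_subset hu hv) _

theorem subset_strongStep (X : Set V) : X ⊆ strongStep G X :=
  (subset_splitStep X).trans Set.subset_union_left

/-- A module that overlaps `X` meets the strong module `N`, so the two are comparable. It cannot
contain `N`, because it does not contain `X`; hence it lies in `N`. -/
theorem strongStep_subset {X N : Set V} (hN : IsStrongModule G N) (h : X ⊆ N) :
    strongStep G X ⊆ N := by
  refine Set.union_subset (splitStep_subset hN.1 h) ?_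
  rintro w ⟨x, y, ⟨⟨a, ha, ha'⟩, -, ⟨b, hb, hb'⟩⟩, hw⟩
  rcases hN.subset_or_subset (isModule_modClosure x y) (h ha') ha with h' | h'
  · exact absurd (h' (h hb)) hb'
  · exact h' hw

/-- Modules generated by pairs suffice as witnesses: if a module `M'` overlaps the closure, choose
`a` in the intersection and `b` in `M'` outside the closure. The smallest module containing `a` and
`b` lies in `M'`, so it overlaps the closure too, and `strongStep` would have added `b`. -/
theorem isStrongModule_strongClosure (u v : V) : IsStrongModule G (strongClosure G u v) := by
  have hfix : strongStep G (strongClosure G u v) ⊆ strongClosure G u v :=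
    (isFixed_iterate_card (strongStep G) subset_strongStep {u, v}).subset
  refine ⟨isModule_of_splitStep_subset (Set.subset_union_left.trans hfix), ?_⟩
  rintro M' hM' ⟨⟨a, ha, ha'⟩, ⟨c, hc, hc'⟩, ⟨b, hb, hb'⟩⟩
  have h1 := pair_subset_modClosure (G := G) a b
  have h2 := modClosure_subset hM' ha' hb
  refine hb' (hfix (.inr ⟨a, b, ⟨⟨a, h1 (by simp), ha⟩, ⟨b, h1 (by simp), hb'⟩,
    ⟨c, hc, fun h => hc' (h2 h)⟩⟩, h1 (by simp)⟩))

theorem pair_subset_strongClosure (u v : V) : {u, v} ⊆ strongClosure G u v :=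
  subset_iterate subset_strongStep _ _

theorem left_mem_strongClosure (u v : V) : u ∈ strongClosure G u v :=
  pair_subset_strongClosure u v (by simp)

theorem right_mem_strongClosure (u v : V) : v ∈ strongClosure G u v :=
  pair_subset_strongClosure u v (by simp)

theorem strongClosure_subset {N : Set V} (hN : IsStrongModule G N) {u v : V} (hu : u ∈ N)
    (hv : v ∈ N) : strongClosure G u v ⊆ N :=
  iterate_subset (fun _ h => strongStep_subset hN h) (Set.pair_subset hu hv) _

theorem strongClosure_self (u : V) : strongClosure G u u = {u} :=
  (strongClosure_subset (isStrongModule_singleton u) rfl rfl).antisymm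
    (by simpa using left_mem_strongClosure u u)

/-- Strong modules through `a` form a chain. Let `Q` be a maximal one properly inside `N` and `b` in
`N` outside `Q`. The closure of `a, b` is not contained in `Q`, so it contains `Q`; were it
different from `N`, it would contradict maximality. -/
theorem IsStrongModule.exists_eq_strongClosure {N : Set V} (hN : IsStrongModule G N) {a : V}
    (ha : a ∈ N) : ∃ b, strongClosure G a b = N := by
  by_cases h : N = {a}
  · exact ⟨a, by rw [strongClosure_self, h]⟩
  have hfin : {Q : Set V | IsStrongModule G Q ∧ a ∈ Q ∧ Q ⊂ N}.Finite := Set.toFinite _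
  obtain ⟨Q, -, hQ⟩ := hfin.exists_le_maximal (a := {a})
    ⟨isStrongModule_singleton a, rfl, (Set.singleton_subset_iff.2 ha).ssubset_of_ne (Ne.symm h)⟩
  obtain ⟨b, hb, hbQ⟩ := Set.exists_of_ssubset hQ.prop.2.2
  refine ⟨b, by_contra fun hne => ?_⟩
  have hs := isStrongModule_strongClosure (G := G) a b
  have hlt := (strongClosure_subset hN ha hb).ssubset_of_ne hne
  have hab := left_mem_strongClosure (G := G) a b
  rcases hs.subset_or_subset hQ.prop.1.1 hab hQ.prop.2.1 with h1 | h1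
  · exact hbQ (h1 (right_mem_strongClosure a b))
  · exact hbQ (hQ.le_of_ge ⟨hs, hab, hlt⟩ h1 (right_mem_strongClosure a b))

end Closure

/-! ### The maximal modular partition -/

theorem maximal_of_mem {P : Set V} (hP : P ∈ maximalModularPartition G) :
    Maximal (fun N : Set V => IsStrongModule G N ∧ N.Nonempty ∧ N ≠ Set.univ) P := hP

/-- Strong modules with a common vertex are nested, and both are maximal. -/
theorem mem_maximalModularPartition_unique {P Q : Set V} (hP : P ∈ maximalModularPartition G)
    (hQ : Q ∈ maximalModularPartition G) {a : V} (ha : a ∈ P) (ha' : a ∈ Q) : P = Q := by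
  rcases (maximal_of_mem hP).prop.1.subset_or_subset (maximal_of_mem hQ).prop.1.1 ha ha' with h | h
  · exact (maximal_of_mem hP).eq_of_le (maximal_of_mem hQ).prop h
  · exact ((maximal_of_mem hQ).eq_of_le (maximal_of_mem hP).prop h).symm

theorem exists_mem_maximalModularPartition [Finite V] {N : Set V} (hN : IsStrongModule G N)
    (hN' : N.Nonempty) (hne : N ≠ Set.univ) : ∃ P ∈ maximalModularPartition G, N ⊆ P := by
  have hfin : {N : Set V | IsStrongModule G N ∧ N.Nonempty ∧ N ≠ Set.univ}.Finite := Set.toFinite _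
  obtain ⟨P, h1, h2⟩ := hfin.exists_le_maximal (a := N) ⟨hN, hN', hne⟩
  exact ⟨P, h2, h1⟩

theorem exists_part [Finite V] [Nontrivial V] (a : V) :
    ∃ P : maximalModularPartition G, a ∈ P.1 := by
  obtain ⟨P, hP, h⟩ := exists_mem_maximalModularPartition (isStrongModule_singleton (G := G) a)
    (Set.singleton_nonempty a) (Set.singleton_ne_univ a)
  exact ⟨⟨P, hP⟩, h rfl⟩

/-- Distinct parts are disjoint modules, so moving either endpoint within its part does not affect
adjacency. -/
theorem quotientGraph_adj {P Q : maximalModularPartition G} (hPQ : P ≠ Q) {a b : V}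
    (ha : a ∈ P.1) (hb : b ∈ Q.1) : (quotientGraph G).Adj P Q ↔ G.Adj a b := by
  have key : ∀ {P Q : maximalModularPartition G}, P ≠ Q → ∀ {a b a' b' : V}, a ∈ P.1 → b ∈ Q.1 →
      a' ∈ P.1 → b' ∈ Q.1 → G.Adj a b → G.Adj a' b' := by
    intro P Q hPQ a b a' b' ha hb ha' hb' h
    have hd : ∀ {x}, x ∈ P.1 → x ∉ Q.1 := fun hx hx' =>
      hPQ (Subtype.ext (mem_maximalModularPartition_unique P.2 Q.2 hx hx'))
    have h1 := (maximal_of_mem Q.2).prop.1.1 a (hd ha) b hb b' hb' h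
    exact ((maximal_of_mem P.2).prop.1.1 b' (fun h => hd h hb') a ha a' ha' h1.symm).symm
  rw [quotientGraph, SimpleGraph.fromRel_adj]
  constructor
  · rintro ⟨-, h | h⟩
    · exact h a ha b hb
    · exact (h b hb a ha).symm
  · exact fun h => ⟨hPQ, .inl fun u hu v hv => key hPQ ha hb hu hv h⟩

/-! ### Isomorphisms -/

section Iso

variable {W : Type*} {H : SimpleGraph W}

theorem IsModule.preimage (f : G ≃g H) {N : Set W} (hN : IsModule H N) :
    IsModule G (f ⁻¹' N) := fun u hu v hv w hw h =>
  f.map_adj_iff.1 (hN (f u) hu (f v) hv (f w) hw (f.map_adj_iff.2 h))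

theorem IsStrongModule.preimage (f : G ≃g H) {N : Set W} (hN : IsStrongModule H N) :
    IsStrongModule G (f ⁻¹' N) := by
  refine ⟨hN.1.preimage f, ?_⟩
  rintro M' hM' ⟨⟨a, ha, ha'⟩, ⟨b, hb, hb'⟩, ⟨c, hc, hc'⟩⟩
  exact hN.2 (f.symm ⁻¹' M') (hM'.preimage f.symm)
    ⟨⟨f a, ha, by simpa using ha'⟩, ⟨f b, hb, by simpa using hb'⟩, ⟨f c, by simpa using hc, hc'⟩⟩

theorem proper_preimage (f : G ≃g H) {N : Set W}
    (hN : IsStrongModule H N ∧ N.Nonempty ∧ N ≠ Set.univ) :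
    IsStrongModule G (f ⁻¹' N) ∧ (f ⁻¹' N).Nonempty ∧ f ⁻¹' N ≠ Set.univ := by
  obtain ⟨h1, h2, h3⟩ := hN
  refine ⟨h1.preimage f, h2.preimage f.surjective, fun h => h3 ?_⟩
  rw [Set.eq_univ_iff_forall] at h ⊢
  intro x
  simpa using h (f.symm x)

theorem preimage_mem_maximalModularPartition (f : G ≃g H) {P : Set W}
    (hP : P ∈ maximalModularPartition H) : f ⁻¹' P ∈ maximalModularPartition G := by
  refine ⟨proper_preimage f (maximal_of_mem hP).prop, fun N hN hle x hx => ?_⟩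
  have h1 : P ⊆ f.symm ⁻¹' N := fun y hy => hle (by simpa using hy)
  have := (maximal_of_mem hP).le_of_ge (proper_preimage f.symm hN) h1
  exact this (by simpa using hx)

/-- An isomorphism of graphs induces one of the quotient graphs. -/
def quotientIso (f : G ≃g H) : quotientGraph G ≃g quotientGraph H where
  toFun P := ⟨f.symm ⁻¹' P.1, preimage_mem_maximalModularPartition f.symm P.2⟩
  invFun P := ⟨f ⁻¹' P.1, preimage_mem_maximalModularPartition f P.2⟩
  left_inv P := by ext; simp
  right_inv P := by ext; simp
  map_rel_iff' {P Q} := by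
    obtain ⟨a, ha⟩ := (maximal_of_mem P.2).prop.2.1
    obtain ⟨b, hb⟩ := (maximal_of_mem Q.2).prop.2.1
    by_cases h : P = Q
    · subst h; simp
    · rw [quotientGraph_adj h ha hb, ← f.map_adj_iff]
      refine quotientGraph_adj (fun h' => h ?_) (by simpa using ha) (by simpa using hb)
      ext x
      have := congrArg (f x ∈ ·.1) h'
      simpa using this

theorem mem_quotientIso (f : G ≃g H) (P : maximalModularPartition G) (x : V) :
    f x ∈ (quotientIso f P).1 ↔ x ∈ P.1 := by
  simp [quotientIso]

theorem HasFPFAut.of_iso (f : G ≃g H) (h : HasFPFAut G) : HasFPFAut H := by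
  obtain ⟨φ, hφ⟩ := h
  refine ⟨(f.symm.trans φ).trans f, fun v hv => hφ (f.symm v) ?_⟩
  have := congrArg f.symm hv
  simpa using this

theorem hasFPFAut_congr (f : G ≃g H) : HasFPFAut G ↔ HasFPFAut H :=
  ⟨fun h => h.of_iso f, fun h => h.of_iso f.symm⟩

/-- Restrict an isomorphism to induced subgraphs. -/
def induceIso (f : G ≃g H) (P : Set V) (Q : Set W) (h : ∀ x, x ∈ P ↔ f x ∈ Q) :
    G.induce P ≃g H.induce Q where
  toEquiv := f.toEquiv.subtypeEquiv h
  map_rel_iff' := f.map_adj_iff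

/-- An induced subgraph of an induced subgraph is an induced subgraph. -/
noncomputable def induceInduceIso (G : SimpleGraph V) (X : Set V) (P : Set X) :
    (G.induce X).induce P ≃g G.induce (Subtype.val '' P) where
  toEquiv := Equiv.Set.image _ P Subtype.val_injective
  map_rel_iff' := Iff.rfl

end Iso

/-! ### Fixed point free automorphisms and the quotient -/

/-- Forwards, an automorphism induces one of the quotient, and its restrictions show that colours
are preserved and that preserved parts are marked. Backwards, isomorphisms between the parts are
glued along the automorphism of the quotient. The graph `K` is an arbitrary copy of the quotient
because the oracle receives it on numbered vertices. -/
theorem hasFPFAut_iff_hasPFPFAut [Finite V] [Nontrivial V] {U C : Type*} {K : SimpleGraph U}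
    (e : K ≃g quotientGraph G) (c : U → C) (b : U → Bool)
    (hc : ∀ u v, c u = c v ↔ Nonempty (G.induce (e u).1 ≃g G.induce (e v).1))
    (hb : ∀ u, b u = true ↔ HasFPFAut (G.induce (e u).1)) :
    HasFPFAut G ↔ HasPFPFAut K c b := by
  constructor
  · rintro ⟨φ, hφ⟩
    have hm : ∀ u x, x ∈ (e u).1 ↔ φ x ∈ (e (((e.trans (quotientIso φ)).trans e.symm) u)).1 := by
      intro u x
      simp [mem_quotientIso]
    refine ⟨(e.trans (quotientIso φ)).trans e.symm, fun u => ?_, fun u hu => ?_⟩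
    · exact ((hc _ _).2 ⟨induceIso φ _ _ (hm u)⟩).symm
    · rw [hb]
      have hm' := hm u
      rw [hu] at hm'
      refine ⟨induceIso φ _ _ hm', fun x hx => hφ x.1 (congrArg Subtype.val hx)⟩
  · rintro ⟨ψ, h1, h2⟩
    have hpart : ∀ w, ∃ u, w ∈ (e u).1 := by
      intro w
      obtain ⟨P, hP⟩ := exists_part (G := G) w
      exact ⟨e.symm P, by simpa using hP⟩
    choose π hπ using hpart
    have huniq : ∀ {w u u'}, w ∈ (e u).1 → w ∈ (e u').1 → u = u' := fun hu hu' =>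
      e.injective (Subtype.ext (mem_maximalModularPartition_unique (e _).2 (e _).2 hu hu'))
    have hg : ∀ u, ∃ g : G.induce (e u).1 ≃g G.induce (e (ψ u)).1, ∀ x, (g x).1 ≠ x.1 := by
      intro u
      by_cases hu : ψ u = u
      · obtain ⟨g, hg⟩ := (hb u).1 (h2 u hu)
        rw [hu]
        exact ⟨g, fun x hx => hg x (Subtype.ext hx)⟩
      -- Source and target are disjoint parts, so any isomorphism between them moves every vertex.
      · obtain ⟨g⟩ := (hc _ _).1 (h1 u).symm
        refine ⟨g, fun x hx => hu ?_⟩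
        exact huniq (w := x.1) (hx ▸ (g x).2) x.2
    choose g hg using hg
    set F : V → V := fun w => (g (π w) ⟨w, hπ w⟩).1 with hF
    have hFmem : ∀ w, F w ∈ (e (ψ (π w))).1 := fun w => (g (π w) ⟨w, hπ w⟩).2
    have hFeq : ∀ w u (hw : w ∈ (e u).1), F w = (g u ⟨w, hw⟩).1 := by
      intro w u hw
      obtain rfl := huniq hw (hπ w)
      rfl
    have hinj : Injective F := by
      intro w w' h
      have hu : π w = π w' := ψ.injective (huniq (hFmem w) (h ▸ hFmem w'))
      have hw' : w' ∈ (e (π w)).1 := hu ▸ hπ w'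
      rw [hFeq w (π w) (hπ w), hFeq w' (π w) hw'] at h
      exact congrArg Subtype.val ((g (π w)).injective (Subtype.ext h))
    refine ⟨⟨Equiv.ofBijective F (Finite.injective_iff_bijective.1 hinj), fun {w w'} => ?_⟩,
      fun w => hg (π w) ⟨w, hπ w⟩⟩
    change G.Adj (F w) (F w') ↔ G.Adj w w'
    -- Within one part adjacency is preserved by the chosen isomorphism, between different parts by
    -- `ψ`.
    by_cases hu : π w = π w'
    · have hw' : w' ∈ (e (π w)).1 := hu ▸ hπ w'
      rw [hFeq w (π w) (hπ w), hFeq w' (π w) hw']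
      exact (g (π w)).map_adj_iff
    · rw [← quotientGraph_adj (fun h => hu (e.injective h)) (hπ w) (hπ w'),
        ← quotientGraph_adj (fun h => hu (ψ.injective (e.injective h))) (hFmem w) (hFmem w'),
        e.map_adj_iff, e.map_adj_iff, ψ.map_adj_iff]

/-! ### Strong modules of induced subgraphs -/

/-- A vertex outside `X` does not split `X`, let alone a subset of it. -/
theorem isModule_induce {X : Set V} (hX : IsModule G X) (N : Set X) :
    IsModule (G.induce X) N ↔ IsModule G (Subtype.val '' N) := by
  constructor
  · rintro h u hu _ ⟨v, hv, rfl⟩ _ ⟨w, hw, rfl⟩ huv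
    by_cases hux : u ∈ X
    · exact h ⟨u, hux⟩ (fun hu' => hu ⟨_, hu', rfl⟩) v hv w hw huv
    · exact hX u hux v v.2 w w.2 huv
  · intro h u hu v hv w hw huv
    refine h u ?_ v ⟨v, hv, rfl⟩ w ⟨w, hw, rfl⟩ huv
    rintro ⟨u', hu', h'⟩
    exact hu (Subtype.ext h' ▸ hu')

/-- A module of `G` that overlaps a subset of the strong module `X` cannot contain `X`, so it lies
inside `X` and already overlaps within `G[X]`. -/
theorem isStrongModule_induce {X : Set V} (hX : IsStrongModule G X) (N : Set X) :
    IsStrongModule (G.induce X) N ↔ IsStrongModule G (Subtype.val '' N) := by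
  constructor
  · rintro ⟨h1, h2⟩
    refine ⟨(isModule_induce hX.1 N).1 h1, ?_⟩
    rintro M' hM' ⟨⟨_, ⟨a, ha, rfl⟩, ha'⟩, ⟨_, ⟨b, hb, rfl⟩, hb'⟩, ⟨c, hc, hc'⟩⟩
    rcases hX.subset_or_subset hM' a.2 ha' with h | h
    · exact hb' (h b.2)
    · refine h2 (Subtype.val ⁻¹' M') ((isModule_induce hX.1 _).2 ?_)
        ⟨⟨a, ha, ha'⟩, ⟨b, hb, hb'⟩, ⟨⟨c, h hc⟩, hc, fun h' => hc' ⟨_, h', rfl⟩⟩⟩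
      rwa [Subtype.image_preimage_coe, Set.inter_eq_right.2 h]
  · rintro ⟨h1, h2⟩
    refine ⟨(isModule_induce hX.1 N).2 h1, ?_⟩
    rintro M' hM' ⟨⟨a, ha, ha'⟩, ⟨b, hb, hb'⟩, ⟨c, hc, hc'⟩⟩
    refine h2 _ ((isModule_induce hX.1 M').1 hM') ⟨⟨a, ⟨a, ha, rfl⟩, ⟨a, ha', rfl⟩⟩,
      ⟨b, ⟨b, hb, rfl⟩, ?_⟩, ⟨c, ⟨c, hc, rfl⟩, ?_⟩⟩
    · rintro ⟨b', h, h'⟩; exact hb' (Subtype.ext h' ▸ h)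
    · rintro ⟨b', h, h'⟩; exact hc' (Subtype.ext h' ▸ h)

section Part

variable [Fintype V] (G)

/-- The vertices of `X` that lie with `a` in a common strong module properly contained in `X`. -/
def partOf (X : Set V) (a : V) : Set V := {w | w ∈ X ∧ ¬ X ⊆ strongClosure G a w}

variable {G} {X : Set V}

/-- This makes the parts first-order definable from the table of strong closures. If the closure of
`a, w` does not exhaust `X`, it is a proper strong module of `G[X]` and lies in some part, which is
`P` because it contains `a`. -/
theorem image_part_eq (hX : IsStrongModule G X) {P : Set X} (hP : P ∈ maximalModularPartition (G.induce X)) {a : X}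
    (ha : a ∈ P) : Subtype.val '' P = partOf G X a := by
  ext w
  constructor
  · rintro ⟨w, hw, rfl⟩
    refine ⟨w.2, fun h => (maximal_of_mem hP).prop.2.2 ?_⟩
    have h1 := strongClosure_subset ((isStrongModule_induce hX P).1 (maximal_of_mem hP).prop.1) ⟨a, ha, rfl⟩
      ⟨w, hw, rfl⟩
    rw [Set.eq_univ_iff_forall]
    intro x
    obtain ⟨y, hy, hxy⟩ := h1 (h x.2)
    exact Subtype.ext hxy ▸ hy
  · rintro ⟨hw, hne⟩
    have h1 := strongClosure_subset hX a.2 hw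
    have h2 : IsStrongModule (G.induce X) (Subtype.val ⁻¹' strongClosure G a w) := by
      rw [isStrongModule_induce hX, Subtype.image_preimage_coe, Set.inter_eq_right.2 h1]
      exact isStrongModule_strongClosure _ _
    have hne' : (Subtype.val ⁻¹' strongClosure G a w : Set X) ≠ Set.univ := by
      intro h
      exact hne fun x hx => (Set.eq_univ_iff_forall.1 h ⟨x, hx⟩)
    obtain ⟨Q, hQ, hsub⟩ := exists_mem_maximalModularPartition h2
      ⟨a, left_mem_strongClosure (G := G) a.1 w⟩ hne'
    obtain rfl := mem_maximalModularPartition_unique hP hQ ha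
      (hsub (left_mem_strongClosure (G := G) a.1 w))
    exact ⟨⟨w, hw⟩, hsub (right_mem_strongClosure (G := G) a.1 w), rfl⟩

end Part

end Modules

end FPFAut

/-! ### Concrete instances: sublists, colour numbers, and representatives of parts. -/

namespace FPFAut

open Function

/-! ### Subgraphs given by lists -/

section Lists

variable {n : ℕ}

open Classical in
/-- The list of the elements of a set in increasing order. -/
noncomputable def listOf (S : Set (Fin n)) : List (Fin n) :=
  (List.finRange n).filter fun x => decide (x ∈ S)

@[simp] theorem mem_listOf {S : Set (Fin n)} {x : Fin n} : x ∈ listOf S ↔ x ∈ S := by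
  simp [listOf]

theorem nodup_listOf (S : Set (Fin n)) : (listOf S).Nodup :=
  (List.nodup_finRange n).filter _

/-- The induced subgraph on the vertices in a list. -/
def sub (G : SimpleGraph (Fin n)) (L : List (Fin n)) : FinGraph := ⟨L.length, G.comap L.get⟩

variable {G : SimpleGraph (Fin n)} {L : List (Fin n)}

theorem length_le_of_nodup (hL : L.Nodup) : L.length ≤ n := by
  simpa using hL.length_le_card

theorem sub_mem {𝒢 : Set FinGraph} (h𝒢 : IsHereditary 𝒢) (hG : (⟨n, G⟩ : FinGraph) ∈ 𝒢)
    (hL : L.Nodup) : sub G L ∈ 𝒢 :=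
  h𝒢 _ hG _ ⟨⟨⟨L.get, List.nodup_iff_injective_get.1 hL⟩, Iff.rfl⟩⟩

theorem nonempty_subIso (S : Set (Fin n)) :
    Nonempty ((sub G (listOf S)).graph ≃g G.induce S) := by
  classical
  exact ⟨⟨((nodup_listOf S).getEquiv (listOf S)).trans
    (Equiv.subtypeEquivRight fun x => mem_listOf), Iff.rfl⟩⟩

open Classical in
theorem encodeGraph_sub : encodeGraph (sub G L) =
    L.map (fun _ => some true) ++ [none] ++
      L.flatMap fun x => L.map fun y => some (decide (G.Adj x y)) := by
  have h : ∀ {α : Type} (g : Fin n → α), (List.ofFn fun i : Fin L.length => g (L.get i)) = L.map g :=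
    fun g => by
      conv_rhs => rw [← List.ofFn_get L]
      rw [List.map_ofFn]
      rfl
  have h1 : (List.ofFn fun i : Fin (sub G L).n => List.ofFn fun j : Fin (sub G L).n =>
      (some (decide ((sub G L).graph.Adj i j)) : Symb)) =
      L.map fun x => L.map fun y => some (decide (G.Adj x y)) := by
    rw [← h]
    congr 1
    funext i
    rw [← h]
    rfl
  rw [encodeGraph, h1, List.flatMap_def]
  congr 2
  simp [sub]

theorem encodeColoring_get (c : Fin L.length → Fin L.length) (col : Fin n → ℕ)
    (hc : ∀ i, (c i : ℕ) = col (L.get i)) : encodeColoring c =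
      L.flatMap fun x => List.replicate (col x) (some true) ++ [none] := by
  rw [encodeColoring, List.flatMap_def]
  congr 1
  conv_rhs => rw [← List.ofFn_get L]
  rw [List.map_ofFn]
  congr 1
  funext i
  simp [hc]

theorem encodeBoolFun_get (b : Fin n → Bool) :
    encodeBoolFun (fun i : Fin L.length => b (L.get i)) = L.map fun x => some (b x) := by
  rw [encodeBoolFun]
  conv_rhs => rw [← List.ofFn_get L]
  rw [List.map_ofFn]
  rfl

end Lists

/-! ### Numbering equivalence classes -/

section FirstIdx

open Classical in
/-- The number of list elements that precede all list elements equivalent to `a`. -/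
noncomputable def firstIdx {α : Type*} [LinearOrder α] (L : List α) (r : α → α → Prop) (a : α) : ℕ :=
  (L.filter fun b => decide (∀ c ∈ L, c ≤ b → ¬ r a c)).length

variable {α : Type*} [LinearOrder α] {L : List α} {r : α → α → Prop}

theorem firstIdx_lt (hr : ∀ a, r a a) {a : α} (ha : a ∈ L) : firstIdx L r a < L.length := by
  rw [firstIdx, List.length_filter_lt_length_iff_exists]
  exact ⟨a, ha, by simpa using ⟨a, ha, le_rfl, hr a⟩⟩

/-- The number counts the elements below the least member of the class of `a`. If the least members
satisfy `f < f'`, the first filtered list is contained in the second, and `f` belongs only to the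
second. Equal numbers thus mean equal least members. -/
theorem firstIdx_eq_iff (hr : Equivalence r) {a a' : α} (ha : a ∈ L) (ha' : a' ∈ L) :
    firstIdx L r a = firstIdx L r a' ↔ r a a' := by
  classical
  have hmin : ∀ a ∈ L, ∃ f ∈ L, r a f ∧ ∀ c ∈ L, r a c → f ≤ c := by
    intro a ha
    have hne : (L.toFinset.filter (r a)).Nonempty := ⟨a, by simpa using ⟨ha, hr.refl a⟩⟩
    refine ⟨(L.toFinset.filter (r a)).min' hne, ?_, ?_, fun c hc hac =>
      Finset.min'_le _ _ (by simpa using ⟨hc, hac⟩)⟩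
    · have := Finset.min'_mem _ hne
      simp only [Finset.mem_filter, List.mem_toFinset] at this
      exact this.1
    · have := Finset.min'_mem _ hne
      simp only [Finset.mem_filter, List.mem_toFinset] at this
      exact this.2
  have hlt : ∀ {a a' f f'}, f ∈ L → r a f → (∀ c ∈ L, r a' c → f' ≤ c) → f < f' →
      firstIdx L r a ≠ firstIdx L r a' := by
    intro a a' f f' hf haf hf' hlt heq
    have hsub : (L.filter fun b => decide (∀ c ∈ L, c ≤ b → ¬ r a c)).Sublist
        (L.filter fun b => decide (∀ c ∈ L, c ≤ b → ¬ r a' c)) := by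
      refine List.monotone_filter_right L fun b hb => ?_
      simp only [decide_eq_true_eq] at hb ⊢
      intro c hc hcb hac
      exact hb f hf (hlt.le.trans ((hf' c hc hac).trans hcb)) haf
    have := hsub.eq_of_length heq
    have hmem : f ∈ L.filter fun b => decide (∀ c ∈ L, c ≤ b → ¬ r a' c) := by
      simp only [List.mem_filter, decide_eq_true_eq]
      exact ⟨hf, fun c hc hcf hac => absurd (hf' c hc hac) (not_le.2 (hcf.trans_lt hlt))⟩
    rw [← this] at hmem
    simp only [List.mem_filter, decide_eq_true_eq] at hmem
    exact hmem.2 f hf le_rfl haf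
  constructor
  · intro h
    obtain ⟨f, hf, haf, hmf⟩ := hmin a ha
    obtain ⟨f', hf', haf', hmf'⟩ := hmin a' ha'
    rcases lt_trichotomy f f' with hff | rfl | hff
    · exact absurd h (hlt hf haf hmf' hff)
    · exact hr.trans haf (hr.symm haf')
    · exact absurd h.symm (hlt hf' haf' hmf hff)
  · intro h
    have : ∀ c, r a c ↔ r a' c := fun c => ⟨fun h' => hr.trans (hr.symm h) h', hr.trans h⟩
    simp only [firstIdx, this]

end FirstIdx

/-! ### Representatives of the parts -/

section Reps

variable {n : ℕ} (G : SimpleGraph (Fin n)) (X : Set (Fin n))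

/-- The smallest elements of the parts. -/
noncomputable def reps : List (Fin n) :=
  listOf {a | a ∈ X ∧ ∀ b < a, b ∉ partOf G X a}

/-- Two parts induce isomorphic subgraphs. -/
def PartIso (a b : Fin n) : Prop :=
  Nonempty (G.induce (partOf G X a) ≃g G.induce (partOf G X b))

theorem partIso_equivalence : Equivalence (PartIso G X) :=
  ⟨fun _ => ⟨SimpleGraph.Iso.refl⟩, fun ⟨f⟩ => ⟨f.symm⟩, fun ⟨f⟩ ⟨g⟩ => ⟨f.trans g⟩⟩

variable {G X}

theorem mem_reps {a : Fin n} : a ∈ reps G X ↔ a ∈ X ∧ ∀ b < a, b ∉ partOf G X a := by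
  simp [reps]

/-- Every part has exactly one representative, its least vertex, and adjacency of parts can be read
off from representatives. So the quotient is itself an induced subgraph of `G`. -/
theorem exists_quotientIso (hX : IsStrongModule G X) [Nontrivial X] :
    ∃ e : (sub G (reps G X)).graph ≃g quotientGraph (G.induce X),
      ∀ i, Subtype.val '' (e i).1 = partOf G X ((reps G X).get i) := by
  have hmem : ∀ i, (reps G X).get i ∈ X := fun i => (mem_reps.1 (List.get_mem _ _)).1
  choose f hf using fun i => exists_part (G := G.induce X) ⟨_, hmem i⟩
  have hpart : ∀ i, Subtype.val '' (f i).1 = partOf G X ((reps G X).get i) := fun i =>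
    image_part_eq hX (f i).2 (hf i)
  have hinj : Injective f := by
    intro i j hij
    have key : ∀ i j, f i = f j → ¬ (reps G X).get i < (reps G X).get j := by
      intro i j hij hlt
      refine (mem_reps.1 (List.get_mem (reps G X) j)).2 _ hlt ?_
      rw [← hpart j, ← hij]
      exact ⟨_, hf i, rfl⟩
    exact List.nodup_iff_injective_get.1 (nodup_listOf _)
      (le_antisymm (not_lt.1 (key j i hij.symm)) (not_lt.1 (key i j hij)))
  have hsurj : Surjective f := by
    intro P
    obtain ⟨x, hx⟩ := (maximal_of_mem P.2).prop.2.1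
    obtain ⟨a, ⟨a, ha, rfl⟩, hmin⟩ := (Set.toFinite (Subtype.val '' P.1)).exists_minimal
      ⟨x.1, x, hx, rfl⟩
    have hP := image_part_eq hX P.2 ha
    have har : a.1 ∈ reps G X := by
      refine mem_reps.2 ⟨a.2, fun b hb hb' => ?_⟩
      rw [← hP] at hb'
      exact absurd (hmin hb' hb.le) (not_le.2 hb)
    obtain ⟨i, hi⟩ := List.get_of_mem har
    refine ⟨i, Subtype.ext (mem_maximalModularPartition_unique (f i).2 P.2 (hf i) ?_)⟩
    have : (⟨(reps G X).get i, hmem i⟩ : X) = a := Subtype.ext hi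
    rwa [this]
  refine ⟨⟨Equiv.ofBijective f ⟨hinj, hsurj⟩, fun {i j} => ?_⟩, hpart⟩
  change (quotientGraph (G.induce X)).Adj (f i) (f j) ↔ _
  by_cases hij : i = j
  · subst hij; simp
  · rw [quotientGraph_adj (fun h => hij (hinj h)) (hf i) (hf j)]
    rfl

/-- The witness is `G[X]`, which belongs to `𝒢` by heredity. -/
theorem sub_reps_mem {𝒢 : Set FinGraph} (h𝒢 : IsHereditary 𝒢) (hG : (⟨n, G⟩ : FinGraph) ∈ 𝒢)
    (hX : IsStrongModule G X) [Nontrivial X] : sub G (reps G X) ∈ quotientClass 𝒢 := by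
  obtain ⟨e, -⟩ := exists_quotientIso hX
  obtain ⟨f⟩ := nonempty_subIso (G := G) X
  refine ⟨sub G (listOf X), sub_mem h𝒢 hG (nodup_listOf X), ?_, ⟨e.trans (quotientIso f.symm)⟩⟩
  have h1 : 1 < Nat.card X := Finite.one_lt_card
  rw [Nat.card_congr f.symm.toEquiv, Nat.card_fin] at h1
  exact h1

/-- The colouring of the representatives by the isomorphism types of their parts. -/
noncomputable def repColoring (G : SimpleGraph (Fin n)) (X : Set (Fin n)) :
    Fin (reps G X).length → Fin (reps G X).length := fun i =>
  ⟨firstIdx (reps G X) (PartIso G X) ((reps G X).get i),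
    firstIdx_lt (partIso_equivalence G X).refl (List.get_mem _ _)⟩

theorem hasFPFAut_induce_iff (hX : IsStrongModule G X) [Nontrivial X] (b : Fin n → Bool)
    (hb : ∀ a ∈ reps G X, b a = true ↔ HasFPFAut (G.induce (partOf G X a))) :
    HasFPFAut (G.induce X) ↔ HasPFPFAut (sub G (reps G X)).graph (repColoring G X)
      (fun i => b ((reps G X).get i)) := by
  obtain ⟨e, he⟩ := exists_quotientIso hX
  have hiso : ∀ i, Nonempty ((G.induce X).induce (e i).1 ≃g
      G.induce (partOf G X ((reps G X).get i))) := fun i => by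
    rw [← he i]
    exact ⟨induceInduceIso _ _ _⟩
  refine hasFPFAut_iff_hasPFPFAut e _ _ (fun i j => ?_) fun i => ?_
  · obtain ⟨f⟩ := hiso i
    obtain ⟨g⟩ := hiso j
    refine (Fin.ext_iff.trans (firstIdx_eq_iff (partIso_equivalence G X)
      (List.get_mem (reps G X) i) (List.get_mem (reps G X) j))).trans ?_
    exact ⟨fun ⟨h⟩ => ⟨(f.trans h).trans g.symm⟩, fun ⟨h⟩ => ⟨(f.symm.trans h).trans g⟩⟩
  · obtain ⟨f⟩ := hiso i
    exact (hb _ (List.get_mem _ _)).trans (hasFPFAut_congr f).symm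

end Reps

end FPFAut

/-! ### The algorithm as commands, and correctness of the preliminary tables. -/

namespace FPFAut

open Function

/-! ### Semantics of formulas over the vertices -/

section Semantics

variable {n : ℕ} {ρ : Rel → List Bool} {e : Var → ℕ}

/-- A formula holds. -/
def Sat (n : ℕ) (ρ : Rel → List Bool) (φ : Fm) (e : Var → ℕ) : Prop := φ.eval n ρ e = true

/-- The relation stored in the table of a relation symbol. -/
def Tab (n : ℕ) (ρ : Rel → List Bool) (a : Rel) (xs : List ℕ) : Prop :=
  (ρ a).getD (pos n xs) false = true

@[simp] theorem sat_rel {a : Rel} {is : List Var} :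
    Sat n ρ (.rel a is) e ↔ Tab n ρ a (is.map e) := Iff.rfl

@[simp] theorem sat_lt {i j : Var} : Sat n ρ (.lt i j) e ↔ e i < e j := by simp [Sat, Fm.eval]

@[simp] theorem sat_not {φ : Fm} : Sat n ρ (.not φ) e ↔ ¬ Sat n ρ φ e := by simp [Sat, Fm.eval]

@[simp] theorem sat_and {φ ψ : Fm} : Sat n ρ (.and φ ψ) e ↔ Sat n ρ φ e ∧ Sat n ρ ψ e := by
  simp [Sat, Fm.eval]

@[simp] theorem sat_or {φ ψ : Fm} : Sat n ρ (.or φ ψ) e ↔ Sat n ρ φ e ∨ Sat n ρ ψ e := by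
  simp only [Fm.or, sat_not, sat_and]
  tauto

@[simp] theorem sat_ex {i : Var} {φ : Fm} :
    Sat n ρ (.ex i φ) e ↔ ∃ x : Fin n, Sat n ρ φ (update e i x) := by
  simp [Sat, Fm.eval, Fin.exists_iff]

@[simp] theorem sat_all {i : Var} {φ : Fm} :
    Sat n ρ (.all i φ) e ↔ ∀ x : Fin n, Sat n ρ φ (update e i x) := by
  simp [Fm.all]

/-- Equality. -/
def Fm.eq (i j : Var) : Fm := .and (.not (.lt i j)) (.not (.lt j i))

@[simp] theorem sat_eq {i j : Var} : Sat n ρ (.eq i j) e ↔ e i = e j := by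
  simp only [Fm.eq, sat_and, sat_not, sat_lt]
  omega

/-- Equivalence. -/
def Fm.iff (φ ψ : Fm) : Fm := .or (.and φ ψ) (.and (.not φ) (.not ψ))

@[simp] theorem sat_iff {φ ψ : Fm} :
    Sat n ρ (.iff φ ψ) e ↔ (Sat n ρ φ e ↔ Sat n ρ ψ e) := by
  simp only [Fm.iff, sat_or, sat_and, sat_not]
  tauto

/-- A valid formula. -/
def Fm.tt : Fm := .not (.and (.lt 0 1) (.lt 1 0))

@[simp] theorem sat_tt : Sat n ρ .tt e := by
  simp only [Fm.tt, sat_and, sat_not, sat_lt]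
  omega

theorem tab_update_self {a : Rel} {val : (Var → ℕ) → Bool} {is : List Var} {xs : List (Fin n)}
    (hl : is.length = xs.length) :
    Tab n (update ρ a (table n val is e)) a (xs.map Fin.val) ↔
      val (assign e is (xs.map Fin.val)) = true := by
  rw [Tab, update_self, getD_table _ _ _ _ _ (by simpa using hl) (by simp)]

theorem tab_congr {ρ' : Rel → List Bool} {a : Rel} (h : ρ' a = ρ a) (xs : List ℕ) :
    Tab n ρ' a xs ↔ Tab n ρ a xs := by
  rw [Tab, Tab, h]

/-- Skipping the unwanted indices in a loop over all of them amounts to looping over the sorted list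
of a subset; this is how the encodings of induced subgraphs arise. -/
theorem flatMap_range_guard (S : Set (Fin n)) (p : ℕ → Prop) [DecidablePred p]
    (hp : ∀ x : Fin n, p x ↔ x ∈ S) (w : ℕ → List Symb) :
    ((List.range n).flatMap fun x => if p x then w x else []) =
      (listOf S).flatMap fun x : Fin n => w x := by
  classical
  rw [← List.map_coe_finRange_eq_range, List.flatMap_map, listOf]
  induction List.finRange n with
  | nil => rfl
  | cons x l ih =>
    rw [List.flatMap_cons, ih, List.filter_cons]
    by_cases h : x ∈ S
    · simp [h, (hp x).2 h]
    · simp [h, mt (hp x).1 h]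

theorem eval_cat_guard {i : Var} {φ : Fm} {E : Em} (S : Set (Fin n))
    (h : ∀ x : Fin n, Sat n ρ φ (update e i x) ↔ x ∈ S) :
    (Em.cat i (.guard φ E)).eval n ρ e =
      (listOf S).flatMap fun x : Fin n => E.eval n ρ (update e i x) :=
  flatMap_range_guard S (fun x => φ.eval n ρ (update e i x) = true) h
    fun x => E.eval n ρ (update e i x)

theorem eval_eq_decide {φ : Fm} {p : Prop} [Decidable p] (h : Sat n ρ φ e ↔ p) : φ.eval n ρ e = decide p := by
  rw [Bool.eq_iff_iff, decide_eq_true_eq]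
  exact h

/-- The encoding of the induced subgraph on the vertices that satisfy a formula. -/
def Em.subgraph (φ : Var → Fm) (i j : Var) : Em :=
  .seq (.seq (.cat i (.guard (φ i) (.sym (some true)))) (.sym none))
    (.cat i (.guard (φ i) (.cat j (.guard (φ j) (.val (.rel 0 [i, j]))))))

theorem eval_subgraph {G : SimpleGraph (Fin n)} {φ : Var → Fm} {i j : Var} (hij : i ≠ j)
    (S : Set (Fin n)) (hG : ∀ x y : Fin n, Tab n ρ 0 [↑x, ↑y] ↔ G.Adj x y)
    (h1 : ∀ x : Fin n, Sat n ρ (φ i) (update e i x) ↔ x ∈ S)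
    (h2 : ∀ x y : Fin n, Sat n ρ (φ j) (update (update e i x) j y) ↔ y ∈ S) :
    (Em.subgraph φ i j).eval n ρ e = encodeGraph (sub G (listOf S)) := by
  classical
  have h3 : ∀ x : Fin n, (Em.cat j (.guard (φ j) (.val (.rel 0 [i, j])))).eval n ρ (update e i x) =
      (listOf S).map fun y => some (decide (G.Adj x y)) := by
    intro x
    rw [eval_cat_guard S (h2 x), ← List.flatMap_singleton' ((listOf S).map _), List.flatMap_map]
    refine congrArg (List.flatMap · _) (funext fun y => ?_)
    rw [Em.eval, eval_eq_decide (p := G.Adj x y)]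
    simp [hij, hG]
  rw [encodeGraph_sub, Em.subgraph, Em.eval, Em.eval, eval_cat_guard S h1, eval_cat_guard S h1]
  simp only [h3]
  simp only [Em.eval, List.map_eq_flatMap]

end Semantics

/-! ### The program -/

/-- Some vertices of the set given by a relation and `0`, `1` are split by `2`. -/
def splitFm (a : Rel) : Fm :=
  .ex 3 (.and (.rel a [0, 1, 3]) (.ex 4 (.and (.rel a [0, 1, 4])
    (.and (.rel 0 [2, 3]) (.not (.rel 0 [2, 4]))))))

/-- Initialize the closures. -/
def pairCmd (a : Rel) : Cmd Bool := .set a [0, 1, 2] (.or (.eq 2 0) (.eq 2 1))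

/-- One step towards the smallest modules. -/
def modCmd : Cmd Bool := .set 1 [0, 1, 2] (.or (.rel 1 [0, 1, 2]) (splitFm 1))

/-- One step towards the smallest strong modules. -/
def strongCmd : Cmd Bool := .set 2 [0, 1, 2] (.or (.or (.rel 2 [0, 1, 2]) (splitFm 2))
  (.ex 5 (.ex 6 (.and
    (.and (.ex 7 (.and (.rel 1 [5, 6, 7]) (.rel 2 [0, 1, 7])))
      (.and (.ex 8 (.and (.rel 1 [5, 6, 8]) (.not (.rel 2 [0, 1, 8]))))
        (.ex 9 (.and (.rel 2 [0, 1, 9]) (.not (.rel 1 [5, 6, 9]))))))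
    (.rel 1 [5, 6, 2])))))

/-- Compute the parts. -/
def partCmd : Cmd Bool := .set 3 [0, 1, 2, 3] (.and (.rel 2 [0, 1, 3])
  (.ex 4 (.and (.rel 2 [0, 1, 4]) (.not (.rel 2 [2, 3, 4])))))

/-- Compute the representatives. -/
def repCmd : Cmd Bool := .set 6 [0, 1, 2] (.and (.rel 2 [0, 1, 2])
  (.not (.ex 3 (.and (.lt 3 2) (.rel 3 [0, 1, 2, 3])))))

/-- Find out which parts are isomorphic. -/
def isoCmd : Cmd Bool := .ask 4 [0, 1, 2, 3] .tt false
  (.seq (.subgraph (fun i => .rel 3 [0, 1, 2, i]) 4 5) (.subgraph (fun i => .rel 3 [0, 1, 3, i]) 4 5))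

/-- The encoding of the colouring of the representatives. -/
def colorEm : Em := .cat 2 (.guard (.rel 6 [0, 1, 2]) (.seq (.cat 3 (.guard (.and (.rel 6 [0, 1, 3])
  (.not (.ex 4 (.and (.rel 6 [0, 1, 4]) (.and (.not (.lt 3 4)) (.rel 4 [0, 1, 2, 4]))))))
    (.sym (some true)))) (.sym none)))

/-- The encoding of the Boolean function on the representatives. -/
def boolEm : Em := .cat 2 (.guard (.rel 6 [0, 1, 2]) (.val (.ex 3 (.and (.rel 5 [2, 3])
  (.all 4 (.iff (.rel 2 [2, 3, 4]) (.rel 3 [0, 1, 2, 4])))))))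

/-- Find out which strong modules have fixed point free automorphisms, using the results for
smaller ones. -/
def fpfCmd : Cmd Bool := .ask 5 [0, 1] (.not (.eq 0 1)) true
  (.seq (.seq (.subgraph (fun i => .rel 6 [0, 1, i]) 4 5) colorEm) boolEm)

/-- Compute the tables from which the oracle for coloured quotient graphs is asked. -/
def tablesCmd : Cmd Bool :=
  .seq (.seq (.seq (.seq (.seq (pairCmd 1) (.iter 12 modCmd))
    (.seq (pairCmd 2) (.iter 12 strongCmd))) partCmd) repCmd) isoCmd

/-- The main command. -/
def mainCmd : Cmd Bool := .seq tablesCmd (.iter 12 fpfCmd)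

/-- The formula that gives the answer. -/
def answerFm : Fm := .or (.not (.ex 0 .tt))
  (.ex 0 (.ex 1 (.and (.all 2 (.rel 2 [0, 1, 2])) (.rel 5 [0, 1]))))

theorem mainCmd_wf : mainCmd.wf = true := by decide

theorem answerFm_wf : answerFm.wf = true := by decide

theorem mainCmd_bound : ∀ i ∈ mainCmd.bound, i ∉ consts := by decide

theorem answerFm_bound : ∀ i ∈ answerFm.bound, i ∉ consts := by decide

/-! ### Correctness of the program -/

section Correctness

variable {n : ℕ} {G : SimpleGraph (Fin n)} {ans : Bool → List Symb → Bool}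
  {ρ : Rel → List Bool} {e : Var → ℕ}

theorem tab_set {a : Rel} {is : List Var} {φ : Fm} {xs : List (Fin n)}
    (hl : is.length = xs.length) :
    Tab n ((Cmd.set a is φ : Cmd Bool).eval n ans e ρ) a (xs.map Fin.val) ↔
      Sat n ρ φ (assign e is (xs.map Fin.val)) :=
  tab_update_self hl

theorem tab_pairCmd (a : Rel) (u v w : Fin n) :
    Tab n ((pairCmd a).eval n ans e ρ) a [↑u, ↑v, ↑w] ↔ w ∈ ({u, v} : Set (Fin n)) := by
  refine (tab_set (xs := [u, v, w]) rfl).trans ?_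
  simp [assign, Fin.val_inj]

theorem tab_modCmd {S : Fin n → Fin n → Set (Fin n)}
    (hG : ∀ x y : Fin n, Tab n ρ 0 [↑x, ↑y] ↔ G.Adj x y)
    (h : ∀ u v w : Fin n, Tab n ρ 1 [↑u, ↑v, ↑w] ↔ w ∈ S u v) (u v w : Fin n) :
    Tab n (modCmd.eval n ans e ρ) 1 [↑u, ↑v, ↑w] ↔ w ∈ splitStep G (S u v) := by
  refine (tab_set (xs := [u, v, w]) rfl).trans ?_
  simp [assign, splitFm, hG, h, splitStep]

theorem tab_strongCmd {S : Fin n → Fin n → Set (Fin n)}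
    (hG : ∀ x y : Fin n, Tab n ρ 0 [↑x, ↑y] ↔ G.Adj x y)
    (hM : ∀ u v w : Fin n, Tab n ρ 1 [↑u, ↑v, ↑w] ↔ w ∈ modClosure G u v)
    (h : ∀ u v w : Fin n, Tab n ρ 2 [↑u, ↑v, ↑w] ↔ w ∈ S u v) (u v w : Fin n) :
    Tab n (strongCmd.eval n ans e ρ) 2 [↑u, ↑v, ↑w] ↔ w ∈ strongStep G (S u v) := by
  refine (tab_set (xs := [u, v, w]) rfl).trans ?_
  simp [assign, splitFm, hG, h, hM, splitStep, strongStep, Overlap, Set.Nonempty]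

theorem tab_partCmd
    (h : ∀ u v w : Fin n, Tab n ρ 2 [↑u, ↑v, ↑w] ↔ w ∈ strongClosure G u v) (u v a w : Fin n) :
    Tab n (partCmd.eval n ans e ρ) 3 [↑u, ↑v, ↑a, ↑w] ↔
      w ∈ partOf G (strongClosure G u v) a := by
  refine (tab_set (xs := [u, v, a, w]) rfl).trans ?_
  simp [assign, h, partOf, Set.not_subset]

theorem tab_repCmd
    (h : ∀ u v w : Fin n, Tab n ρ 2 [↑u, ↑v, ↑w] ↔ w ∈ strongClosure G u v)
    (h' : ∀ u v a w : Fin n, Tab n ρ 3 [↑u, ↑v, ↑a, ↑w] ↔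
      w ∈ partOf G (strongClosure G u v) a) (u v a : Fin n) :
    Tab n (repCmd.eval n ans e ρ) 6 [↑u, ↑v, ↑a] ↔ a ∈ reps G (strongClosure G u v) := by
  refine (tab_set (xs := [u, v, a]) rfl).trans ?_
  simp [assign, h, h', mem_reps]

/-- The words on which the oracles are asked. -/
structure OracleOK (𝒢 : Set FinGraph) (n : ℕ) (ans : Bool → List Symb → Bool)
    (V : Bool → List Symb → Prop) : Prop where
  iso : ∀ x : (isoProblem 𝒢).Inst, (isoProblem 𝒢).size x ≤ n → V false ((isoProblem 𝒢).encode x) ∧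
    (ans false ((isoProblem 𝒢).encode x) = true ↔ (isoProblem 𝒢).IsYes x)
  pfpf : ∀ x : (pfpfProblem (quotientClass 𝒢)).Inst, (pfpfProblem (quotientClass 𝒢)).size x ≤ n →
    V true ((pfpfProblem (quotientClass 𝒢)).encode x) ∧
    (ans true ((pfpfProblem (quotientClass 𝒢)).encode x) = true ↔
      (pfpfProblem (quotientClass 𝒢)).IsYes x)

variable {𝒢 : Set FinGraph} {V : Bool → List Symb → Prop}

/-- Legality of the query does not require `a` and `b` to lie in `X`: every induced subgraph of `G`
belongs to `𝒢`. Hence `isoCmd` needs no guard. -/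
theorem OracleOK.partIso (hO : OracleOK 𝒢 n ans V) (h𝒢 : IsHereditary 𝒢)
    (hGm : (⟨n, G⟩ : FinGraph) ∈ 𝒢) (X : Set (Fin n)) (a b : Fin n) :
    V false (encodeGraph (sub G (listOf (partOf G X a))) ++
      encodeGraph (sub G (listOf (partOf G X b)))) ∧
    (ans false (encodeGraph (sub G (listOf (partOf G X a))) ++
      encodeGraph (sub G (listOf (partOf G X b)))) = true ↔ PartIso G X a b) := by
  have h := hO.iso ⟨⟨_, sub_mem h𝒢 hGm (nodup_listOf (partOf G X a))⟩,
    ⟨_, sub_mem h𝒢 hGm (nodup_listOf (partOf G X b))⟩⟩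
    (max_le (length_le_of_nodup (nodup_listOf _)) (length_le_of_nodup (nodup_listOf _)))
  refine ⟨h.1, h.2.trans ?_⟩
  obtain ⟨f⟩ := nonempty_subIso (G := G) (partOf G X a)
  obtain ⟨g⟩ := nonempty_subIso (G := G) (partOf G X b)
  exact ⟨fun ⟨k⟩ => ⟨(f.symm.trans k).trans g⟩, fun ⟨k⟩ => ⟨(f.trans k).trans g.symm⟩⟩

theorem eval_isoEm (hG : ∀ x y : Fin n, Tab n ρ 0 [↑x, ↑y] ↔ G.Adj x y)
    (h : ∀ u v a w : Fin n, Tab n ρ 3 [↑u, ↑v, ↑a, ↑w] ↔ w ∈ partOf G (strongClosure G u v) a)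
    (u v a b : Fin n) :
    (Em.seq (.subgraph (fun i => .rel 3 [0, 1, 2, i]) 4 5)
      (.subgraph (fun i => .rel 3 [0, 1, 3, i]) 4 5)).eval n ρ
        (assign e [0, 1, 2, 3] [↑u, ↑v, ↑a, ↑b]) =
      encodeGraph (sub G (listOf (partOf G (strongClosure G u v) a))) ++
      encodeGraph (sub G (listOf (partOf G (strongClosure G u v) b))) := by
  rw [Em.eval, eval_subgraph (by decide) (partOf G (strongClosure G u v) a) hG,
    eval_subgraph (by decide) (partOf G (strongClosure G u v) b) hG]
  all_goals simp [assign, h]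

theorem tab_isoCmd (hO : OracleOK 𝒢 n ans V) (h𝒢 : IsHereditary 𝒢)
    (hGm : (⟨n, G⟩ : FinGraph) ∈ 𝒢) (hG : ∀ x y : Fin n, Tab n ρ 0 [↑x, ↑y] ↔ G.Adj x y)
    (h : ∀ u v a w : Fin n, Tab n ρ 3 [↑u, ↑v, ↑a, ↑w] ↔ w ∈ partOf G (strongClosure G u v) a)
    (u v a b : Fin n) :
    Tab n (isoCmd.eval n ans e ρ) 4 [↑u, ↑v, ↑a, ↑b] ↔ PartIso G (strongClosure G u v) a b := by
  refine (tab_update_self (xs := [u, v, a, b]) rfl).trans ?_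
  rw [Bool.and_eq_true]
  refine (and_iff_right sat_tt).trans ?_
  simp only [List.map_cons, List.map_nil]
  rw [eval_isoEm hG h]
  exact (hO.partIso h𝒢 hGm _ a b).2

theorem exists_of_forall_lt {xs : List ℕ} (h : ∀ x ∈ xs, x < n) :
    ∃ ys : List (Fin n), ys.map Fin.val = xs := by
  induction xs with
  | nil => exact ⟨[], rfl⟩
  | cons x xs ih =>
    obtain ⟨ys, rfl⟩ := ih fun y hy => h y (by simp [hy])
    exact ⟨⟨x, h x (by simp)⟩ :: ys, rfl⟩

theorem safe_isoCmd (hO : OracleOK 𝒢 n ans V) (h𝒢 : IsHereditary 𝒢)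
    (hGm : (⟨n, G⟩ : FinGraph) ∈ 𝒢) (hG : ∀ x y : Fin n, Tab n ρ 0 [↑x, ↑y] ↔ G.Adj x y)
    (h : ∀ u v a w : Fin n, Tab n ρ 3 [↑u, ↑v, ↑a, ↑w] ↔
      w ∈ partOf G (strongClosure G u v) a) : isoCmd.Safe n ans V e ρ := by
  intro xs hl hx _
  obtain ⟨ys, rfl⟩ := exists_of_forall_lt hx
  obtain ⟨u, v, a, b, rfl⟩ : ∃ u v a b, ys = [u, v, a, b] := by
    rcases ys with _ | ⟨u, _ | ⟨v, _ | ⟨a, _ | ⟨b, _ | ⟨c, l⟩⟩⟩⟩⟩ <;> simp at hl ⊢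
  simp only [List.map_cons, List.map_nil]
  rw [eval_isoEm hG h]
  exact (hO.partIso h𝒢 hGm _ a b).1

end Correctness

end FPFAut

/-! ### Correctness of one round of the dynamic program. -/

namespace FPFAut

open Function

section Correctness

variable {n : ℕ} {G : SimpleGraph (Fin n)} {ans : Bool → List Symb → Bool}
  {ρ : Rel → List Bool} {e : Var → ℕ} {𝒢 : Set FinGraph} {V : Bool → List Symb → Prop}

/-- The tables from which the oracle for coloured quotient graphs is asked. -/
structure TablesOK (G : SimpleGraph (Fin n)) (ρ : Rel → List Bool) : Prop where
  adj : ∀ x y : Fin n, Tab n ρ 0 [↑x, ↑y] ↔ G.Adj x y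
  strong : ∀ u v w : Fin n, Tab n ρ 2 [↑u, ↑v, ↑w] ↔ w ∈ strongClosure G u v
  part : ∀ u v a w : Fin n, Tab n ρ 3 [↑u, ↑v, ↑a, ↑w] ↔ w ∈ partOf G (strongClosure G u v) a
  rep : ∀ u v a : Fin n, Tab n ρ 6 [↑u, ↑v, ↑a] ↔ a ∈ reps G (strongClosure G u v)
  iso : ∀ u v a b : Fin n, Tab n ρ 4 [↑u, ↑v, ↑a, ↑b] ↔ PartIso G (strongClosure G u v) a b

/-- The tables have the results for strong modules with at most `m` vertices. -/
def Solved (G : SimpleGraph (Fin n)) (ρ : Rel → List Bool) (m : ℕ) : Prop :=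
  ∀ u v : Fin n, (strongClosure G u v).ncard ≤ m →
    (Tab n ρ 5 [↑u, ↑v] ↔ HasFPFAut (G.induce (strongClosure G u v)))

open Classical in
/-- Some strong closure that is the part of `a` in `X` has a positive entry. -/
noncomputable def partBit (G : SimpleGraph (Fin n)) (ρ : Rel → List Bool) (X : Set (Fin n))
    (a : Fin n) : Bool :=
  decide (∃ a' : Fin n, Tab n ρ 5 [↑a, ↑a'] ∧ strongClosure G a a' = partOf G X a)

theorem flatMap_const_singleton {α β : Type*} (l : List α) (b : β) :
    (l.flatMap fun _ => [b]) = List.replicate l.length b := by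
  induction l with
  | nil => rfl
  | cons x l ih => rw [List.flatMap_cons, ih]; rfl

theorem reps_filter (X : Set (Fin n)) (p : Fin n → Prop) [DecidablePred p] :
    (reps G X).filter (fun x => decide (p x)) = listOf {x | x ∈ reps G X ∧ p x} := by
  classical
  rw [reps, listOf, listOf, List.filter_filter]
  refine List.filter_congr fun x _ => ?_
  simp [and_comm]

/-- The unary colour of a representative has one symbol for each representative below all those with
an isomorphic part, which is `firstIdx`. -/
theorem eval_colorEm (h : TablesOK G ρ) (u v : Fin n) :
    colorEm.eval n ρ (assign e [0, 1] [↑u, ↑v]) =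
      encodeColoring (repColoring G (strongClosure G u v)) := by
  classical
  rw [encodeColoring_get _ (firstIdx (reps G (strongClosure G u v))
    (PartIso G (strongClosure G u v))) fun i => rfl, colorEm,
    eval_cat_guard {x | x ∈ strongClosure G u v ∧ ∀ b < x, b ∉ partOf G (strongClosure G u v) x}]
  · refine congrArg (List.flatMap · _) (funext fun x => ?_)
    rw [Em.eval, eval_cat_guard {y | y ∈ reps G (strongClosure G u v) ∧
      ∀ c ∈ reps G (strongClosure G u v), c ≤ y → ¬ PartIso G (strongClosure G u v) x c}]
    · simp only [Em.eval]
      rw [flatMap_const_singleton, firstIdx]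
      congr 3
      exact (@reps_filter _ _ _ (fun y => ∀ c ∈ reps G (strongClosure G u v), c ≤ y →
        ¬ PartIso G (strongClosure G u v) x c) fun _ => _).symm
    · intro y
      simp [assign, h.rep, h.iso]
  · intro x
    simp [assign, h.rep, mem_reps]

theorem eval_boolEm (h : TablesOK G ρ) (u v : Fin n) :
    boolEm.eval n ρ (assign e [0, 1] [↑u, ↑v]) =
      encodeBoolFun (fun i => partBit G ρ (strongClosure G u v)
        ((reps G (strongClosure G u v)).get i)) := by
  classical
  rw [encodeBoolFun_get, boolEm,
    eval_cat_guard {x | x ∈ strongClosure G u v ∧ ∀ b < x, b ∉ partOf G (strongClosure G u v) x},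
    List.map_eq_flatMap]
  · refine congrArg (List.flatMap · _) (funext fun x => ?_)
    refine congrArg (fun b => [some b]) ((eval_eq_decide ?_).trans (partBit.eq_1 ..).symm)
    simp [assign, h.strong, h.part, Set.ext_iff]
  · intro x
    simp [assign, h.rep, mem_reps]

theorem eval_fpfEm (h : TablesOK G ρ) (u v : Fin n) :
    (Em.seq (.seq (.subgraph (fun i => .rel 6 [0, 1, i]) 4 5) colorEm) boolEm).eval n ρ
        (assign e [0, 1] [↑u, ↑v]) =
      encodeGraph (sub G (reps G (strongClosure G u v))) ++
        encodeColoring (repColoring G (strongClosure G u v)) ++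
        encodeBoolFun (fun i => partBit G ρ (strongClosure G u v)
          ((reps G (strongClosure G u v)).get i)) := by
  rw [Em.eval, Em.eval, eval_colorEm h, eval_boolEm h, eval_subgraph (by decide)
    {x | x ∈ strongClosure G u v ∧ ∀ b < x, b ∉ partOf G (strongClosure G u v) x} h.adj]
  · rfl
  all_goals simp [assign, h.rep, mem_reps]

theorem nontrivial_strongClosure {u v : Fin n} (huv : u ≠ v) :
    Nontrivial (strongClosure G u v) :=
  ⟨⟨u, left_mem_strongClosure u v⟩, ⟨v, right_mem_strongClosure u v⟩,
    fun h => huv (congrArg Subtype.val h)⟩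

/-- Correctness of relation `5` is not required: as `b` may be arbitrary, the query is legal even in
early rounds, when the bits may still be wrong. `u ≠ v` provides the two vertices needed for a
quotient. -/
theorem OracleOK.fpf (hO : OracleOK 𝒢 n ans V) (h𝒢 : IsHereditary 𝒢)
    (hGm : (⟨n, G⟩ : FinGraph) ∈ 𝒢) (h : TablesOK G ρ) {u v : Fin n} (huv : u ≠ v) :
    V true ((Em.seq (.seq (.subgraph (fun i => .rel 6 [0, 1, i]) 4 5) colorEm) boolEm).eval n ρ
        (assign e [0, 1] [↑u, ↑v])) ∧
    (ans true ((Em.seq (.seq (.subgraph (fun i => .rel 6 [0, 1, i]) 4 5) colorEm) boolEm).eval n ρ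
        (assign e [0, 1] [↑u, ↑v])) = true ↔
      HasPFPFAut (sub G (reps G (strongClosure G u v))).graph
        (repColoring G (strongClosure G u v)) (fun i => partBit G ρ (strongClosure G u v)
          ((reps G (strongClosure G u v)).get i))) := by
  rw [eval_fpfEm h]
  have := nontrivial_strongClosure (G := G) huv
  exact hO.pfpf ⟨⟨_, sub_reps_mem h𝒢 hGm (isStrongModule_strongClosure u v)⟩,
    repColoring G _, fun i => partBit G ρ _ ((reps G _).get i)⟩ (length_le_of_nodup (nodup_listOf _))

theorem safe_fpfCmd (hO : OracleOK 𝒢 n ans V) (h𝒢 : IsHereditary 𝒢)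
    (hGm : (⟨n, G⟩ : FinGraph) ∈ 𝒢) (h : TablesOK G ρ) : fpfCmd.Safe n ans V e ρ := by
  intro xs hl hx hs
  obtain ⟨ys, rfl⟩ := exists_of_forall_lt hx
  obtain ⟨u, v, rfl⟩ : ∃ u v, ys = [u, v] := by
    rcases ys with _ | ⟨u, _ | ⟨v, _ | ⟨a, l⟩⟩⟩ <;> simp at hl ⊢
  change Sat n ρ _ _ at hs
  refine (hO.fpf h𝒢 hGm h ?_).1
  rintro rfl
  simp [assign] at hs

/-- The parts of a strong module with at most `m + 1` vertices are strong modules with at most `m`,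
so the bits handed to the oracle are already correct. -/
theorem solved_fpfCmd (hO : OracleOK 𝒢 n ans V) (h𝒢 : IsHereditary 𝒢)
    (hGm : (⟨n, G⟩ : FinGraph) ∈ 𝒢) (h : TablesOK G ρ) {m : ℕ} (hm : Solved G ρ m) :
    Solved G (fpfCmd.eval n ans e ρ) (m + 1) := by
  intro u v huv
  refine (tab_update_self (xs := [u, v]) rfl).trans ?_
  rw [Bool.and_eq_true]
  refine (and_congr_left' (b := u ≠ v) ?_).trans ?_
  · refine sat_not.trans (not_congr ?_)
    simp [assign, Fin.val_inj]
  by_cases hne : u = v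
  · subst hne
    -- A single vertex has no fixed point free automorphism, in accordance with the entry `false`
    -- produced by the guard.
    rw [strongClosure_self]
    refine iff_of_false (by simp) ?_
    rintro ⟨φ, hφ⟩
    exact hφ ⟨u, rfl⟩ (Subsingleton.elim _ _)
  rw [and_iff_right hne]
  have := nontrivial_strongClosure (G := G) hne
  have hX := isStrongModule_strongClosure (G := G) u v
  rw [hasFPFAut_induce_iff hX (partBit G ρ (strongClosure G u v)) fun a ha => ?_]
  · exact (hO.fpf h𝒢 hGm h hne).2
  have haX := (mem_reps.1 ha).1
  obtain ⟨⟨P, hP⟩, haP⟩ := exists_part (G := G.induce (strongClosure G u v)) ⟨a, haX⟩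
  have hPa := image_part_eq hX hP haP
  have hmax := (maximal_of_mem hP).prop
  have hstrong : IsStrongModule G (partOf G (strongClosure G u v) a) := by
    rw [← hPa]
    exact (isStrongModule_induce hX P).1 hmax.1
  have ha' : a ∈ partOf G (strongClosure G u v) a := by
    rw [← hPa]; exact ⟨_, haP, rfl⟩
  -- A part is not the whole module, so it has strictly fewer vertices.
  have hlt : (partOf G (strongClosure G u v) a).ncard ≤ m := by
    refine Nat.lt_succ_iff.1 ((Set.ncard_lt_ncard ?_ (Set.toFinite _)).trans_le huv)
    refine ⟨fun w hw => hw.1, fun hsub => hmax.2.2 ?_⟩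
    refine Set.eq_univ_of_forall fun x => ?_
    have := hsub x.2
    rw [← hPa] at this
    obtain ⟨y, hy, hyx⟩ := this
    rwa [← Subtype.ext hyx]
  refine (@decide_eq_true_iff _ (_)).trans ?_
  constructor
  · rintro ⟨a', h1, h2⟩
    rw [← h2]
    exact (hm a a' (by rwa [h2])).1 h1
  · intro h1
    -- The part is a strong module through `a`, so it has an entry in the table in row `a`.
    obtain ⟨a', h2⟩ := hstrong.exists_eq_strongClosure ha'
    exact ⟨a', (hm a a' (by rwa [h2])).2 (by rwa [h2]), h2⟩

end Correctness

end FPFAut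

/-! ### Correctness of the whole algorithm and of the input format. -/

namespace FPFAut

open Function

section Correctness

variable {n : ℕ} {G : SimpleGraph (Fin n)} {ans : Bool → List Symb → Bool}
  {ρ : Rel → List Bool} {e : Var → ℕ} {𝒢 : Set FinGraph} {V : Bool → List Symb → Prop}

theorem loop_induction {α : Type*} {f : ℕ → α → α} {a : α} {P : ℕ → α → Prop} (h0 : P 0 a)
    (hs : ∀ m x, P m x → P (m + 1) (f m x)) (m : ℕ) : P m (Cmd.loop f a m) := by
  induction m with
  | zero => exact h0
  | succ m ih => exact hs m _ ih

/-- If one command applies `F` to all the sets stored in `a` and leaves the other tables alone, then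
`n` rounds compute `F^[n]` of all pairs simultaneously. -/
theorem tab_closure {a : Rel} {c : Cmd Bool} {F : Set (Fin n) → Set (Fin n)}
    (hc : ∀ e σ b, b ≠ a → c.eval n ans e σ b = σ b)
    (hF : ∀ e σ (S : Fin n → Fin n → Set (Fin n)), (∀ b ≠ a, σ b = ρ b) →
      (∀ u v w : Fin n, Tab n σ a [↑u, ↑v, ↑w] ↔ w ∈ S u v) →
      ∀ u v w : Fin n, Tab n (c.eval n ans e σ) a [↑u, ↑v, ↑w] ↔ w ∈ F (S u v)) :
    (∀ b ≠ a, (Cmd.seq (pairCmd a) (.iter 12 c)).eval n ans e ρ b = ρ b) ∧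
    ∀ u v w : Fin n, Tab n ((Cmd.seq (pairCmd a) (.iter 12 c)).eval n ans e ρ) a [↑u, ↑v, ↑w] ↔
      w ∈ F^[n] {u, v} := by
  refine loop_induction (P := fun m σ => (∀ b ≠ a, σ b = ρ b) ∧
    ∀ u v w : Fin n, Tab n σ a [↑u, ↑v, ↑w] ↔ w ∈ F^[m] {u, v}) ⟨fun b hb => ?_, ?_⟩ ?_ n
  · exact update_of_ne hb _ _
  · exact tab_pairCmd a
  · rintro m σ ⟨h1, h2⟩
    refine ⟨fun b hb => (hc _ _ b hb).trans (h1 b hb), fun u v w => ?_⟩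
    rw [iterate_succ_apply']
    exact hF _ σ (fun u v => F^[m] {u, v}) h1 h2 u v w

theorem tablesOK (hO : OracleOK 𝒢 n ans V) (h𝒢 : IsHereditary 𝒢)
    (hGm : (⟨n, G⟩ : FinGraph) ∈ 𝒢) (hG : ∀ x y : Fin n, Tab n ρ 0 [↑x, ↑y] ↔ G.Adj x y) :
    tablesCmd.Safe n ans V e ρ ∧ TablesOK G (tablesCmd.eval n ans e ρ) := by
  obtain ⟨h1, hM⟩ := tab_closure (ρ := ρ) (ans := ans) (e := e) (a := 1) (c := modCmd)
    (F := splitStep G) (fun e σ b hb => update_of_ne hb _ _) fun e σ S hσ hS =>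
      tab_modCmd (fun x y => (tab_congr (hσ 0 (by decide)) _).trans (hG x y)) hS
  set ρ₁ := (Cmd.seq (pairCmd 1) (.iter 12 modCmd)).eval n ans e ρ
  have hG₁ : ∀ x y : Fin n, Tab n ρ₁ 0 [↑x, ↑y] ↔ G.Adj x y := fun x y =>
    (tab_congr (h1 0 (by decide)) _).trans (hG x y)
  have hM₁ : ∀ u v w : Fin n, Tab n ρ₁ 1 [↑u, ↑v, ↑w] ↔ w ∈ modClosure G u v := by
    simpa only [modClosure, Fintype.card_fin] using hM
  obtain ⟨h2, hS⟩ := tab_closure (ρ := ρ₁) (ans := ans) (e := e) (a := 2) (c := strongCmd)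
    (F := strongStep G) (fun e σ b hb => update_of_ne hb _ _) fun e σ S hσ hS =>
      tab_strongCmd (fun x y => (tab_congr (hσ 0 (by decide)) _).trans (hG₁ x y))
        (fun u v w => (tab_congr (hσ 1 (by decide)) _).trans (hM₁ u v w)) hS
  set ρ₂ := (Cmd.seq (pairCmd 2) (.iter 12 strongCmd)).eval n ans e ρ₁
  have hS₂ : ∀ u v w : Fin n, Tab n ρ₂ 2 [↑u, ↑v, ↑w] ↔ w ∈ strongClosure G u v := by
    simpa only [strongClosure, Fintype.card_fin] using hS
  have hG₂ : ∀ x y : Fin n, Tab n ρ₂ 0 [↑x, ↑y] ↔ G.Adj x y := fun x y =>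
    (tab_congr (h2 0 (by decide)) _).trans (hG₁ x y)
  set ρ₃ := partCmd.eval n ans e ρ₂ with hρ₃
  have h3 : ∀ b ≠ 3, ρ₃ b = ρ₂ b := fun b hb => update_of_ne hb _ _
  have hS₃ : ∀ u v w : Fin n, Tab n ρ₃ 2 [↑u, ↑v, ↑w] ↔ w ∈ strongClosure G u v :=
    fun u v w => (tab_congr (h3 2 (by decide)) _).trans (hS₂ u v w)
  set ρ₄ := repCmd.eval n ans e ρ₃ with hρ₄
  have h4 : ∀ b ≠ 6, ρ₄ b = ρ₃ b := fun b hb => update_of_ne hb _ _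
  have hG₄ : ∀ x y : Fin n, Tab n ρ₄ 0 [↑x, ↑y] ↔ G.Adj x y := fun x y =>
    (tab_congr ((h4 0 (by decide)).trans (h3 0 (by decide))) _).trans (hG₂ x y)
  have hP₄ : ∀ u v a w : Fin n, Tab n ρ₄ 3 [↑u, ↑v, ↑a, ↑w] ↔
      w ∈ partOf G (strongClosure G u v) a :=
    fun u v a w => (tab_congr (h4 3 (by decide)) _).trans (tab_partCmd hS₂ u v a w)
  have h5 : ∀ b ≠ 4, isoCmd.eval n ans e ρ₄ b = ρ₄ b := fun b hb => update_of_ne hb _ _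
  refine ⟨⟨⟨⟨⟨⟨trivial, fun _ _ => trivial⟩, ⟨trivial, fun _ _ => trivial⟩⟩, trivial⟩, trivial⟩,
    safe_isoCmd hO h𝒢 hGm hG₄ hP₄⟩, ?_⟩
  change TablesOK G (isoCmd.eval n ans e ρ₄)
  exact
    { adj := fun x y => (tab_congr (h5 0 (by decide)) _).trans (hG₄ x y)
      strong := fun u v w => (tab_congr ((h5 2 (by decide)).trans (h4 2 (by decide))) _).trans
        (hS₃ u v w)
      part := fun u v a w => (tab_congr (h5 3 (by decide)) _).trans (hP₄ u v a w)
      rep := fun u v a => (tab_congr (h5 6 (by decide)) _).trans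
        (tab_repCmd hS₃ (fun u v a w => (tab_congr rfl _).trans (tab_partCmd hS₂ u v a w)) u v a)
      iso := tab_isoCmd hO h𝒢 hGm hG₄ hP₄ }

theorem TablesOK.congr {ρ' : Rel → List Bool} (h : TablesOK G ρ) (h' : ∀ b ≠ 5, ρ' b = ρ b) :
    TablesOK G ρ' where
  adj x y := (tab_congr (h' 0 (by decide)) _).trans (h.adj x y)
  strong u v w := (tab_congr (h' 2 (by decide)) _).trans (h.strong u v w)
  part u v a w := (tab_congr (h' 3 (by decide)) _).trans (h.part u v a w)
  rep u v a := (tab_congr (h' 6 (by decide)) _).trans (h.rep u v a)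
  iso u v a b := (tab_congr (h' 4 (by decide)) _).trans (h.iso u v a b)

theorem solved_mainCmd (hO : OracleOK 𝒢 n ans V) (h𝒢 : IsHereditary 𝒢)
    (hGm : (⟨n, G⟩ : FinGraph) ∈ 𝒢) (hG : ∀ x y : Fin n, Tab n ρ 0 [↑x, ↑y] ↔ G.Adj x y) :
    mainCmd.Safe n ans V e ρ ∧ TablesOK G (mainCmd.eval n ans e ρ) ∧
      Solved G (mainCmd.eval n ans e ρ) n := by
  obtain ⟨h1, h2⟩ := tablesOK (e := e) hO h𝒢 hGm hG
  have key := loop_induction (f := fun m ρ => fpfCmd.eval n ans (update e 12 m) ρ)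
    (a := tablesCmd.eval n ans e ρ) (P := fun m σ => TablesOK G σ ∧ Solved G σ m)
    ⟨h2, fun u v huv => ?_⟩ fun m σ hσ =>
      ⟨hσ.1.congr fun b hb => update_of_ne hb _ _, solved_fpfCmd hO h𝒢 hGm hσ.1 hσ.2⟩
  · exact ⟨⟨h1, fun m _ => safe_fpfCmd hO h𝒢 hGm (key m).1⟩, key n⟩
  -- Before the first round nothing is claimed, since closures are nonempty.
  · have := (Set.ncard_pos (Set.toFinite _)).2 ⟨u, left_mem_strongClosure (G := G) u v⟩
    omega

/-- The whole vertex set is a strong module, so for a nonempty graph it is the closure of some pair.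
The empty graph is a yes-instance and has to be treated separately, having no pairs. -/
theorem sat_answerFm (h : TablesOK G ρ) (h' : Solved G ρ n) :
    Sat n ρ answerFm e ↔ HasFPFAut G := by
  have h1 : ∀ u v : Fin n, Tab n ρ 5 [↑u, ↑v] ↔ HasFPFAut (G.induce (strongClosure G u v)) :=
    fun u v => h' u v (by simpa using Set.ncard_le_card (strongClosure G u v))
  have h2 : Sat n ρ answerFm e ↔
      IsEmpty (Fin n) ∨ ∃ u v : Fin n, strongClosure G u v = Set.univ ∧
        HasFPFAut (G.induce (strongClosure G u v)) := by
    simp [answerFm, h1, h.strong, Set.eq_univ_iff_forall]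
  rw [h2]
  rcases isEmpty_or_nonempty (Fin n) with hn | ⟨⟨u⟩⟩
  · exact iff_of_true (.inl hn) ⟨SimpleGraph.Iso.refl, isEmptyElim⟩
  · have f : G.induce Set.univ ≃g G := SimpleGraph.induceUnivIso G
    constructor
    · rintro (hn | ⟨u, v, huv, hfpf⟩)
      · exact hn.elim u
      · rw [huv] at hfpf
        exact hfpf.of_iso f
    · intro hfpf
      obtain ⟨v, hv⟩ := (isStrongModule_univ (G := G)).exists_eq_strongClosure (Set.mem_univ u)
      refine .inr ⟨u, v, hv, ?_⟩
      rw [hv]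
      exact hfpf.of_iso f.symm

/-! ### The input -/

open Classical in
/-- The entries of the adjacency matrix. -/
noncomputable def adjBits (G : SimpleGraph (Fin n)) : List Bool :=
  (List.finRange n).flatMap fun x => (List.finRange n).map fun y => decide (G.Adj x y)

theorem length_adjBits : (adjBits G).length = n ^ 2 := by
  simp [adjBits, List.length_flatMap, sq]

theorem encodeGraph_eq : encodeGraph ⟨n, G⟩ = ones n ++ [none] ++ (adjBits G).map some := by
  classical
  rw [encodeGraph, adjBits, List.map_flatMap, List.flatMap_def, ones]
  congr 2
  rw [List.ofFn_eq_map]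
  refine List.map_congr_left fun x _ => ?_
  rw [List.ofFn_eq_map, List.map_map]
  exact List.map_congr_left fun y _ => congrArg some (by congr)

theorem tab_adjBits (x y : Fin n) : Tab n (tab₀ (adjBits G)) 0 [↑x, ↑y] ↔ G.Adj x y := by
  classical
  -- Adjacency is extended to all natural numbers so that the block lemma for `List.range` applies.
  have h : adjBits G = (List.range n).flatMap fun x => (List.range n).map fun y =>
      decide (∃ (hx : x < n) (hy : y < n), G.Adj ⟨x, hx⟩ ⟨y, hy⟩) := by
    rw [adjBits, ← List.map_coe_finRange_eq_range, List.flatMap_map]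
    refine congrArg (List.flatMap · _) (funext fun x => ?_)
    rw [List.map_map]
    refine List.map_congr_left fun y _ => ?_
    simp
  have h' := getD_flatMap_range (fun x => (List.range n).map fun y =>
      decide (∃ (hx : x < n) (hy : y < n), G.Adj ⟨x, hx⟩ ⟨y, hy⟩)) n (by simp) false n x y x.2 y.2
  rw [← h] at h'
  simp only [Tab, tab₀, update_self, pos, List.length_singleton, List.length_nil, pow_one, pow_zero,
    mul_one, add_zero, h']
  simp [List.getD_eq_getElem?_getD]

end Correctness

end FPFAut

/-! ### Oracle answers and the final assembly. -/

namespace FPFAut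

open Turing Function

/-! ### Running oracle machines -/

theorem iterate_eq_of_halts {α : Type*} {f : α → Option α} {a b b' : α} {s s' : ℕ}
    (h : (flip Option.bind f)^[s] (some a) = some b)
    (h' : (flip Option.bind f)^[s'] (some a) = some b') (hb : f b = none) (hss : s ≤ s') :
    b = b' := by
  obtain ⟨d, rfl⟩ := Nat.exists_eq_add_of_le hss
  rw [Nat.add_comm, iterate_add_apply, h] at h'
  cases d with
  | zero => exact Option.some.inj h'
  | succ d =>
    rw [iterate_succ_apply] at h'
    have h0 : flip Option.bind f (some b) = none := hb
    rw [h0] at h'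
    exact absurd ((iterate_flip_bind_none f d).symm.trans h') (by simp)

theorem ReachesIn.eq_of_halts {α : Type*} {f : α → Option α} {a b b' : α} {t t' : ℕ}
    (h : ReachesIn f a b t) (h' : ReachesIn f a b' t') (hb : f b = none) (hb' : f b' = none) :
    b = b' := by
  obtain ⟨h⟩ := h
  obtain ⟨h'⟩ := h'
  rcases le_total h.steps h'.steps with hs | hs
  · exact iterate_eq_of_halts h.evals_in_steps h'.evals_in_steps hb hs
  · exact (iterate_eq_of_halts h'.evals_in_steps h.evals_in_steps hb' hs).symm

theorem ReachesIn.pos {α : Type*} {f : α → Option α} {a b : α} {t : ℕ} (h : ReachesIn f a b t)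
    (hab : a ≠ b) : 1 ≤ t := by
  obtain ⟨h⟩ := h
  refine Nat.one_le_iff_ne_zero.2 fun ht => hab ?_
  have h0 := Nat.le_zero.1 (h.steps_le_m.trans_eq ht)
  have := h.evals_in_steps
  rw [h0] at this
  exact Option.some.inj this

section Oracles

variable {O : Type} {M : O → TM2ComputableAux Symb Bool} {o : O} {w : List Symb} {b b' : Bool}
  {t t' : ℕ}

/-- The machine is deterministic and a halting configuration has no successor. -/
theorem Answers.unique (h : Answers M o w b t) (h' : Answers M o w b' t') : b = b' := by
  have h1 := ReachesIn.eq_of_halts h h' (by rw [haltList_eq]; rfl) (by rw [haltList_eq]; rfl)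
  rw [haltList_eq, haltList_eq] at h1
  have h2 := congrFun (congrArg TM2.Cfg.stk h1) (M o).tm.k₁
  simpa using h2

theorem Answers.mono (h : Answers M o w b t) (ht : t ≤ t') : Answers M o w b t' :=
  ReachesIn.mono h ht

theorem Answers.pos (h : Answers M o w b t) : 1 ≤ t := by
  refine ReachesIn.pos h ?_
  rw [initList_eq, haltList_eq]
  exact fun h => absurd (congrArg TM2.Cfg.l h) (by simp)

end Oracles

/-- The answer function is defined on words by what the machines do. By uniqueness it is correct for
every instance with the given encoding, so injectivity of the encodings plays no role. -/
theorem exists_oracleOK {𝒢 : Set FinGraph} {M : Bool → TM2ComputableAux Symb Bool}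
    {fIso fPfpf : ℕ → ℕ} (n : ℕ)
    (h1 : ∀ x : (isoProblem 𝒢).Inst, (isoProblem 𝒢).size x ≤ n → ∃ b : Bool,
      (b = true ↔ (isoProblem 𝒢).IsYes x) ∧ Answers M false ((isoProblem 𝒢).encode x) b (fIso n))
    (h2 : ∀ x : (pfpfProblem (quotientClass 𝒢)).Inst, (pfpfProblem (quotientClass 𝒢)).size x ≤ n →
      ∃ b : Bool, (b = true ↔ (pfpfProblem (quotientClass 𝒢)).IsYes x) ∧
        Answers M true ((pfpfProblem (quotientClass 𝒢)).encode x) b (fPfpf n)) :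
    ∃ ans V, OracleOK 𝒢 n ans V ∧ ∀ o w, V o w → Answers M o w (ans o w) (fIso n + fPfpf n) := by
  classical
  have key : ∀ o w, ∃ b, (∃ b, Answers M o w b (fIso n + fPfpf n)) →
      Answers M o w b (fIso n + fPfpf n) := fun o w => by
    by_cases h : ∃ b, Answers M o w b (fIso n + fPfpf n)
    · exact ⟨h.choose, fun _ => h.choose_spec⟩
    · exact ⟨true, fun h' => absurd h' h⟩
  choose ans hans using key
  refine ⟨ans, fun o w => ∃ b, Answers M o w b (fIso n + fPfpf n), ⟨fun x hx => ?_, fun x hx => ?_⟩,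
    hans⟩
  · obtain ⟨b, hb, h⟩ := h1 x hx
    have h' := h.mono (Nat.le_add_right _ (fPfpf n))
    exact ⟨⟨b, h'⟩, by rw [(hans _ _ ⟨b, h'⟩).unique h', hb]⟩
  · obtain ⟨b, hb, h⟩ := h2 x hx
    have h' := h.mono (Nat.le_add_left _ (fIso n))
    exact ⟨⟨b, h'⟩, by rw [(hans _ _ ⟨b, h'⟩).unique h', hb]⟩

theorem eval_le_eval (p : Polynomial ℕ) {m n : ℕ} (h : m ≤ n) : p.eval m ≤ p.eval n := by
  rw [Polynomial.eval_eq_sum, Polynomial.eval_eq_sum]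
  exact Finset.sum_le_sum fun i _ => Nat.mul_le_mul_left _ (Nat.pow_le_pow_left h i)

end FPFAut

theorem mainTheorem9 :
    ∃ p : Polynomial ℕ, ∀ 𝒢 : Set FPFAut.FinGraph, FPFAut.IsHereditary 𝒢 →
      ∀ fIso fPfpf : ℕ → ℕ,
        FPFAut.DecidableInTime (FPFAut.isoProblem 𝒢) fIso →
        FPFAut.DecidableInTime (FPFAut.pfpfProblem (FPFAut.quotientClass 𝒢)) fPfpf →
        FPFAut.DecidableInTime (FPFAut.fpfProblem 𝒢)
          (fun n => p.eval n * (fIso n + fPfpf n)) := by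
  classical
  obtain ⟨p, hp⟩ := FPFAut.exec_prog FPFAut.mainCmd FPFAut.mainCmd_wf FPFAut.answerFm
    FPFAut.answerFm_wf FPFAut.mainCmd_bound FPFAut.answerFm_bound
  -- The summand `1` pays for the final output step, using `1 ≤ fIso N + fPfpf N`.
  refine ⟨p + 1, fun 𝒢 h𝒢 fIso fPfpf ⟨M₁, hM₁⟩ ⟨M₂, hM₂⟩ => ?_⟩
  let M : Bool → Turing.TM2ComputableAux FPFAut.Symb Bool := fun o =>
    bif o then M₂ else M₁
  refine ⟨FPFAut.machine M (FPFAut.prog FPFAut.mainCmd FPFAut.answerFm) .inp .res, ?_⟩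
  rintro N ⟨⟨n, G⟩, hG⟩ (hn : n ≤ N)
  -- Oracle times are taken at the bound `N` and not at the actual size `n`, as the time functions
  -- need not be monotone.
  obtain ⟨ans, V, hO, hV⟩ := FPFAut.exists_oracleOK (𝒢 := 𝒢) (M := M) N
    (fun x hx => ⟨_, decide_eq_true_iff, hM₁ N x hx⟩)
    (fun x hx => ⟨_, decide_eq_true_iff, hM₂ N x hx⟩)
  have hO' : FPFAut.OracleOK 𝒢 n ans V :=
    ⟨fun x hx => hO.iso x (hx.trans hn), fun x hx => hO.pfpf x (hx.trans hn)⟩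
  -- The empty graph belongs to the hereditary class, and even on the pair of empty graphs the
  -- isomorphism machine must make at least one step.
  have hT : 1 ≤ fIso N + fPfpf N := by
    have hE : (⟨0, ⊥⟩ : FPFAut.FinGraph) ∈ 𝒢 := h𝒢 _ hG _
      ⟨⟨⟨Fin.elim0, fun x => x.elim0⟩, fun {x} => x.elim0⟩⟩
    have h := (hO.iso ⟨⟨_, hE⟩, ⟨_, hE⟩⟩ (Nat.zero_le _)).1
    exact (hV _ _ h).pos
  obtain ⟨h1, h2, h3⟩ := FPFAut.solved_mainCmd (e := FPFAut.env₀ n) hO' h𝒢 hG FPFAut.tab_adjBits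
  have h4 := hp n _ ans V (FPFAut.adjBits G) hT hV FPFAut.length_adjBits.le h1
  have h5 : FPFAut.answerFm.eval n (FPFAut.mainCmd.eval n ans (FPFAut.env₀ n)
      (FPFAut.tab₀ (FPFAut.adjBits G))) (FPFAut.env₀ n) =
      decide ((FPFAut.fpfProblem 𝒢).IsYes ⟨⟨n, G⟩, hG⟩) :=
    FPFAut.eval_eq_decide (FPFAut.sat_answerFm h2 h3)
  rw [← FPFAut.encodeGraph_eq, h5] at h4
  obtain ⟨h6⟩ := FPFAut.machine_outputs M _ _ _ _ _ _ h4
  refine ⟨⟨h6.toEvalsTo, h6.steps_le_m.trans ?_⟩⟩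
  have h7 := Nat.mul_le_mul_right (fIso N + fPfpf N) (FPFAut.eval_le_eval p hn)
  simp only [Polynomial.eval_add, Polynomial.eval_one, Nat.add_mul]
  omega
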